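/- Let $n\ge 3$, $1<p\le \frac{2n}{n+2}$, $p'=\frac{p}{p-1}$, $T\in(0,\infty)$, and let $\Omega\subset\mathbb R^n$ be a bounded open set. Write $\Omega_S:=\Omega\times(0,S)$ for $S>0$. *Densities.* Let $E_1,E_p:\mathbb R^n\to[0,\infty)$ be convex, where $E_1\in C^0(\mathbb R^n)\cap C^2(\mathbb R^n\setminus\{0\})$ satisfies $E_1(kz)=kE_1(z)$ for all $z\in\mathbb R^n$, $k>0$, and $E_p\in C^1(\mathbb R^n)\cap C^2(\mathbb R^n\setminus\{0\})$ satisfies, for some constants $0<\lambda_0\le\Lambda_0<\infty$, $|\nabla E_p(z)|\le\Lambda_0|z|^{p-1}$ for all $z$ and $\lambda_0|z|^{p-2}\mathrm{id}\le\nabla^2E_p(z)\le\Lambda_0|z|^{p-2}\mathrm{id}$ for all $z\ne0$. Put $E:=E_1+E_p$. Let $\rho\in C_c^\infty(\mathbb R^n)$ be nonnegative and spherically symmetric, with $\int\rho=1$ and support equal to the closed unit ball, let $\rho_\varepsilon(z):=\varepsilon^{-n}\rho(z/\varepsilon)$, and $E^\varepsilon:=\rho_\varepsilon*E$ for $\varepsilon\in(0,1)$.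 *Spaces.* Let $V:=W^{1,p}(\Omega)\cap L^2(\Omega)$ and $V_0:=W^{1,p}_0(\Omega)\cap L^2(\Omega)$, normed by $\|\nabla v\|_{L^p}+\|v\|_{L^2}$ (or equivalently), and let $V_0'$ be the continuous dual of $V_0$, with $L^2(\Omega)$ embedded in $V_0'$ by the $L^2$ inner product. For $S>0$ let $$X^p(0,S;\Omega):=\{u\in L^p(0,S;V):\partial_tu\in L^{p'}(0,S;V_0')\},\qquad X^p_0(0,S;\Omega):=\{u\in L^p(0,S;V_0):\partial_tu\in L^{p'}(0,S;V_0')\}.$$ *Dirichlet problems.* Fix $u_\star\in X^p(0,T;\Omega)\cap C^0([0,T];L^2(\Omega))$. The weak solution $u_\varepsilon$ of $$\partial_tu_\varepsilon-\mathrm{div}(\nabla E^\varepsilon(\nabla u_\varepsilon))=0\ \text{ in }\Omega_T,\qquad u_\varepsilon=u_\star\ \text{ on }\partial_{\mathrm p}\Omega_T,$$ is the function $u_\varepsilon\in u_\star+X_0^p(0,T;\Omega)$ that satisfies the equation in $L^{p'}(0,T;V_0')$ and $(u_\varepsilon-u_\star)(\cdot,0)=0$ in $L^2(\Omega)$. For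 $S\in(0,T]$, a weak solution of $$\partial_tu-\mathrm{div}(\nabla E(\nabla u))=0\ \text{ in }\Omega_S,\qquad u=u_\star\ \text{ on }\partial_{\mathrm p}\Omega_S,\qquad(\mathrm D_S)$$ is a function $u\in X^p(0,S;\Omega)\cap C^0([0,S];L^2(\Omega))$ with $u\in u_\star+X_0^p(0,S;\Omega)$ and $(u-u_\star)(\cdot,0)=0$ in $L^2(\Omega)$, for which there is $Z\in L^\infty(\Omega_S;\mathbb R^n)$ such that $Z(x,t)\in\partial E_1(\nabla u(x,t))$ (the subdifferential) for a.e. $(x,t)\in\Omega_S$ and $$\int_0^S\langle\partial_tu,\varphi\rangle_{V_0',V_0}\,dt+\iint_{\Omega_S}\langle Z+\nabla E_p(\nabla u)\mid\nabla\varphi\rangle\,dx\,dt=0\quad\text{for all }\varphi\in X_0^p(0,S;\Omega).$$ **Proposition.** Let $\tau\in(0,T)$, and for each $\varepsilon\in(0,1)$ let $u_\varepsilon\in u_\star+X_0^p(0,T;\Omega)$ be the weak solution of the mollified Dirichlet problem above. Then there exist a decreasing sequence $(\varepsilon_k)_k\subset(0,1)$ with $\varepsilon_k\to0$ and a function $u_0\in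 u_\star+X_0^p(0,T;\Omega)$ such that $$\nabla u_{\varepsilon_k}\to\nabla u_0\quad\text{a.e. in }\Omega_{T-\tau}\text{ and strongly in }L^p(\Omega_{T-\tau};\mathbb R^n),$$ and $u_0$ is, on $\Omega_{T-\tau}$, the unique weak solution of $(\mathrm D_{T-\tau})$. -/

import Mathlib

open MeasureTheory Set Filter Topology
open scoped ENNReal ContDiff Gradient RealInnerProductSpace

noncomputable section

namespace OnePLaplace

/-- Euclidean space `ℝⁿ`. -/
abbrev Rn (n : ℕ) : Type := EuclideanSpace ℝ (Fin n)

instance factOneLe (p : ℝ) [h : Fact (1 < p)] : Fact (1 ≤ ENNReal.ofReal p) :=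
  ⟨by simpa using ENNReal.ofReal_le_ofReal h.out.le⟩

/-! ### Energy densities and their mollification -/

/-- The hypotheses on `E₁`: convex, nonnegative, continuous, of class `C²` away from the origin,
and positively one-homogeneous. -/
structure IsOneDensity {n : ℕ} (E₁ : Rn n → ℝ) : Prop where
  convex : ConvexOn ℝ univ E₁
  nonneg : ∀ z, 0 ≤ E₁ z
  continuous : Continuous E₁
  contDiffOn : ContDiffOn ℝ 2 E₁ {0}ᶜ
  homogeneous : ∀ (z : Rn n) (k : ℝ), 0 < k → E₁ (k • z) = k * E₁ z

/-- The hypotheses on `E_p`: convex, nonnegative, of class `C¹`, of class `C²` away from the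
origin, `|∇E_p(z)| ≤ Λ₀|z|^{p-1}`, and `λ₀|z|^{p-2} id ≤ ∇²E_p(z) ≤ Λ₀|z|^{p-2} id` for
`z ≠ 0`, where `0 < λ₀ ≤ Λ₀`. -/
structure IsPDensity {n : ℕ} (p lam₀ Lam₀ : ℝ) (Eₚ : Rn n → ℝ) : Prop where
  convex : ConvexOn ℝ univ Eₚ
  nonneg : ∀ z, 0 ≤ Eₚ z
  contDiff : ContDiff ℝ 1 Eₚ
  contDiffOn : ContDiffOn ℝ 2 Eₚ {0}ᶜ
  lam_pos : 0 < lam₀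
  lam_le : lam₀ ≤ Lam₀
  norm_gradient_le : ∀ z, ‖∇ Eₚ z‖ ≤ Lam₀ * ‖z‖ ^ (p - 1)
  hessian_ge : ∀ z, z ≠ 0 → ∀ ξ : Rn n,
    lam₀ * ‖z‖ ^ (p - 2) * ‖ξ‖ ^ 2 ≤ fderiv ℝ (fderiv ℝ Eₚ) z ξ ξ
  hessian_le : ∀ z, z ≠ 0 → ∀ ξ : Rn n,
    fderiv ℝ (fderiv ℝ Eₚ) z ξ ξ ≤ Lam₀ * ‖z‖ ^ (p - 2) * ‖ξ‖ ^ 2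

/-- The kernel of the Friedrichs mollifier: a nonnegative, spherically symmetric, smooth function
with integral one whose support is the closed unit ball. -/
structure IsMollifier {n : ℕ} (ρ : Rn n → ℝ) : Prop where
  contDiff : ContDiff ℝ ∞ ρ
  nonneg : ∀ z, 0 ≤ ρ z
  radial : ∀ z w, ‖z‖ = ‖w‖ → ρ z = ρ w
  integral_eq_one : ∫ z, ρ z = 1
  support_eq : tsupport ρ = Metric.closedBall 0 1

/-- `(ρ_ε * F)(z) = ∫ ρ_ε(y) F(z - y) dy` with `ρ_ε(y) = ε^{-n} ρ(y/ε)`. -/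
def mollify {n : ℕ} (ρ : Rn n → ℝ) (ε : ℝ) (F : Rn n → ℝ) (z : Rn n) : ℝ :=
  ∫ y, (ε ^ n)⁻¹ * ρ (ε⁻¹ • y) * F (z - y)

/-- The relaxed energy density `E^ε = ρ_ε * E₁ + ρ_ε * E_p`. -/
def relaxedDensity {n : ℕ} (ρ : Rn n → ℝ) (E₁ Eₚ : Rn n → ℝ) (ε : ℝ) (z : Rn n) : ℝ :=
  mollify ρ ε E₁ z + mollify ρ ε Eₚ z

/-- The subdifferential `∂F(z)`. -/
def subdifferential {n : ℕ} (F : Rn n → ℝ) (z : Rn n) : Set (Rn n) :=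
  {ζ | ∀ w, F z + ⟪ζ, w - z⟫ ≤ F w}

/-! ### The spaces `V = W^{1,p}(Ω) ∩ L²(Ω)` and `V₀ = W₀^{1,p}(Ω) ∩ L²(Ω)` -/

/-- `g` is the gradient of `v` in the sense of distributions in `Ω`. -/
def HasWeakGradient {n : ℕ} (Ω : Set (Rn n)) (v : Rn n → ℝ) (g : Rn n → Rn n) : Prop :=
  ∀ φ : Rn n → ℝ, ContDiff ℝ ∞ φ → HasCompactSupport φ → tsupport φ ⊆ Ω →
    ∫ x in Ω, v x • ∇ φ x = -∫ x in Ω, φ x • g x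

/-- The ambient Banach space `L²(Ω) × L^p(Ω; ℝⁿ)` of pairs (function, gradient). -/
abbrev Pairs {n : ℕ} (Ω : Set (Rn n)) (p : ℝ) : Type :=
  Lp ℝ 2 (volume.restrict Ω) × Lp (Rn n) (ENNReal.ofReal p) (volume.restrict Ω)

lemma integrable_smul_gradient {n : ℕ} {Ω : Set (Rn n)} (v : Lp ℝ 2 (volume.restrict Ω))
    {φ : Rn n → ℝ} (h : ContDiff ℝ ∞ φ) (hc : HasCompactSupport φ) :
    Integrable (fun x => v x • ∇ φ x) (volume.restrict Ω) := by
  have hcont : Continuous (∇ φ) :=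
    (InnerProductSpace.toDual ℝ (Rn n)).symm.continuous.comp (h.continuous_fderiv (by simp))
  have hcs : HasCompactSupport (∇ φ) := by
    have := hc.fderiv (𝕜 := ℝ)
    exact this.comp_left (g := (InnerProductSpace.toDual ℝ (Rn n)).symm) (map_zero _)
  exact ((Lp.memLp v).locallyIntegrable (by norm_num)).integrable_smul_right_of_hasCompactSupport
    hcont hcs

lemma integrable_smul_grad {n : ℕ} {Ω : Set (Rn n)} {p : ℝ} [Fact (1 < p)]
    (g : Lp (Rn n) (ENNReal.ofReal p) (volume.restrict Ω))
    {φ : Rn n → ℝ} (h : ContDiff ℝ ∞ φ) (hc : HasCompactSupport φ) :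
    Integrable (fun x => φ x • g x) (volume.restrict Ω) :=
  ((Lp.memLp g).locallyIntegrable
    (factOneLe p).out).integrable_smul_left_of_hasCompactSupport h.continuous hc

/-- `V = W^{1,p}(Ω) ∩ L²(Ω)`; an element is recorded together with its weak gradient (which it
determines). The norm `max (‖v‖_{L²}) (‖∇v‖_{L^p})` is equivalent to the sum of the two. -/
def V {n : ℕ} (Ω : Set (Rn n)) (p : ℝ) [Fact (1 < p)] : Submodule ℝ (Pairs Ω p) where
  carrier := {w | MemLp w.1 (ENNReal.ofReal p) (volume.restrict Ω) ∧ HasWeakGradient Ω w.1 w.2}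
  zero_mem' := by
    refine ⟨(memLp_congr_ae (Lp.coeFn_zero _ _ _)).2 MemLp.zero, fun φ _ _ _ => ?_⟩
    have h1 : ∫ x in Ω, ((0 : Pairs Ω p).1 x) • ∇ φ x = 0 :=
      integral_eq_zero_of_ae ((Lp.coeFn_zero ℝ 2 (volume.restrict Ω)).mono
        fun x hx => by
          have : ((0 : Pairs Ω p).1 x) = 0 := hx
          simp only [this, zero_smul, Pi.zero_apply])
    have h2 : ∫ x in Ω, φ x • ((0 : Pairs Ω p).2 x) = 0 :=
      integral_eq_zero_of_ae ((Lp.coeFn_zero (Rn n) (ENNReal.ofReal p) (volume.restrict Ω)).mono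
        fun x hx => by
          have : ((0 : Pairs Ω p).2 x) = 0 := hx
          simp only [this, smul_zero, Pi.zero_apply])
    rw [h1, h2, neg_zero]
  add_mem' := by
    rintro a b ⟨ha, ha'⟩ ⟨hb, hb'⟩
    refine ⟨(memLp_congr_ae (Lp.coeFn_add a.1 b.1)).2 (ha.add hb), fun φ h hc hs => ?_⟩
    have h1 : ∫ x in Ω, ((a + b).1 x) • ∇ φ x
        = ∫ x in Ω, (a.1 x • ∇ φ x + b.1 x • ∇ φ x) :=
      integral_congr_ae ((Lp.coeFn_add a.1 b.1).mono fun x hx => by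
        simp only [Prod.fst_add, hx, Pi.add_apply, add_smul])
    have h2 : ∫ x in Ω, φ x • ((a + b).2 x) = ∫ x in Ω, (φ x • a.2 x + φ x • b.2 x) :=
      integral_congr_ae ((Lp.coeFn_add a.2 b.2).mono fun x hx => by
        simp only [Prod.snd_add, hx, Pi.add_apply, smul_add])
    rw [h1, h2, integral_add (integrable_smul_gradient _ h hc) (integrable_smul_gradient _ h hc),
      integral_add (integrable_smul_grad _ h hc) (integrable_smul_grad _ h hc),
      ha' φ h hc hs, hb' φ h hc hs, neg_add]
  smul_mem' := by
    rintro c a ⟨ha, ha'⟩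
    refine ⟨(memLp_congr_ae (Lp.coeFn_smul c a.1)).2 (ha.const_smul c), fun φ h hc hs => ?_⟩
    have h1 : ∫ x in Ω, ((c • a).1 x) • ∇ φ x = ∫ x in Ω, c • (a.1 x • ∇ φ x) :=
      integral_congr_ae ((Lp.coeFn_smul c a.1).mono fun x hx => by
        simp only [Prod.smul_fst, hx, Pi.smul_apply, smul_assoc])
    have h2 : ∫ x in Ω, φ x • ((c • a).2 x) = ∫ x in Ω, c • (φ x • a.2 x) :=
      integral_congr_ae ((Lp.coeFn_smul c a.2).mono fun x hx => by
        simp only [Prod.smul_snd, hx, Pi.smul_apply]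
        exact smul_comm _ _ _)
    rw [h1, h2, integral_smul, integral_smul, ha' φ h hc hs, smul_neg]

/-- The pair `(v, g)` is a limit in `W^{1,p}(Ω)` of pairs `(φ, ∇φ)` with `φ ∈ C_c^1(Ω)`,
that is, `v ∈ W₀^{1,p}(Ω)` and `g = ∇v`. -/
def IsW0 {n : ℕ} (Ω : Set (Rn n)) (p : ℝ) (v : Rn n → ℝ) (g : Rn n → Rn n) : Prop :=
  ∃ φ : ℕ → Rn n → ℝ,
    (∀ k, ContDiff ℝ 1 (φ k) ∧ HasCompactSupport (φ k) ∧ tsupport (φ k) ⊆ Ω) ∧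
    Tendsto (fun k => eLpNorm (fun x => φ k x - v x) (ENNReal.ofReal p) (volume.restrict Ω))
      atTop (𝓝 0) ∧
    Tendsto (fun k => eLpNorm (fun x => ∇ (φ k) x - g x) (ENNReal.ofReal p) (volume.restrict Ω))
      atTop (𝓝 0)

lemma IsW0.add {n : ℕ} {Ω : Set (Rn n)} {p : ℝ} [Fact (1 < p)] {v w : Rn n → ℝ}
    {g k : Rn n → Rn n}
    (hv : AEStronglyMeasurable v (volume.restrict Ω))
    (hw : AEStronglyMeasurable w (volume.restrict Ω))
    (hg : AEStronglyMeasurable g (volume.restrict Ω))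
    (hk : AEStronglyMeasurable k (volume.restrict Ω))
    (h1 : IsW0 Ω p v g) (h2 : IsW0 Ω p w k) : IsW0 Ω p (v + w) (g + k) := by
  obtain ⟨φ, hφ, a, b⟩ := h1
  obtain ⟨ψ, hψ, c, d⟩ := h2
  have hgrad : ∀ f : Rn n → ℝ, ContDiff ℝ 1 f → Continuous (∇ f) := fun f hf =>
    (InnerProductSpace.toDual ℝ (Rn n)).symm.continuous.comp (hf.continuous_fderiv (by simp))
  refine ⟨fun i => φ i + ψ i, fun i => ⟨(hφ i).1.add (hψ i).1, (hφ i).2.1.add (hψ i).2.1,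
    (tsupport_add _ _).trans (union_subset (hφ i).2.2 (hψ i).2.2)⟩, ?_, ?_⟩
  · refine tendsto_of_tendsto_of_tendsto_of_le_of_le tendsto_const_nhds
      (by simpa using a.add c) (fun _ => zero_le) fun i => ?_
    refine le_trans (le_of_eq ?_) (eLpNorm_add_le
      ((hφ i).1.continuous.aestronglyMeasurable.sub hv)
      ((hψ i).1.continuous.aestronglyMeasurable.sub hw) (factOneLe p).out)
    congr 1
    funext x
    simp only [Pi.add_apply]
    ring
  · refine tendsto_of_tendsto_of_tendsto_of_le_of_le tendsto_const_nhds
      (by simpa using b.add d) (fun _ => zero_le) fun i => ?_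
    refine le_trans (le_of_eq ?_) (eLpNorm_add_le
      ((hgrad _ (hφ i).1).aestronglyMeasurable.sub hg)
      ((hgrad _ (hψ i).1).aestronglyMeasurable.sub hk) (factOneLe p).out)
    congr 1
    funext x
    have : ∇ (φ i + ψ i) x = ∇ (φ i) x + ∇ (ψ i) x := by
      simp only [gradient, fderiv_add ((hφ i).1.differentiable (by simp) x)
        ((hψ i).1.differentiable (by simp) x), map_add]
    simp only [Pi.add_apply, this]
    abel

lemma IsW0.smul {n : ℕ} {Ω : Set (Rn n)} {p : ℝ} {v : Rn n → ℝ} {g : Rn n → Rn n}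
    (c : ℝ) (h : IsW0 Ω p v g) : IsW0 Ω p (c • v) (c • g) := by
  obtain ⟨φ, hφ, a, b⟩ := h
  refine ⟨fun i => c • φ i, fun i => ⟨contDiff_const.smul (hφ i).1, (hφ i).2.1.smul_left,
    (tsupport_smul_subset_right (fun _ => c) (φ i)).trans (hφ i).2.2⟩, ?_, ?_⟩
  · have e : ∀ i, (fun x => (c • φ i) x - (c • v) x) = c • fun x => φ i x - v x := fun i => by
      funext x; simp only [Pi.smul_apply, smul_sub]
    simp only [e, eLpNorm_const_smul]
    simpa using ENNReal.Tendsto.const_mul a (Or.inr (by simp))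
  · have e : ∀ i, (fun x => ∇ (c • φ i) x - (c • g) x) = c • fun x => ∇ (φ i) x - g x := fun i => by
      funext x
      have : ∇ (c • φ i) x = c • ∇ (φ i) x := by
        simp only [gradient, fderiv_const_smul ((hφ i).1.differentiable (by simp) x), map_smul]
      simp only [Pi.smul_apply, this, smul_sub]
    simp only [e, eLpNorm_const_smul]
    simpa using ENNReal.Tendsto.const_mul b (Or.inr (by simp))

lemma IsW0.congr {n : ℕ} {Ω : Set (Rn n)} {p : ℝ} {v w : Rn n → ℝ} {g k : Rn n → Rn n}
    (hv : v =ᵐ[volume.restrict Ω] w) (hg : g =ᵐ[volume.restrict Ω] k)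
    (h : IsW0 Ω p v g) : IsW0 Ω p w k := by
  obtain ⟨φ, hφ, a, b⟩ := h
  refine ⟨φ, hφ, a.congr fun i => eLpNorm_congr_ae ?_, b.congr fun i => eLpNorm_congr_ae ?_⟩
  · filter_upwards [hv] with x hx using by rw [hx]
  · filter_upwards [hg] with x hx using by rw [hx]

/-- `V₀ = W₀^{1,p}(Ω) ∩ L²(Ω)`, as a subspace of `L²(Ω) × L^p(Ω; ℝⁿ)` (see `V`). -/
def V₀ {n : ℕ} (Ω : Set (Rn n)) (p : ℝ) [Fact (1 < p)] : Submodule ℝ (Pairs Ω p) where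
  carrier := {w | w ∈ V Ω p ∧ IsW0 Ω p w.1 w.2}
  zero_mem' := by
    refine ⟨zero_mem _, IsW0.congr (v := 0) (g := 0) (Lp.coeFn_zero _ _ _).symm
      (Lp.coeFn_zero _ _ _).symm ⟨fun _ => 0, fun _ => ⟨contDiff_const, HasCompactSupport.zero,
        by simp [tsupport]⟩, ?_, ?_⟩⟩
    · simp
    · simp [gradient]
  add_mem' := by
    rintro a b ⟨ha, ha'⟩ ⟨hb, hb'⟩
    exact ⟨add_mem ha hb, (ha'.add (Lp.aestronglyMeasurable _) (Lp.aestronglyMeasurable _)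
      (Lp.aestronglyMeasurable _) (Lp.aestronglyMeasurable _) hb').congr
      (Lp.coeFn_add a.1 b.1).symm (Lp.coeFn_add a.2 b.2).symm⟩
  smul_mem' := by
    rintro c a ⟨ha, ha'⟩
    exact ⟨Submodule.smul_mem _ c ha, (ha'.smul c).congr
      (Lp.coeFn_smul c a.1).symm (Lp.coeFn_smul c a.2).symm⟩

/-- The dual `V₀'`. -/
abbrev V₀Dual {n : ℕ} (Ω : Set (Rn n)) (p : ℝ) [Fact (1 < p)] : Type := StrongDual ℝ (V₀ Ω p)

/-! ### The parabolic spaces `X^p(0,T;Ω)` and `X₀^p(0,T;Ω)`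

Elements of `L^p(0,T;V)` are functions `u : ℝ → V`, of which only the values on `(0,T)` matter,
almost everywhere. -/

/-- Lebesgue measure on `(0,T)`. -/
abbrev timeMeasure (T : ℝ) : Measure ℝ := volume.restrict (Ioo 0 T)

/-- The space-time cylinder `Ω_T = Ω × (0,T)`. -/
abbrev spaceTime {n : ℕ} (Ω : Set (Rn n)) (T : ℝ) : Set (Rn n × ℝ) := Ω ×ˢ Ioo 0 T

section Parabolic

variable {n : ℕ} (Ω : Set (Rn n)) (p : ℝ) [Fact (1 < p)] (T : ℝ)

/-- `W ∈ L^{p'}(0,T;V₀')` is the time derivative of `u ∈ L^p(0,T;L²(Ω))` in the sense of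
distributions on `(0,T)` with values in `V₀'`, where `L²(Ω)` is embedded into `V₀'` by the
`L²`-inner product: `∫ η'(t) (u(t), v)_{L²} dt = -∫ η(t) ⟨W(t), v⟩ dt`. -/
def IsTimeDeriv (u : ℝ → Lp ℝ 2 (volume.restrict Ω)) (W : ℝ → V₀Dual Ω p) : Prop :=
  MemLp W (ENNReal.ofReal (p / (p - 1))) (timeMeasure T) ∧
  ∀ (v : V₀ Ω p) (η : ℝ → ℝ), ContDiff ℝ ∞ η → HasCompactSupport η → tsupport η ⊆ Ioo 0 T →
    ∫ t in Ioo 0 T, deriv η t * ⟪u t, v.1.1⟫ = -∫ t in Ioo 0 T, η t * W t v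

/-- `u ∈ X^p(0,T;Ω)`. -/
def MemX (u : ℝ → V Ω p) : Prop :=
  MemLp u (ENNReal.ofReal p) (timeMeasure T) ∧
  ∃ W : ℝ → V₀Dual Ω p, IsTimeDeriv Ω p T (fun t => (u t).1.1) W

/-- `φ ∈ X₀^p(0,T;Ω)`. -/
def MemX₀ (φ : ℝ → V₀ Ω p) : Prop :=
  MemLp φ (ENNReal.ofReal p) (timeMeasure T) ∧
  ∃ W : ℝ → V₀Dual Ω p, IsTimeDeriv Ω p T (fun t => (φ t).1.1) W

/-- `u ∈ C⁰([0,T];L²(Ω))`, for an element `u` of `L^p(0,T;V)`. -/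
def MemC (u : ℝ → V Ω p) : Prop :=
  ∃ c : ℝ → Lp ℝ 2 (volume.restrict Ω), ContinuousOn c (Icc 0 T) ∧
    ∀ᵐ t ∂timeMeasure T, c t = (u t).1.1

/-- `u ∈ u_⋆ + X₀^p(0,T;Ω)`. -/
def MemAffine (uStar u : ℝ → V Ω p) : Prop :=
  ∃ w : ℝ → V₀ Ω p, MemX₀ Ω p T w ∧
    ∀ᵐ t ∂timeMeasure T, (u t : Pairs Ω p) = (uStar t : Pairs Ω p) + (w t : Pairs Ω p)

/-- `(u - u_⋆)(·,0) = 0` in `L²(Ω)`, where `u - u_⋆` is evaluated at time zero through its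
representative in `C⁰([0,T];L²(Ω))`. -/
def SameInitialValue (uStar u : ℝ → V Ω p) : Prop :=
  ∃ c : ℝ → Lp ℝ 2 (volume.restrict Ω), ContinuousOn c (Icc 0 T) ∧
    (∀ᵐ t ∂timeMeasure T, c t = (u t).1.1 - (uStar t).1.1) ∧ c 0 = 0

/-- `G ∈ L^p(Ω_T;ℝⁿ)` is the spatial gradient `∇u(x,t)` of the element `u` of `L^p(0,T;V)` (or of
`L^p(0,T;V₀)`, with values viewed in the same ambient space), as a function on `Ω_T`. -/
def IsSpaceTimeGradient (u : ℝ → Pairs Ω p) (G : Rn n × ℝ → Rn n) : Prop :=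
  MemLp G (ENNReal.ofReal p) (volume.restrict (spaceTime Ω T)) ∧
  ∀ᵐ t ∂timeMeasure T, (fun x => G (x, t)) =ᵐ[volume.restrict Ω] (u t).2

/-- `u` is a weak solution of `∂ₜu - div(∇E₁(∇u) + ∇E_p(∇u)) = 0` in `Ω_T`. -/
def IsWeakSolution (E₁ Eₚ : Rn n → ℝ) (u : ℝ → V Ω p) : Prop :=
  MemX Ω p T u ∧ MemC Ω p T u ∧
  ∃ (W : ℝ → V₀Dual Ω p) (G Z : Rn n × ℝ → Rn n),
    IsTimeDeriv Ω p T (fun t => (u t).1.1) W ∧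
    IsSpaceTimeGradient Ω p T (fun t => (u t).1) G ∧
    MemLp Z ∞ (volume.restrict (spaceTime Ω T)) ∧
    (∀ᵐ z ∂volume.restrict (spaceTime Ω T), Z z ∈ subdifferential E₁ (G z)) ∧
    ∀ (φ : ℝ → V₀ Ω p) (Gφ : Rn n × ℝ → Rn n), MemX₀ Ω p T φ →
      IsSpaceTimeGradient Ω p T (fun t => (φ t).1) Gφ →
      (∫ t in Ioo 0 T, W t (φ t)) +
        ∫ z in spaceTime Ω T, ⟪Z z + ∇ Eₚ (G z), Gφ z⟫ = 0

/-- `u` is a weak solution of the Dirichlet problem for `∂ₜu - div(∇E(∇u)) = 0` in `Ω_T`,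
`u = u_⋆` on the parabolic boundary. -/
def IsDirichletSolution (E₁ Eₚ : Rn n → ℝ) (uStar u : ℝ → V Ω p) : Prop :=
  MemAffine Ω p T uStar u ∧ SameInitialValue Ω p T uStar u ∧ IsWeakSolution Ω p T E₁ Eₚ u

/-- `u` is a weak solution of the Dirichlet problem for `∂ₜu - div(∇F(∇u)) = 0` in `Ω_T`,
`u = u_⋆` on the parabolic boundary, with a smooth density `F`: `u ∈ u_⋆ + X₀^p(0,T;Ω)`, the
equation holds in `L^{p'}(0,T;V₀')`, and `(u - u_⋆)(·,0) = 0` in `L²(Ω)`. -/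
def IsSmoothDirichletSolution (F : Rn n → ℝ) (uStar u : ℝ → V Ω p) : Prop :=
  MemAffine Ω p T uStar u ∧ SameInitialValue Ω p T uStar u ∧
  MemLp u (ENNReal.ofReal p) (timeMeasure T) ∧
  ∃ W : ℝ → V₀Dual Ω p, IsTimeDeriv Ω p T (fun t => (u t).1.1) W ∧
    ∀ᵐ t ∂timeMeasure T, ∀ v : V₀ Ω p,
      W t v + ∫ x in Ω, ⟪∇ F ((u t).1.2 x), v.1.2 x⟫ = 0

end Parabolic

end OnePLaplace

end

open OnePLaplace

noncomputable section

namespace OnePLaplace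

/-! The mollified densities approach `E` at a linear rate while keeping one fixed modulus of strict
convexity. This turns closeness of densities into closeness of solutions, so the gradients form a
Cauchy family in `L^p` and strong convergence needs no compactness argument.

Some properties of `E` survive mollification with constants independent of `ε`
(`exists_uniform_densities`): nonnegativity, convexity, growth of order `p`, and midpoint convexity
with the remainder `κ (1+|a|+|b|)^(p-2) |a-b|²`. The remainder involves no second derivatives, so
averaging preserves it. The local Lipschitz bound for convex functions of `p`-growth also gives
`|E^ε - E| ≤ K ε (1+|z|)^(p-1)`. Consequently subgradients of two such nearby densities are monotone
up to a small error (`IsGrowthConvex.inner_sub_ge`).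

Subtract the equations for `u_ε` and `u_δ` and test with `u_ε - u_δ`, which lies in `V₀` and
vanishes at time zero. The energy inequality `half_norm_sq_le_integral` then gives, for each `S ∈
(0,T]`, `½‖(u_ε - u_δ)(S)‖² + 4κ ∬ (1+|∇u_ε|+|∇u_δ|)^(p-2) |∇u_ε - ∇u_δ|² ≤ 2K(ε+δ) ∬
(1+|∇u_ε|+|∇u_δ|)^(p-1)`. Comparison with the single solution `u_{1/2}` bounds all gradients in
`L^p`. Reinserting this bound gives `‖∇u_ε - ∇u_δ‖_p^p ≤ M (ε+δ)^(p/2)`, and the functions are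
Cauchy in `L²(Ω)` uniformly in time (`exists_bound_of_monotone`, `exists_energy_bound`).
Completeness yields `u₀` (`exists_limit`).

The fluxes `∇E^ε(∇u_ε)` are bounded in `L^{p'}` and have a weak limit `Y`. Strong convergence of the
gradients passes the subgradient inequality to the limit, so `Y ∈ ∂E(∇u₀)` almost everywhere
(`exists_flux_limit`). Since `E_p` is differentiable, `Z = Y - ∇E_p(∇u₀)` lies in `∂E₁(∇u₀)`, and it
is bounded because `E₁` grows linearly. Uniqueness is the same comparison for two equal densities,
followed by Poincaré's inequality (`IsFluxSolution.ae_eq_of_same_density`). -/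

/-! ### Convex functions of `p`-growth -/

/-- Nonnegative convex functions of `p`-growth which are midpoint convex with a quantitative
remainder. -/
structure IsGrowthConvex {n : ℕ} (p C κ : ℝ) (F : Rn n → ℝ) : Prop where
  convex : ConvexOn ℝ univ F
  nonneg : ∀ z, 0 ≤ F z
  growth : ∀ z, F z ≤ C * (1 + ‖z‖) ^ p
  midpoint : ∀ a b, F ((1 / 2 : ℝ) • (a + b)) + κ * ((1 + ‖a‖ + ‖b‖) ^ (p - 2) * ‖a - b‖ ^ 2)
    ≤ (F a + F b) / 2

section Convex

variable {n : ℕ} {p C κ : ℝ} {F : Rn n → ℝ}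

lemma IsGrowthConvex.continuous (hF : IsGrowthConvex p C κ F) : Continuous F :=
  hF.convex.locallyLipschitz.continuous

lemma IsGrowthConvex.const_nonneg (hF : IsGrowthConvex p C κ F) : 0 ≤ C := by
  have := (hF.nonneg 0).trans (hF.growth 0)
  simpa using this

lemma one_add_rpow_mul {p : ℝ} (z : Rn n) :
    (1 + ‖z‖) ^ (p - 1) * (1 + ‖z‖) = (1 + ‖z‖) ^ p := by
  have h : 0 < 1 + ‖z‖ := by positivity
  rw [Real.rpow_sub_one h.ne', div_mul_cancel₀ _ h.ne']

/-- Step from `z` in the direction of `ζ` by the length `1 + ‖z‖`: the subgradient inequality gains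
`(1 + ‖z‖) ‖ζ‖`, while nonnegativity and growth cap the gain by `C 2^p (1 + ‖z‖)^p`. -/
lemma IsGrowthConvex.norm_le_of_mem_subdifferential (hp : 1 < p) (hF : IsGrowthConvex p C κ F)
    {z ζ : Rn n} (h : ζ ∈ subdifferential F z) :
    ‖ζ‖ ≤ C * 2 ^ p * (1 + ‖z‖) ^ (p - 1) := by
  have hC := hF.const_nonneg
  have hz : 0 < 1 + ‖z‖ := by positivity
  rcases eq_or_ne ζ 0 with rfl | hζ
  · rw [norm_zero]; positivity
  have hζ' : 0 < ‖ζ‖ := norm_pos_iff.2 hζ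
  set e : Rn n := ((1 + ‖z‖) / ‖ζ‖) • ζ with he
  have hen : ‖e‖ = 1 + ‖z‖ := by
    rw [he, norm_smul, Real.norm_of_nonneg (by positivity), div_mul_cancel₀ _ hζ'.ne']
  have h1 := h (z + e)
  have h2 : ⟪ζ, (z + e) - z⟫ = (1 + ‖z‖) * ‖ζ‖ := by
    rw [add_sub_cancel_left, he, real_inner_smul_right, real_inner_self_eq_norm_sq]
    field_simp
  have h3 : F (z + e) ≤ C * 2 ^ p * (1 + ‖z‖) ^ p := by
    refine (hF.growth _).trans ?_
    rw [mul_assoc, ← Real.mul_rpow (by norm_num) hz.le]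
    gcongr
    linarith [norm_add_le z e]
  have h4 := hF.nonneg z
  rw [← one_add_rpow_mul] at h3
  rw [h2] at h1
  have : (1 + ‖z‖) * ‖ζ‖ ≤ (1 + ‖z‖) * (C * 2 ^ p * (1 + ‖z‖) ^ (p - 1)) := by linarith
  exact le_of_mul_le_mul_left this hz

/-- The subgradient inequality is applied at the midpoint, where the convexity remainder is
available; doubling the result produces the factor `2κ`. -/
lemma IsGrowthConvex.subgradient_ge (hF : IsGrowthConvex p C κ F) {a b ζ : Rn n}
    (h : ζ ∈ subdifferential F a) :
    F a + ⟪ζ, b - a⟫ + 2 * κ * ((1 + ‖a‖ + ‖b‖) ^ (p - 2) * ‖a - b‖ ^ 2) ≤ F b := by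
  have h1 := h ((1 / 2 : ℝ) • (a + b))
  have h2 := hF.midpoint a b
  have h3 : (1 / 2 : ℝ) • (a + b) - a = (1 / 2 : ℝ) • (b - a) := by module
  rw [h3, real_inner_smul_right] at h1
  linarith

/-- Prolong the segment from `z` through `w` to a point `q` at distance `1 + ‖z‖` from `z`.
Convexity bounds the increment by the fraction `s` of `F q`, since `F z ≥ 0`, and growth controls `F
q`. -/
lemma IsGrowthConvex.sub_le (hp : 1 < p) (hF : IsGrowthConvex p C κ F) {z w : Rn n}
    (h : ‖w - z‖ ≤ 1) : F w - F z ≤ C * 2 ^ p * (1 + ‖z‖) ^ (p - 1) * ‖w - z‖ := by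
  have hz : 0 < 1 + ‖z‖ := by positivity
  have hC := hF.const_nonneg
  rcases eq_or_ne w z with rfl | hne
  · simp
  have hd : 0 < ‖w - z‖ := norm_pos_iff.2 (sub_ne_zero.2 hne)
  set s := ‖w - z‖ / (1 + ‖z‖) with hs
  have hs0 : 0 < s := by positivity
  have hs1 : s ≤ 1 := (div_le_one hz).2 (by linarith [norm_nonneg z])
  set q := z + s⁻¹ • (w - z) with hq
  have hqn : ‖s⁻¹ • (w - z)‖ = 1 + ‖z‖ := by
    rw [norm_smul, Real.norm_of_nonneg (by positivity), hs]
    field_simp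
  have h3 : F q ≤ C * 2 ^ p * (1 + ‖z‖) ^ p := by
    refine (hF.growth _).trans ?_
    rw [mul_assoc, ← Real.mul_rpow (by norm_num) hz.le]
    gcongr
    linarith [norm_add_le z (s⁻¹ • (w - z))]
  have hw : w = (1 - s) • z + s • q := by
    rw [hq, smul_add, smul_inv_smul₀ hs0.ne']; module
  have h4 := hF.convex.2 (mem_univ z) (mem_univ q) (sub_nonneg.2 hs1) hs0.le (by ring)
  rw [← hw, smul_eq_mul, smul_eq_mul] at h4
  have h5 := hF.nonneg z
  rw [← one_add_rpow_mul] at h3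
  have h6 : s * F q ≤ s * (C * 2 ^ p * ((1 + ‖z‖) ^ (p - 1) * (1 + ‖z‖))) := by gcongr
  have h7 : s * (1 + ‖z‖) = ‖w - z‖ := div_mul_cancel₀ _ hz.ne'
  calc F w - F z ≤ s * F q := by nlinarith
    _ ≤ _ := h6
    _ = C * 2 ^ p * (1 + ‖z‖) ^ (p - 1) * (s * (1 + ‖z‖)) := by ring
    _ = _ := by rw [h7]

/-- The one-sided bound is used with `z` and `w` exchanged; `1 + ‖w‖ ≤ 2 (1 + ‖z‖)` costs a factor
absorbed by replacing `2^p` with `4^p`. -/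
lemma IsGrowthConvex.abs_sub_le (hp : 1 < p) (hF : IsGrowthConvex p C κ F) {z w : Rn n}
    (h : ‖w - z‖ ≤ 1) : |F w - F z| ≤ C * 4 ^ p * (1 + ‖z‖) ^ (p - 1) * ‖w - z‖ := by
  have hC := hF.const_nonneg
  have h4 : (4 : ℝ) ^ p = 2 ^ p * 2 ^ p := by
    rw [← Real.mul_rpow (by norm_num) (by norm_num)]; norm_num
  have h2 : (1 : ℝ) ≤ 2 ^ p := Real.one_le_rpow (by norm_num) (by linarith)
  refine abs_sub_le_iff.2 ⟨(hF.sub_le hp h).trans ?_, (hF.sub_le hp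
    (by rwa [norm_sub_rev])).trans ?_⟩
  · rw [h4, ← mul_assoc]
    gcongr
    exact le_mul_of_one_le_right (by positivity) h2
  · rw [norm_sub_rev z w, h4, ← mul_assoc, mul_assoc (C * 2 ^ p) (2 ^ p)]
    gcongr
    calc (1 + ‖w‖) ^ (p - 1) ≤ (2 * (1 + ‖z‖)) ^ (p - 1) := by
          gcongr
          linarith [norm_sub_norm_le w z, norm_nonneg z]
      _ = 2 ^ (p - 1) * (1 + ‖z‖) ^ (p - 1) :=
        Real.mul_rpow (by norm_num) (by positivity)
      _ ≤ 2 ^ p * (1 + ‖z‖) ^ (p - 1) := by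
        gcongr <;> linarith

/-- The quantitative monotonicity of the subdifferentials of two close functions. -/
lemma IsGrowthConvex.inner_sub_ge {δ : ℝ} {H : Rn n → ℝ} (hp : 1 < p)
    (hF : IsGrowthConvex p C κ F)
    (hH : IsGrowthConvex p C κ H) (hFH : ∀ z, |F z - H z| ≤ δ * (1 + ‖z‖) ^ (p - 1))
    {a b ζ ξ : Rn n} (hζ : ζ ∈ subdifferential F a) (hξ : ξ ∈ subdifferential H b) :
    4 * κ * ((1 + ‖a‖ + ‖b‖) ^ (p - 2) * ‖a - b‖ ^ 2) - 2 * δ * (1 + ‖a‖ + ‖b‖) ^ (p - 1)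
      ≤ ⟪ζ - ξ, a - b⟫ := by
  -- Adding the two inequalities doubles the remainder to `4κ` and leaves `F - H` evaluated at `a`
  -- and at `b`, which costs `δ` twice.
  have h1 := hF.subgradient_ge (b := b) hζ
  have h2 := hH.subgradient_ge (b := a) hξ
  have hδ : 0 ≤ δ := by
    have := (abs_nonneg _).trans (hFH 0)
    simpa using this
  have h3 : |F b - H b| ≤ δ * (1 + ‖a‖ + ‖b‖) ^ (p - 1) := (hFH b).trans <|
    mul_le_mul_of_nonneg_left (Real.rpow_le_rpow (by positivity) (by linarith [norm_nonneg a])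
      (by linarith)) hδ
  have h4 : |F a - H a| ≤ δ * (1 + ‖a‖ + ‖b‖) ^ (p - 1) := (hFH a).trans <|
    mul_le_mul_of_nonneg_left (Real.rpow_le_rpow (by positivity) (by linarith [norm_nonneg b])
      (by linarith)) hδ
  have h5 : ⟪ζ - ξ, a - b⟫ = -⟪ζ, b - a⟫ - ⟪ξ, a - b⟫ := by
    rw [inner_sub_left, ← neg_sub b a, inner_neg_right]
  rw [h5]
  have e : (1 + ‖b‖ + ‖a‖) = 1 + ‖a‖ + ‖b‖ := by ring
  rw [abs_le] at h3 h4
  rw [e, norm_sub_rev b a] at h2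
  linarith

lemma tendsto_slope_gradient {f : Rn n → ℝ} {z : Rn n} (hf : DifferentiableAt ℝ f z) (v : Rn n) :
    Tendsto (fun t : ℝ => t⁻¹ * (f (z + t • v) - f z)) (𝓝[>] 0) (𝓝 ⟪∇ f z, v⟫) := by
  have h := hf.hasGradientAt.hasFDerivAt.hasLineDerivAt v
  have := h.tendsto_slope_zero_right
  simpa [InnerProductSpace.toDual_apply_apply] using this

/-- Apply the inequality at `z + t (w - z)`, bound the increment of `f` by convexity, divide by `t`
and let `t → 0+`; the increment of `g` becomes its derivative. This extracts `Z ∈ ∂E₁` from a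
subgradient of `E₁ + E_p`. -/
lemma sub_gradient_mem_subdifferential {f g : Rn n → ℝ} (hf : ConvexOn ℝ univ f) {z ζ : Rn n}
    (hg : DifferentiableAt ℝ g z) (h : ζ ∈ subdifferential (fun z => f z + g z) z) :
    ζ - ∇ g z ∈ subdifferential f z := by
  intro w
  have h1 : ∀ᶠ t : ℝ in 𝓝[>] 0, ⟪ζ, w - z⟫ - t⁻¹ * (g (z + t • (w - z)) - g z) ≤ f w - f z := by
    filter_upwards [Ioo_mem_nhdsGT (zero_lt_one' ℝ)] with t ht
    have e1 := h (z + t • (w - z))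
    have e2 := hf.2 (mem_univ z) (mem_univ w) (sub_nonneg.2 ht.2.le) ht.1.le (by ring)
    have e3 : (1 - t) • z + t • w = z + t • (w - z) := by module
    rw [e3, smul_eq_mul, smul_eq_mul] at e2
    rw [add_sub_cancel_left, real_inner_smul_right] at e1
    have : t * (⟪ζ, w - z⟫ - t⁻¹ * (g (z + t • (w - z)) - g z)) ≤ t * (f w - f z) := by
      rw [mul_sub, mul_inv_cancel_left₀ ht.1.ne']
      linarith
    exact le_of_mul_le_mul_left this ht.1
  have h2 := le_of_tendsto (tendsto_const_nhds.sub (tendsto_slope_gradient hg (w - z))) h1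
  rw [inner_sub_left]
  linarith

lemma gradient_mem_subdifferential {f : Rn n → ℝ} (hf : ConvexOn ℝ univ f) {z : Rn n}
    (hd : DifferentiableAt ℝ f z) : ∇ f z ∈ subdifferential f z := by
  intro w
  have h1 : ∀ᶠ t : ℝ in 𝓝[>] 0, t⁻¹ * (f (z + t • (w - z)) - f z) ≤ f w - f z := by
    filter_upwards [Ioo_mem_nhdsGT (zero_lt_one' ℝ)] with t ht
    have e2 := hf.2 (mem_univ z) (mem_univ w) (sub_nonneg.2 ht.2.le) ht.1.le (by ring)
    have e3 : (1 - t) • z + t • w = z + t • (w - z) := by module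
    rw [e3, smul_eq_mul, smul_eq_mul] at e2
    rw [inv_mul_le_iff₀ ht.1]
    linarith
  linarith [le_of_tendsto (tendsto_slope_gradient hd (w - z)) h1]

lemma subdifferential_add {f g : Rn n → ℝ} {z ζ ξ : Rn n} (h1 : ζ ∈ subdifferential f z)
    (h2 : ξ ∈ subdifferential g z) : ζ + ξ ∈ subdifferential (fun z => f z + g z) z := by
  intro w
  rw [inner_add_left]
  linarith [h1 w, h2 w]

end Convex

/-! ### The densities -/

/-- A segment may run through the origin, where the Hessian bound is not available. One exceptional
time is harmless: continuity joins the two monotone pieces. -/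
lemma monotoneOn_of_deriv_nonneg_off_point {f : ℝ → ℝ} {a b t₀ : ℝ} (hf : ContinuousOn f (Icc a b))
    (hd : ∀ t ∈ Ioo a b, t ≠ t₀ → DifferentiableAt ℝ f t ∧ 0 ≤ deriv f t) :
    MonotoneOn f (Icc a b) := by
  have key : ∀ x y, a ≤ x → y ≤ b → t₀ ∉ Ioo x y → x ≤ y → f x ≤ f y := by
    intro x y hx hy ht hxy
    have h : ∀ t ∈ Ioo x y, DifferentiableAt ℝ f t ∧ 0 ≤ deriv f t := fun t h =>
      hd t (Ioo_subset_Ioo hx hy h) (fun e => ht (e ▸ h))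
    refine monotoneOn_of_deriv_nonneg (convex_Icc x y) (hf.mono (Icc_subset_Icc hx hy))
      (fun t h' => ?_) (fun t h' => ?_) (left_mem_Icc.2 hxy) (right_mem_Icc.2 hxy) hxy
    · rw [interior_Icc] at h'
      exact (h t h').1.differentiableWithinAt
    · rw [interior_Icc] at h'
      exact (h t h').2
  intro x hx y hy hxy
  by_cases ht : t₀ ∈ Ioo x y
  · exact (key x t₀ hx.1 (ht.2.le.trans hy.2) (by simp) ht.1.le).trans
      (key t₀ y (hx.1.trans ht.1.le) hy.2 (by simp) ht.2.le)
  · exact key x y hx.1 hy.2 ht hxy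

section Densities

variable {n : ℕ} {p lam₀ Lam₀ : ℝ} {E₁ Eₚ : Rn n → ℝ}

lemma IsPDensity.differentiableAt_fderiv (h : IsPDensity p lam₀ Lam₀ Eₚ) {z : Rn n} (hz : z ≠ 0) :
    DifferentiableAt ℝ (fderiv ℝ Eₚ) z := by
  have hopen : IsOpen ({0}ᶜ : Set (Rn n)) := isOpen_compl_singleton
  have h1 : ContDiffOn ℝ 1 (fderiv ℝ Eₚ) {0}ᶜ :=
    h.contDiffOn.fderiv_of_isOpen hopen (by norm_num)
  exact (h1.differentiableOn (by simp)).differentiableAt (hopen.mem_nhds hz)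

/-- On the segment `m + t v`, `|t| ≤ 1`, from `a` to `b`, points have norm at most `R`, so `p ≤ 2`
bounds the second derivative below by `κ = lam₀ R^(p-2) ‖v‖²`. Hence subtracting `κ t²/2` leaves a
convex function. Comparing `t = 0` with `t = ±1` gives the remainder `κ/2`, and `‖v‖ = ‖a - b‖/2`
produces the `1/8`. -/
lemma IsPDensity.midpoint (hp2 : p ≤ 2) (h : IsPDensity p lam₀ Lam₀ Eₚ) (a b : Rn n) :
    Eₚ ((1 / 2 : ℝ) • (a + b)) + lam₀ / 8 * ((1 + ‖a‖ + ‖b‖) ^ (p - 2) * ‖a - b‖ ^ 2)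
      ≤ (Eₚ a + Eₚ b) / 2 := by
  rcases eq_or_ne a b with rfl | hab
  · have e : (1 / 2 : ℝ) • (a + a) = a := by module
    rw [e]; simp
  set m : Rn n := (1 / 2 : ℝ) • (a + b) with hm
  set v : Rn n := (1 / 2 : ℝ) • (b - a) with hv
  have hv0 : v ≠ 0 := smul_ne_zero (by norm_num) (sub_ne_zero.2 hab.symm)
  set R := 1 + ‖a‖ + ‖b‖ with hR
  have hR0 : 0 < R := by positivity
  set κ := lam₀ * R ^ (p - 2) * ‖v‖ ^ 2 with hκ
  have hline : ∀ t : ℝ, HasDerivAt (fun t : ℝ => m + t • v) v t := fun t => by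
    simpa using ((hasDerivAt_id t).smul_const v).const_add m
  have hD : Continuous (fderiv ℝ Eₚ) := h.contDiff.continuous_fderiv (by simp)
  set ψ : ℝ → ℝ := fun t => fderiv ℝ Eₚ (m + t • v) v - κ * t with hψ
  have hψc : Continuous ψ := by
    have : Continuous fun t : ℝ => m + t • v := by fun_prop
    exact ((hD.comp this).clm_apply continuous_const).sub (by fun_prop)
  have hφ : ∀ t, HasDerivAt (fun t => Eₚ (m + t • v) - κ * t ^ 2 / 2) (ψ t) t := fun t => by
    have h1 := ((h.contDiff.differentiable (by simp)) (m + t • v)).hasFDerivAt.comp_hasDerivAt t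
      (hline t)
    have h2 : HasDerivAt (fun t : ℝ => κ * t ^ 2 / 2) (κ * t) t := by
      have := ((hasDerivAt_pow 2 t).const_mul κ).div_const 2
      refine this.congr_deriv ?_
      simp only [Nat.cast_ofNat, Nat.add_one_sub_one, pow_one]
      ring
    exact h1.sub h2
  -- As `v ≠ 0`, the line meets the origin at most once; if it never does, any `t₀` serves.
  obtain ⟨t₀, ht₀⟩ : ∃ t₀ : ℝ, ∀ t, t ≠ t₀ → m + t • v ≠ 0 := by
    by_cases hex : ∃ t₀ : ℝ, m + t₀ • v = 0
    · obtain ⟨t₀, ht₀⟩ := hex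
      refine ⟨t₀, fun t ht e => ht ?_⟩
      have : (t - t₀) • v = 0 := by
        rw [sub_smul, sub_eq_zero]
        exact add_left_cancel (e.trans ht₀.symm)
      exact sub_eq_zero.1 ((smul_eq_zero.1 this).resolve_right hv0)
    · exact ⟨0, fun t _ e => hex ⟨t, e⟩⟩
  have hderiv : ∀ t (L : Rn n →L[ℝ] Rn n →L[ℝ] ℝ), HasFDerivAt (fderiv ℝ Eₚ) L (m + t • v) →
      HasDerivAt ψ (L v v - κ) t := fun t L hL => by
    have h0 : HasDerivAt (fun t : ℝ => fderiv ℝ Eₚ (m + t • v)) (L v) t :=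
      HasFDerivAt.comp_hasDerivAt (f := fun t : ℝ => m + t • v) t hL (hline t)
    have h1 : HasDerivAt (fun t : ℝ => fderiv ℝ Eₚ (m + t • v) v) (L v v) t := by
      have := (ContinuousLinearMap.apply ℝ ℝ v).hasFDerivAt.comp_hasDerivAt t h0
      exact this
    have h2 : HasDerivAt (fun t : ℝ => κ * t) κ t := by
      simpa using (hasDerivAt_id t).const_mul κ
    exact h1.sub h2
  have hmono : MonotoneOn ψ (Icc (-1) 1) := by
    refine monotoneOn_of_deriv_nonneg_off_point (t₀ := t₀) hψc.continuousOn fun t ht htt => ?_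
    have hz := ht₀ t htt
    have hder : HasDerivAt ψ (fderiv ℝ (fderiv ℝ Eₚ) (m + t • v) v v - κ) t :=
      hderiv t _ (h.differentiableAt_fderiv hz).hasFDerivAt
    set z := m + t • v with hzdef
    refine ⟨hder.differentiableAt, ?_⟩
    rw [hder.deriv, sub_nonneg]
    refine le_trans ?_ (h.hessian_ge z hz v)
    have hzR : ‖z‖ ≤ R := by
      have e : z = ((1 - t) / 2) • a + ((1 + t) / 2) • b := by
        rw [hzdef, hm, hv]; module
      rw [e]
      refine (norm_add_le _ _).trans ?_
      rw [norm_smul, norm_smul, Real.norm_of_nonneg (by linarith [ht.2]),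
        Real.norm_of_nonneg (by linarith [ht.1])]
      have := norm_nonneg a
      have := norm_nonneg b
      have := ht.1
      have := ht.2
      nlinarith
    have hpow := Real.rpow_le_rpow_of_nonpos (norm_pos_iff.2 hz) hzR (by linarith : p - 2 ≤ 0)
    have := h.lam_pos
    rw [hκ]
    gcongr
  have hconv : ConvexOn ℝ (Icc (-1 : ℝ) 1) (fun t => Eₚ (m + t • v) - κ * t ^ 2 / 2) := by
    refine MonotoneOn.convexOn_of_deriv (convex_Icc _ _)
      (fun t _ => (hφ t).continuousAt.continuousWithinAt)
      (fun t _ => (hφ t).differentiableAt.differentiableWithinAt) ?_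
    have : deriv (fun t => Eₚ (m + t • v) - κ * t ^ 2 / 2) = ψ := funext fun t => (hφ t).deriv
    rw [this]
    exact hmono.mono interior_subset
  have hfin := hconv.2 (by simp : (-1 : ℝ) ∈ Icc (-1 : ℝ) 1) (by simp : (1 : ℝ) ∈ Icc (-1 : ℝ) 1)
    (by norm_num : (0 : ℝ) ≤ 1 / 2) (by norm_num : (0 : ℝ) ≤ 1 / 2) (by norm_num)
  have e0 : (1 / 2 : ℝ) * -1 + 1 / 2 * 1 = 0 := by norm_num
  have e1 : m + (-1 : ℝ) • v = a := by rw [hm, hv]; module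
  have e2 : m + (1 : ℝ) • v = b := by rw [hm, hv]; module
  simp only [smul_eq_mul, e0, e1, e2, zero_smul, add_zero] at hfin
  have hvn : ‖v‖ ^ 2 = ‖a - b‖ ^ 2 / 4 := by
    rw [hv, norm_smul, norm_sub_rev b a, mul_pow]; norm_num; ring
  rw [hvn] at hκ
  nlinarith

lemma IsOneDensity.exists_bound (h : IsOneDensity E₁) :
    ∃ L, 0 ≤ L ∧ ∀ z, E₁ z ≤ L * ‖z‖ := by
  obtain ⟨L, hL⟩ := (isCompact_sphere (0 : Rn n) 1).bddAbove_image h.continuous.continuousOn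
  have h0 : E₁ 0 = 0 := by
    have := h.homogeneous 0 2 (by norm_num)
    rw [smul_zero] at this
    linarith
  refine ⟨max L 0, le_max_right _ _, fun z => ?_⟩
  rcases eq_or_ne z 0 with rfl | hz
  · simp [h0]
  have hz' := norm_pos_iff.2 hz
  have h1 := h.homogeneous (‖z‖⁻¹ • z) ‖z‖ hz'
  rw [smul_inv_smul₀ hz'.ne'] at h1
  rw [h1, mul_comm]
  gcongr
  exact (hL (mem_image_of_mem _ (by simp [norm_smul, hz'.ne']))).trans (le_max_left _ _)

/-- A subgradient longer than the linear growth constant `L` would force `E₁` above `L ‖·‖` far out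
along `ζ`. The parameter inserted into `hsub` makes the excess exactly `L ‖z‖ + 1`. -/
lemma IsOneDensity.exists_norm_le (h : IsOneDensity E₁) :
    ∃ L, ∀ z ζ, ζ ∈ subdifferential E₁ z → ‖ζ‖ ≤ L := by
  obtain ⟨L, hL, hb⟩ := h.exists_bound
  refine ⟨L, fun z ζ hζ => ?_⟩
  by_contra! hlt
  have hpos : 0 < ‖ζ‖ := hL.trans_lt hlt
  have hsub : ∀ t : ℝ, 0 < t → E₁ z + t * ‖ζ‖ ^ 2 ≤ L * ‖z‖ + t * (L * ‖ζ‖) := fun t ht => by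
    have h1 := hζ (z + t • ζ)
    rw [add_sub_cancel_left, real_inner_smul_right, real_inner_self_eq_norm_sq] at h1
    have h2 := hb (z + t • ζ)
    have h3 := norm_add_le z (t • ζ)
    rw [norm_smul, Real.norm_of_nonneg ht.le] at h3
    nlinarith
  have hgap : 0 < ‖ζ‖ ^ 2 - L * ‖ζ‖ := by nlinarith
  have := hsub ((L * ‖z‖ + 1) / (‖ζ‖ ^ 2 - L * ‖ζ‖)) (by positivity)
  have e : (L * ‖z‖ + 1) / (‖ζ‖ ^ 2 - L * ‖ζ‖) * (‖ζ‖ ^ 2 - L * ‖ζ‖) = L * ‖z‖ + 1 :=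
    div_mul_cancel₀ _ hgap.ne'
  linarith [h.nonneg z]

/-- The remainder comes from `Eₚ` alone, `E₁` being merely convex. In the growth constant, `L`
belongs to `E₁`, and the other two terms come from the subgradient inequality of `Eₚ` at `z` tested
at the origin. -/
lemma isGrowthConvex_add (hp : 1 < p) (hp2 : p ≤ 2) (h₁ : IsOneDensity E₁)
    (hₚ : IsPDensity p lam₀ Lam₀ Eₚ) :
    ∃ C, IsGrowthConvex p C (lam₀ / 8) (fun z => E₁ z + Eₚ z) := by
  obtain ⟨L, hL, hb⟩ := h₁.exists_bound
  have hLam : 0 ≤ Lam₀ := hₚ.lam_pos.le.trans hₚ.lam_le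
  refine ⟨L + Eₚ 0 + Lam₀, h₁.convex.add hₚ.convex, fun z => add_nonneg (h₁.nonneg z) (hₚ.nonneg z),
    fun z => ?_, fun a b => ?_⟩
  · have hz : 1 ≤ 1 + ‖z‖ := by linarith [norm_nonneg z]
    have hone : 1 ≤ (1 + ‖z‖) ^ p := Real.one_le_rpow hz (by linarith)
    have hpow : 1 + ‖z‖ ≤ (1 + ‖z‖) ^ p := by
      simpa using Real.rpow_le_rpow_of_exponent_le hz hp.le
    have hsub := hₚ.convex
    have hgr := gradient_mem_subdifferential hₚ.convex
      ((hₚ.contDiff.differentiable (by simp)) z) 0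
    have h1 : Eₚ z ≤ Eₚ 0 + ‖∇ Eₚ z‖ * ‖z‖ := by
      rw [zero_sub, inner_neg_right] at hgr
      linarith [real_inner_le_norm (∇ Eₚ z) z]
    have h2 : ‖∇ Eₚ z‖ * ‖z‖ ≤ Lam₀ * (1 + ‖z‖) ^ p := by
      rw [← one_add_rpow_mul, ← mul_assoc]
      gcongr
      · refine (hₚ.norm_gradient_le z).trans ?_
        gcongr
        linarith
      · linarith
    have h3 : L * ‖z‖ ≤ L * (1 + ‖z‖) ^ p := by gcongr; linarith
    have h4 : Eₚ 0 ≤ Eₚ 0 * (1 + ‖z‖) ^ p := le_mul_of_one_le_right (hₚ.nonneg 0) hone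
    have := hb z
    linarith
  · have h1 := hₚ.midpoint hp2 a b
    have h2 := h₁.convex.2 (mem_univ a) (mem_univ b) (by norm_num : (0 : ℝ) ≤ 1 / 2)
      (by norm_num : (0 : ℝ) ≤ 1 / 2) (by norm_num)
    rw [← smul_add, smul_eq_mul, smul_eq_mul] at h2
    linarith

end Densities

/-! ### Mollification -/

section Mollify

variable {n : ℕ} {p C κ : ℝ} {F : Rn n → ℝ} {ρ : Rn n → ℝ} {ε : ℝ}

/-- The rescaled kernel `ρ_ε`. -/
def scaledKernel (ρ : Rn n → ℝ) (ε : ℝ) (y : Rn n) : ℝ := (ε ^ n)⁻¹ * ρ (ε⁻¹ • y)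

lemma IsMollifier.contDiff_scaledKernel (hρ : IsMollifier ρ) :
    ContDiff ℝ ∞ (scaledKernel ρ ε) :=
  contDiff_const.mul (hρ.contDiff.comp (contDiff_const_smul _))

lemma IsMollifier.scaledKernel_nonneg (hρ : IsMollifier ρ) (hε : 0 < ε) (y : Rn n) :
    0 ≤ scaledKernel ρ ε y :=
  mul_nonneg (by positivity) (hρ.nonneg _)

lemma IsMollifier.scaledKernel_eq_zero (hρ : IsMollifier ρ) (hε : 0 < ε) {y : Rn n}
    (hy : ε < ‖y‖) : scaledKernel ρ ε y = 0 := by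
  have : ε⁻¹ • y ∉ tsupport ρ := by
    rw [hρ.support_eq, mem_closedBall_zero_iff, norm_smul, Real.norm_of_nonneg (by positivity),
      not_le, inv_mul_eq_div, one_lt_div hε]
    exact hy
  rw [scaledKernel, image_eq_zero_of_notMem_tsupport this, mul_zero]

lemma IsMollifier.hasCompactSupport_scaledKernel (hρ : IsMollifier ρ) (hε : 0 < ε) :
    HasCompactSupport (scaledKernel ρ ε) :=
  HasCompactSupport.intro (isCompact_closedBall (0 : Rn n) ε) fun y hy =>
    hρ.scaledKernel_eq_zero hε (by simpa using hy)

lemma IsMollifier.integral_scaledKernel (hρ : IsMollifier ρ) (hε : 0 < ε) :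
    ∫ y, scaledKernel ρ ε y = 1 := by
  simp only [scaledKernel]
  rw [integral_const_mul, Measure.integral_comp_inv_smul_of_nonneg _ _ hε.le,
    hρ.integral_eq_one, finrank_euclideanSpace_fin, smul_eq_mul, mul_one,
    inv_mul_cancel₀ (by positivity)]

lemma IsMollifier.integrable_scaledKernel_mul (hρ : IsMollifier ρ) (hε : 0 < ε) {f : Rn n → ℝ}
    (hf : Continuous f) : Integrable fun y => scaledKernel ρ ε y * f y :=
  (hρ.contDiff_scaledKernel.continuous.mul hf).integrable_of_hasCompactSupport
    (hρ.hasCompactSupport_scaledKernel hε).mul_right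

/-- An inequality is needed only for shifts of size at most `ε`, where the kernel lives. -/
lemma IsMollifier.integral_scaledKernel_mul_mono (hρ : IsMollifier ρ) (hε : 0 < ε)
    {f g : Rn n → ℝ} (hf : Continuous f) (hg : Continuous g) (h : ∀ y, ‖y‖ ≤ ε → f y ≤ g y) :
    ∫ y, scaledKernel ρ ε y * f y ≤ ∫ y, scaledKernel ρ ε y * g y := by
  refine integral_mono (hρ.integrable_scaledKernel_mul hε hf)
    (hρ.integrable_scaledKernel_mul hε hg) fun y => ?_
  rcases le_or_gt ‖y‖ ε with hy | hy
  · exact mul_le_mul_of_nonneg_left (h y hy) (hρ.scaledKernel_nonneg hε y)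
  · simp [hρ.scaledKernel_eq_zero hε hy]

lemma IsMollifier.integral_scaledKernel_mul_const (hρ : IsMollifier ρ) (hε : 0 < ε) (c : ℝ) :
    ∫ y, scaledKernel ρ ε y * c = c := by
  rw [integral_mul_const, hρ.integral_scaledKernel hε, one_mul]

lemma mollify_eq (z : Rn n) : mollify ρ ε F z = ∫ y, scaledKernel ρ ε y * F (z - y) := rfl

lemma IsMollifier.contDiff_mollify (hρ : IsMollifier ρ) (hε : 0 < ε) (hF : Continuous F) :
    ContDiff ℝ ∞ (mollify ρ ε F) := by
  have := (hρ.hasCompactSupport_scaledKernel hε).contDiff_convolution_left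
    (ContinuousLinearMap.mul ℝ ℝ) (μ := volume) (hρ.contDiff_scaledKernel (ε := ε))
    hF.locallyIntegrable
  exact this

lemma IsMollifier.relaxedDensity_eq (hρ : IsMollifier ρ) (hε : 0 < ε) {E₁ Eₚ : Rn n → ℝ}
    (h₁ : Continuous E₁) (hₚ : Continuous Eₚ) :
    relaxedDensity ρ E₁ Eₚ ε = mollify ρ ε fun z => E₁ z + Eₚ z := by
  funext z
  simp only [relaxedDensity, mollify_eq, mul_add]
  rw [integral_add]
  · exact hρ.integrable_scaledKernel_mul hε (by fun_prop)
  · exact hρ.integrable_scaledKernel_mul hε (by fun_prop)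

/-- Each property is averaged over shifts `y` with `‖y‖ ≤ ε ≤ 1`. A shift enlarges `1 + ‖z‖` by at
most the factor `2` and `1 + ‖a‖ + ‖b‖` by at most `3`, whence `2^p` and, the exponent being
nonpositive, `3^(p-2)`. Neither constant depends on `ε`. -/
lemma IsMollifier.isGrowthConvex_mollify (hρ : IsMollifier ρ) (hε : 0 < ε) (hε1 : ε ≤ 1)
    (hp : 1 < p) (hp2 : p ≤ 2) (hκ : 0 ≤ κ) (hF : IsGrowthConvex p C κ F) :
    IsGrowthConvex p (C * 2 ^ p) (κ * 3 ^ (p - 2)) (mollify ρ ε F) := by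
  have hFc := hF.continuous
  have hC := hF.const_nonneg
  refine ⟨⟨convex_univ, fun a _ b _ s t hs ht hst => ?_⟩, fun z => ?_, fun z => ?_, fun a b => ?_⟩
  · simp only [mollify_eq, smul_eq_mul]
    rw [← integral_const_mul, ← integral_const_mul, ← integral_add
      ((hρ.integrable_scaledKernel_mul hε (by fun_prop)).const_mul _)
      ((hρ.integrable_scaledKernel_mul hε (by fun_prop)).const_mul _)]
    have e : ∀ y, s * (scaledKernel ρ ε y * F (a - y)) + t * (scaledKernel ρ ε y * F (b - y))
        = scaledKernel ρ ε y * (s * F (a - y) + t * F (b - y)) := fun y => by ring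
    simp only [e]
    refine hρ.integral_scaledKernel_mul_mono hε (by fun_prop) (by fun_prop) fun y _ => ?_
    have := hF.convex.2 (mem_univ (a - y)) (mem_univ (b - y)) hs ht hst
    have e2 : s • (a - y) + t • (b - y) = s • a + t • b - y := by
      have : y = (s + t) • y := by rw [hst, one_smul]
      conv_rhs => rw [this]
      module
    rwa [e2] at this
  · exact integral_nonneg fun y => mul_nonneg (hρ.scaledKernel_nonneg hε y) (hF.nonneg _)
  · rw [mollify_eq, ← hρ.integral_scaledKernel_mul_const hε (C * 2 ^ p * (1 + ‖z‖) ^ p)]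
    refine hρ.integral_scaledKernel_mul_mono hε (by fun_prop) (by fun_prop) fun y hy => ?_
    refine (hF.growth _).trans ?_
    rw [mul_assoc, ← Real.mul_rpow (by norm_num) (by positivity)]
    refine mul_le_mul_of_nonneg_left (Real.rpow_le_rpow (by positivity) ?_ (by linarith)) hC
    linarith [norm_sub_le z y, norm_nonneg z]
  · set c := κ * 3 ^ (p - 2) * ((1 + ‖a‖ + ‖b‖) ^ (p - 2) * ‖a - b‖ ^ 2) with hc
    have hI := fun z => hρ.integrable_scaledKernel_mul hε (f := fun y => F (z - y)) (by fun_prop)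
    simp only [mollify_eq]
    rw [← hρ.integral_scaledKernel_mul_const hε c, ← integral_add (hI _)
      (hρ.integrable_scaledKernel_mul hε (by fun_prop)), ← integral_add (hI a) (hI b),
      ← integral_div]
    have e : ∀ y, (scaledKernel ρ ε y * F (a - y) + scaledKernel ρ ε y * F (b - y)) / 2
        = scaledKernel ρ ε y * ((F (a - y) + F (b - y)) / 2) := fun y => by ring
    simp only [e]
    simp only [← mul_add]
    refine hρ.integral_scaledKernel_mul_mono hε (by fun_prop) (by fun_prop) fun y hy => ?_
    have h1 := hF.midpoint (a - y) (b - y)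
    have e2 : (1 / 2 : ℝ) • (a - y + (b - y)) = (1 / 2 : ℝ) • (a + b) - y := by module
    rw [e2, sub_sub_sub_cancel_right] at h1
    refine le_trans ?_ h1
    gcongr
    rw [hc, mul_assoc, ← mul_assoc (3 ^ (p - 2)), ← Real.mul_rpow (by norm_num) (by positivity)]
    refine mul_le_mul_of_nonneg_left (mul_le_mul_of_nonneg_right ?_ (by positivity)) hκ
    refine Real.rpow_le_rpow_of_nonpos (by positivity) ?_ (by linarith)
    linarith [norm_sub_le a y, norm_sub_le b y, norm_nonneg a, norm_nonneg b]

/-- The local Lipschitz bound averaged over `‖y‖ ≤ ε`. The exponent `p - 1`, one below the growth of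
`F`, is what allows the error to be absorbed in the energy estimate. -/
lemma IsMollifier.abs_mollify_sub_le (hρ : IsMollifier ρ) (hε : 0 < ε) (hε1 : ε ≤ 1)
    (hp : 1 < p) (hF : IsGrowthConvex p C κ F) (z : Rn n) :
    |mollify ρ ε F z - F z| ≤ C * 4 ^ p * ε * (1 + ‖z‖) ^ (p - 1) := by
  have hFc := hF.continuous
  have hC := hF.const_nonneg
  have key : ∀ y, ‖y‖ ≤ ε → |F (z - y) - F z| ≤ C * 4 ^ p * ε * (1 + ‖z‖) ^ (p - 1) := by
    intro y hy
    have e : ‖z - y - z‖ = ‖y‖ := by rw [sub_sub_cancel_left, norm_neg]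
    refine (hF.abs_sub_le hp (by rw [e]; linarith)).trans ?_
    rw [e, mul_right_comm]
    gcongr
  rw [abs_sub_le_iff]
  constructor
  · rw [sub_le_iff_le_add, mollify_eq, ← hρ.integral_scaledKernel_mul_const hε (_ + F z)]
    refine hρ.integral_scaledKernel_mul_mono hε (by fun_prop) (by fun_prop) fun y hy => ?_
    linarith [(abs_le.1 (key y hy)).2]
  · rw [sub_le_comm, mollify_eq, ← hρ.integral_scaledKernel_mul_const hε (F z - _)]
    refine hρ.integral_scaledKernel_mul_mono hε (by fun_prop) (by fun_prop) fun y hy => ?_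
    linarith [(abs_le.1 (key y hy)).1]

end Mollify

/-! ### Functions on a product and functions with values in `L^q` -/

section Slices

variable {X Y E : Type*} [MeasurableSpace X] [MeasurableSpace Y] [NormedAddCommGroup E]
  {μ : Measure X} {ν : Measure Y} {q : ℝ≥0∞}

lemma ae_ae_swap_of_ae_prod [SFinite μ] [SFinite ν] {P : X × Y → Prop}
    (h : ∀ᵐ z ∂μ.prod ν, P z) : ∀ᵐ t ∂ν, ∀ᵐ x ∂μ, P (x, t) := by
  rw [← Measure.prod_swap] at h
  exact Measure.ae_ae_of_ae_prod (ae_of_ae_map measurable_swap.aemeasurable h)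

/-- The slices `G(·, t)` of `G` represent `f t ∈ L^q`. -/
def IsSlice (μ : Measure X) (ν : Measure Y) (G : X × Y → E) (f : Y → Lp E q μ) : Prop :=
  ∀ᵐ t ∂ν, (fun x => G (x, t)) =ᵐ[μ] f t

lemma IsSlice.sub {G H : X × Y → E} {f g : Y → Lp E q μ} (hf : IsSlice μ ν G f)
    (hg : IsSlice μ ν H g) : IsSlice μ ν (G - H) (f - g) := by
  filter_upwards [hf, hg] with t h1 h2
  filter_upwards [h1, h2, Lp.coeFn_sub (f t) (g t)] with x e1 e2 e3
  simp only [Pi.sub_apply] at e1 e2 e3 ⊢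
  rw [e1, e2, e3]

lemma IsSlice.add {G H : X × Y → E} {f g : Y → Lp E q μ} (hf : IsSlice μ ν G f)
    (hg : IsSlice μ ν H g) : IsSlice μ ν (G + H) (f + g) := by
  filter_upwards [hf, hg] with t h1 h2
  filter_upwards [h1, h2, Lp.coeFn_add (f t) (g t)] with x e1 e2 e3
  simp only [Pi.add_apply] at e1 e2 e3 ⊢
  rw [e1, e2, e3]

lemma lintegral_enorm_rpow_eq [SFinite μ] [SFinite ν] {G : X × Y → E} (hq0 : q ≠ 0) (hq : q ≠ ⊤)
    (hG : AEStronglyMeasurable G (μ.prod ν)) :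
    ∫⁻ z, ‖G z‖ₑ ^ q.toReal ∂μ.prod ν
      = ∫⁻ t, eLpNorm (fun x => G (x, t)) q μ ^ q.toReal ∂ν := by
  rw [lintegral_prod_symm _ (hG.enorm.pow_const _)]
  refine lintegral_congr fun t => ?_
  rw [eLpNorm_eq_lintegral_rpow_enorm_toReal hq0 hq, ← ENNReal.rpow_mul,
    one_div, inv_mul_cancel₀ (ENNReal.toReal_ne_zero.2 ⟨hq0, hq⟩), ENNReal.rpow_one]

lemma IsSlice.eLpNorm_eq [SFinite μ] [SFinite ν] {G : X × Y → E} {f : Y → Lp E q μ}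
    (hq0 : q ≠ 0) (hq : q ≠ ⊤) (hG : AEStronglyMeasurable G (μ.prod ν)) (h : IsSlice μ ν G f) :
    eLpNorm G q (μ.prod ν) = eLpNorm f q ν := by
  rw [eLpNorm_eq_lintegral_rpow_enorm_toReal hq0 hq, eLpNorm_eq_lintegral_rpow_enorm_toReal hq0 hq,
    lintegral_enorm_rpow_eq hq0 hq hG]
  congr 1
  refine lintegral_congr_ae ?_
  filter_upwards [h] with t ht
  rw [eLpNorm_congr_ae ht, Lp.enorm_def]

/-- Balls form a basis and, by second countability, generate the Borel sets. Measurability of an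
`L^q`-valued map is thereby reduced to that of scalar functions of `t`. -/
lemma measurable_of_forall_dist {M : Type*} [PseudoMetricSpace M] [SecondCountableTopology M]
    [MeasurableSpace M] [BorelSpace M] {f : Y → M} (h : ∀ g, Measurable fun t => dist (f t) g) :
    Measurable f := by
  have hb : TopologicalSpace.IsTopologicalBasis {s : Set M | ∃ x r, s = Metric.ball x r} := by
    refine TopologicalSpace.isTopologicalBasis_of_isOpen_of_nhds ?_ fun a u ha hu => ?_
    · rintro _ ⟨x, r, rfl⟩
      exact Metric.isOpen_ball
    · obtain ⟨r, hr, hs⟩ := Metric.isOpen_iff.1 hu a ha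
      exact ⟨_, ⟨a, r, rfl⟩, Metric.mem_ball_self hr, hs⟩
  rw [BorelSpace.measurable_eq (α := M), hb.borel_eq_generateFrom]
  refine measurable_generateFrom ?_
  rintro _ ⟨x, r, rfl⟩
  exact measurableSet_lt (h x) measurable_const

variable [MeasurableSpace.CountablyGenerated X] [IsFiniteMeasure μ] [IsFiniteMeasure ν]
  [SecondCountableTopology E] [Fact (1 ≤ q)] [Fact (q ≠ ⊤)]

/-- A function in `L^q` of a product defines a function with values in `L^q`. -/
lemma exists_isSlice {G : X × Y → E} (hG : MemLp G q (μ.prod ν)) :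
    ∃ f : Y → Lp E q μ, MemLp f q ν ∧ IsSlice μ ν G f := by
  have hq : q ≠ ⊤ := Fact.out
  have hq0 : q ≠ 0 := (zero_lt_one.trans_le (Fact.out : 1 ≤ q)).ne'
  have hr0 : 0 < q.toReal := ENNReal.toReal_pos hq0 hq
  set G' := hG.1.mk G with hG'
  have hm : StronglyMeasurable G' := hG.1.stronglyMeasurable_mk
  have hL : MemLp G' q (μ.prod ν) := (memLp_congr_ae hG.1.ae_eq_mk).1 hG
  have hslice : ∀ t, StronglyMeasurable fun x => G' (x, t) := fun t =>
    hm.comp_measurable (measurable_id.prodMk measurable_const)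
  have hmeas : ∀ g : X → E, StronglyMeasurable g →
      Measurable fun t => eLpNorm (fun x => G' (x, t) - g x) q μ := fun g hg => by
    simp only [eLpNorm_eq_lintegral_rpow_enorm_toReal hq0 hq]
    refine Measurable.pow_const (Measurable.lintegral_prod_left' (f := fun z : X × Y =>
      ‖G' z - g z.1‖ₑ ^ q.toReal) ?_) _
    exact ((hm.sub (hg.comp_measurable measurable_fst)).enorm).pow_const _
  have hmeas0 : Measurable fun t => eLpNorm (fun x => G' (x, t)) q μ := by
    simpa using hmeas 0 stronglyMeasurable_zero
  classical
  -- The value `0` is a default for slices of infinite norm, which occur only on a null set by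
  -- Tonelli.
  set f : Y → Lp E q μ := fun t => if h : eLpNorm (fun x => G' (x, t)) q μ < ⊤ then
    MemLp.toLp (fun x => G' (x, t)) ⟨(hslice t).aestronglyMeasurable, h⟩ else 0 with hf
  have hfin : ∀ᵐ t ∂ν, eLpNorm (fun x => G' (x, t)) q μ < ⊤ := by
    have h1 := lintegral_rpow_enorm_lt_top_of_eLpNorm_lt_top hq0 hq hL.2
    rw [lintegral_enorm_rpow_eq hq0 hq hL.1] at h1
    filter_upwards [ae_lt_top (hmeas0.pow_const _) h1.ne] with t ht
    exact (ENNReal.rpow_lt_top_iff_of_pos hr0).1 ht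
  have hfs : IsSlice μ ν G f := by
    filter_upwards [hfin, ae_ae_swap_of_ae_prod hG.1.ae_eq_mk] with t ht he
    simp only [hf, dif_pos ht]
    filter_upwards [he, MemLp.coeFn_toLp (f := fun x => G' (x, t))
      ⟨(hslice t).aestronglyMeasurable, ht⟩] with x h1 h2
    rw [h2, h1]
  have hfm : StronglyMeasurable f := by
    let _ : MeasurableSpace (Lp E q μ) := borel _
    have : BorelSpace (Lp E q μ) := ⟨rfl⟩
    refine Measurable.stronglyMeasurable (measurable_of_forall_dist fun g => ?_)
    -- On the measurable set of finite slices the distance is a power of a parametric integral;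
    -- elsewhere it is constant.
    have e : (fun t => dist (f t) g) = {t | eLpNorm (fun x => G' (x, t)) q μ < ⊤}.piecewise
        (fun t => (eLpNorm (fun x => G' (x, t) - g x) q μ).toReal) (fun _ => dist 0 g) := by
      funext t
      by_cases ht : eLpNorm (fun x => G' (x, t)) q μ < ⊤
      · rw [Set.piecewise_eq_of_mem _ _ _ (by exact ht)]
        simp only [hf, dif_pos ht]
        rw [Lp.dist_def]
        congr 1
        refine eLpNorm_congr_ae ?_
        filter_upwards [MemLp.coeFn_toLp (f := fun x => G' (x, t))
          ⟨(hslice t).aestronglyMeasurable, ht⟩] with x h1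
        simp only [Pi.sub_apply, h1]
      · rw [Set.piecewise_eq_of_notMem _ _ _ (by exact ht)]
        simp only [hf, dif_neg ht]
    rw [e]
    refine Measurable.piecewise (measurableSet_lt hmeas0 measurable_const) ?_ measurable_const
    exact (hmeas g (Lp.stronglyMeasurable g)).ennreal_toReal
  exact ⟨f, ⟨hfm.aestronglyMeasurable, (hfs.eLpNorm_eq hq0 hq hG.1).symm ▸ hG.2⟩, hfs⟩

/-- A function with values in `L^q` is represented by a function on the product. -/
lemma exists_joint [CompleteSpace E] {f : Y → Lp E q μ} (hf : MemLp f q ν) :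
    ∃ G : X × Y → E, MemLp G q (μ.prod ν) ∧ IsSlice μ ν G f := by
  have hq : q ≠ ⊤ := Fact.out
  have hq0 : q ≠ 0 := (zero_lt_one.trans_le (Fact.out : 1 ≤ q)).ne'
  suffices H : ∀ f : Lp (Lp E q μ) q ν,
      ∃ G : X × Y → E, MemLp G q (μ.prod ν) ∧ IsSlice μ ν G f by
    obtain ⟨G, hG, hs⟩ := H (hf.toLp f)
    refine ⟨G, hG, ?_⟩
    filter_upwards [hs, hf.coeFn_toLp] with t h1 h2
    rw [← h2]
    exact h1
  intro f
  refine Lp.induction hq (motive := fun f => ∃ G : X × Y → E, MemLp G q (μ.prod ν) ∧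
    IsSlice μ ν G f) ?_ ?_ ?_ f
  · intro c s hs hμs
    refine ⟨(univ ×ˢ s).indicator fun z => c z.1, ?_, ?_⟩
    · have h1 : MemLp (fun z : X × Y => c z.1) q (μ.prod ν) := (Lp.memLp c).comp_fst ν
      exact h1.indicator (MeasurableSet.univ.prod hs)
    · filter_upwards [indicatorConstLp_coeFn (p := q) (hs := hs) (hμs := hμs.ne) (c := c)]
        with t ht
      rw [Lp.simpleFunc.coe_indicatorConst, ht]
      by_cases hts : t ∈ s
      · refine ae_of_all _ fun x => ?_
        simp [hts]
      · simp only [indicator_of_notMem hts]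
        filter_upwards [Lp.coeFn_zero E q μ] with x hx
        rw [hx]
        simp [hts]
  · rintro f g hf hg - ⟨F, hF, hFs⟩ ⟨G, hG, hGs⟩
    refine ⟨F + G, hF.add hG, ?_⟩
    filter_upwards [hFs.add hGs, Lp.coeFn_add (hf.toLp f) (hg.toLp g)] with t h1 h2
    rw [h2]
    exact h1
  · refine isClosed_of_closure_subset fun f hfc => ?_
    obtain ⟨u, hu, hlim⟩ := mem_closure_iff_seq_limit.1 hfc
    choose G hG hGs using hu
    -- Passing to slices is isometric. Joint representatives of a convergent sequence are therefore
    -- Cauchy, and the slices of their limit represent the limit of the sequence.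
    have hdist : ∀ (f g : Lp (Lp E q μ) q ν) (F H : X × Y → E) (hF : MemLp F q (μ.prod ν))
        (hH : MemLp H q (μ.prod ν)), IsSlice μ ν F f → IsSlice μ ν H g →
        edist (hF.toLp F) (hH.toLp H) = edist f g := fun f g F H hF hH h1 h2 => by
      rw [Lp.edist_toLp_toLp, Lp.edist_def, (h1.sub h2).eLpNorm_eq hq0 hq (hF.sub hH).1]
    have hcau : CauchySeq fun k => (hG k).toLp (G k) := by
      have := hlim.cauchySeq
      rw [EMetric.cauchySeq_iff] at this ⊢
      intro ε hε
      obtain ⟨N, hN⟩ := this ε hε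
      refine ⟨N, fun m hm k hk => ?_⟩
      rw [hdist _ _ _ _ _ _ (hGs m) (hGs k)]
      exact hN m hm k hk
    obtain ⟨g, hg⟩ := cauchySeq_tendsto_of_complete hcau
    obtain ⟨f', hf', hs'⟩ := exists_isSlice (Lp.memLp g)
    have hs'' : IsSlice μ ν g (hf'.toLp f') := by
      filter_upwards [hs', hf'.coeFn_toLp] with t h1 h2
      rw [h2]
      exact h1
    have : Tendsto u atTop (𝓝 (hf'.toLp f')) := by
      rw [tendsto_iff_edist_tendsto_0] at hg ⊢
      refine hg.congr fun k => ?_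
      rw [← hdist _ _ _ _ (hG k) (Lp.memLp g) (hGs k) hs'', Lp.toLp_coeFn]
    rw [tendsto_nhds_unique hlim this]
    exact ⟨g, Lp.memLp g, hs''⟩

end Slices

/-! ### The space `V₀` is closed, and Poincaré's inequality -/

lemma tendsto_eLpNorm_sub_of_exponent_le {X E ι : Type*} [MeasurableSpace X] [NormedAddCommGroup E]
    {μ : Measure X} [IsFiniteMeasure μ] {q r : ℝ≥0∞} (hqr : q ≤ r) {l : Filter ι}
    {f : ι → X → E} {g : X → E} (hf : ∀ i, AEStronglyMeasurable (f i) μ)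
    (hg : AEStronglyMeasurable g μ)
    (h : Tendsto (fun i => eLpNorm (fun x => f i x - g x) r μ) l (𝓝 0)) :
    Tendsto (fun i => eLpNorm (fun x => f i x - g x) q μ) l (𝓝 0) := by
  rcases eq_or_ne q 0 with rfl | hq
  · simpa using tendsto_const_nhds
  have hfin : μ univ ^ (1 / q.toReal - 1 / r.toReal) ≠ ⊤ := by
    rcases eq_or_ne (μ univ) 0 with h0 | h0
    · have : μ = 0 := Measure.measure_univ_eq_zero.1 h0
      rcases eq_or_ne r ⊤ with rfl | hr
      · simp [h0]
      · refine ENNReal.rpow_ne_top_of_nonneg (sub_nonneg.2 ?_) (measure_ne_top _ _)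
        have hq' : 0 < q.toReal := ENNReal.toReal_pos hq (ne_top_of_le_ne_top hr hqr)
        exact one_div_le_one_div_of_le hq' (ENNReal.toReal_mono hr hqr)
    · exact ENNReal.rpow_ne_top_of_ne_zero h0 (measure_ne_top _ _)
  have h2 := ENNReal.Tendsto.mul_const h (Or.inr hfin)
  rw [zero_mul] at h2
  exact tendsto_of_tendsto_of_tendsto_of_le_of_le tendsto_const_nhds h2 (fun _ => zero_le)
    fun i => eLpNorm_le_eLpNorm_mul_rpow_measure_univ hqr ((hf i).sub hg)

lemma Lp.tendsto_eLpNorm_sub {X E ι : Type*} [MeasurableSpace X] [NormedAddCommGroup E]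
    {μ : Measure X} {q : ℝ≥0∞} [Fact (1 ≤ q)] {l : Filter ι} {f : ι → Lp E q μ} {g : Lp E q μ}
    (h : Tendsto f l (𝓝 g)) : Tendsto (fun i => eLpNorm (fun x => f i x - g x) q μ) l (𝓝 0) := by
  have := (tendsto_iff_edist_tendsto_0.1 h)
  simp only [Lp.edist_def] at this
  exact this

/-! ### Pairing convergent sequences with bounded functions -/

section Pairing

variable {X E F G ι : Type*} [MeasurableSpace X] [NormedAddCommGroup E] [NormedSpace ℝ E]
  [NormedAddCommGroup F] [NormedSpace ℝ F] [NormedAddCommGroup G] [NormedSpace ℝ G]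
  {μ : Measure X} (L : E →L[ℝ] F →L[ℝ] G) {q : ℝ≥0∞}

lemma memLp_pairing_of_bound {f : X → E} {H : X → F} (hf : MemLp f q μ)
    (hH : AEStronglyMeasurable H μ) {M : ℝ} (hM : ∀ᵐ x ∂μ, ‖H x‖ ≤ M) :
    MemLp (fun x => L (f x) (H x)) q μ := by
  refine hf.of_le_mul (c := ‖L‖ * M) (L.aestronglyMeasurable_comp₂ hf.1 hH) ?_
  filter_upwards [hM] with x hx
  calc ‖L (f x) (H x)‖ ≤ ‖L‖ * ‖f x‖ * ‖H x‖ := L.le_opNorm₂ _ _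
    _ ≤ ‖L‖ * ‖f x‖ * M := by gcongr
    _ = ‖L‖ * M * ‖f x‖ := by ring

lemma tendsto_integral_pairing [IsFiniteMeasure μ] (hq : 1 ≤ q) {l : Filter ι} {f : ι → X → E}
    {g : X → E}
    {H : X → F} (hf : ∀ i, MemLp (f i) q μ) (hg : MemLp g q μ)
    (h : Tendsto (fun i => eLpNorm (fun x => f i x - g x) q μ) l (𝓝 0))
    (hH : AEStronglyMeasurable H μ) {M : ℝ} (hM : ∀ᵐ x ∂μ, ‖H x‖ ≤ M) :
    Tendsto (fun i => ∫ x, L (f i x) (H x) ∂μ) l (𝓝 (∫ x, L (g x) (H x) ∂μ)) := by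
  have h1 := tendsto_eLpNorm_sub_of_exponent_le hq (fun i => (hf i).1) hg.1 h
  refine tendsto_integral_of_L1 _
    ((memLp_pairing_of_bound L hg hH hM).integrable hq).1
    (Eventually.of_forall fun i => (memLp_pairing_of_bound L (hf i) hH hM).integrable hq) ?_
  have h2 : Tendsto (fun i => ENNReal.ofReal (‖L‖ * M) *
      eLpNorm (fun x => f i x - g x) 1 μ) l (𝓝 0) := by
    simpa using ENNReal.Tendsto.const_mul h1 (Or.inr ENNReal.ofReal_ne_top)
  refine tendsto_of_tendsto_of_tendsto_of_le_of_le tendsto_const_nhds h2 (fun _ => zero_le)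
    fun i => ?_
  simp only
  rw [eLpNorm_one_eq_lintegral_enorm, ← lintegral_const_mul' _ _ ENNReal.ofReal_ne_top]
  refine lintegral_mono_ae ?_
  filter_upwards [hM] with x hx
  rw [← ofReal_norm, ← ofReal_norm,
    ← ENNReal.ofReal_mul' (norm_nonneg _)]
  refine ENNReal.ofReal_le_ofReal ?_
  have e : L (f i x) (H x) - L (g x) (H x) = L (f i x - g x) (H x) := by
    rw [map_sub, sub_apply]
  rw [e]
  calc ‖L (f i x - g x) (H x)‖ ≤ ‖L‖ * ‖f i x - g x‖ * ‖H x‖ := L.le_opNorm₂ _ _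
    _ ≤ ‖L‖ * ‖f i x - g x‖ * M := by gcongr
    _ = ‖L‖ * M * ‖f i x - g x‖ := by ring

end Pairing

section Closed

variable {n : ℕ} {Ω : Set (Rn n)}

lemma isFiniteMeasure_restrict_of_isBounded (hΩ : Bornology.IsBounded Ω) :
    IsFiniteMeasure (volume.restrict Ω) :=
  ⟨by simpa using hΩ.measure_lt_top⟩

lemma ofReal_le_two {p : ℝ} (hp2 : p ≤ 2) : ENNReal.ofReal p ≤ 2 := by
  simpa using ENNReal.ofReal_le_ofReal hp2

lemma continuous_gradient {φ : Rn n → ℝ} (h : ContDiff ℝ 1 φ) : Continuous (∇ φ) :=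
  (InnerProductSpace.toDual ℝ (Rn n)).symm.continuous.comp (h.continuous_fderiv (by simp))

lemma norm_gradient_eq (φ : Rn n → ℝ) (x : Rn n) : ‖∇ φ x‖ = ‖fderiv ℝ φ x‖ :=
  (InnerProductSpace.toDual ℝ (Rn n)).symm.norm_map _

lemma exists_bound_gradient {φ : Rn n → ℝ} (h : ContDiff ℝ ∞ φ) (hc : HasCompactSupport φ) :
    ∃ M, ∀ x, ‖∇ φ x‖ ≤ M := by
  have h1 : ContDiff ℝ 1 φ := h.of_le (by exact_mod_cast le_top)
  obtain ⟨M, hM⟩ := (hc.fderiv (𝕜 := ℝ)).exists_bound_of_continuous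
    (h1.continuous_fderiv (by simp))
  exact ⟨M, fun x => (norm_gradient_eq φ x).trans_le (hM x)⟩

variable {p : ℝ} [Fact (1 < p)]

lemma HasWeakGradient.of_tendsto [IsFiniteMeasure (volume.restrict Ω)] {u : ℕ → Pairs Ω p}
    {w : Pairs Ω p} (hu : ∀ k, HasWeakGradient Ω (u k).1 (u k).2) (h : Tendsto u atTop (𝓝 w)) :
    HasWeakGradient Ω w.1 w.2 := by
  intro φ hφ hc hs
  obtain ⟨M, hM⟩ := exists_bound_gradient hφ hc
  obtain ⟨M', hM'⟩ := hc.exists_bound_of_continuous hφ.continuous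
  have h1 := tendsto_integral_pairing (ContinuousLinearMap.lsmul ℝ ℝ : ℝ →L[ℝ] Rn n →L[ℝ] Rn n)
    (q := 2) (by norm_num) (fun k => Lp.memLp (u k).1) (Lp.memLp w.1)
    (Lp.tendsto_eLpNorm_sub ((continuous_fst.tendsto w).comp h))
    (continuous_gradient (hφ.of_le (by exact_mod_cast le_top))).aestronglyMeasurable
    (ae_of_all _ hM)
  have h2 := tendsto_integral_pairing
    (ContinuousLinearMap.lsmul ℝ ℝ : ℝ →L[ℝ] Rn n →L[ℝ] Rn n).flip
    (factOneLe p).out (fun k => Lp.memLp (u k).2) (Lp.memLp w.2)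
    (Lp.tendsto_eLpNorm_sub ((continuous_snd.tendsto w).comp h))
    hφ.continuous.aestronglyMeasurable (ae_of_all _ hM')
  refine tendsto_nhds_unique h1 (h2.neg.congr fun k => ?_)
  exact (hu k φ hφ hc hs).symm

/-- Choose for each `k` a test function within `1/(k+1)` of the `k`-th pair. The `L²` convergence of
the functions yields `L^p` convergence because `p ≤ 2` and the measure is finite. -/
lemma IsW0.of_tendsto [IsFiniteMeasure (volume.restrict Ω)] (hp2 : p ≤ 2) {u : ℕ → Pairs Ω p}
    {w : Pairs Ω p} (hu : ∀ k, IsW0 Ω p (u k).1 (u k).2) (h : Tendsto u atTop (𝓝 w)) :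
    IsW0 Ω p w.1 w.2 := by
  have key : ∀ k : ℕ, ∃ φ : Rn n → ℝ,
      (ContDiff ℝ 1 φ ∧ HasCompactSupport φ ∧ tsupport φ ⊆ Ω) ∧
      eLpNorm (fun x => φ x - (u k).1 x) (ENNReal.ofReal p) (volume.restrict Ω)
        ≤ ((k : ℝ≥0∞) + 1)⁻¹ ∧
      eLpNorm (fun x => ∇ φ x - (u k).2 x) (ENNReal.ofReal p) (volume.restrict Ω)
        ≤ ((k : ℝ≥0∞) + 1)⁻¹ := fun k => by
    obtain ⟨φ, hφ, a, b⟩ := hu k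
    have hpos : (0 : ℝ≥0∞) < ((k : ℝ≥0∞) + 1)⁻¹ := by simp
    obtain ⟨j, hj1, hj2⟩ := ((a.eventually_le_const hpos).and (b.eventually_le_const hpos)).exists
    exact ⟨φ j, hφ j, hj1, hj2⟩
  choose φ hφ ha hb using key
  have hinv : Tendsto (fun k : ℕ => ((k : ℝ≥0∞) + 1)⁻¹) atTop (𝓝 0) := by
    have := (tendsto_add_atTop_iff_nat 1).2 ENNReal.tendsto_inv_nat_nhds_zero
    simpa using this
  have h1 : Tendsto (fun k => eLpNorm (fun x => (u k).1 x - w.1 x) (ENNReal.ofReal p)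
      (volume.restrict Ω)) atTop (𝓝 0) :=
    tendsto_eLpNorm_sub_of_exponent_le (ofReal_le_two hp2)
      (fun k => Lp.aestronglyMeasurable _) (Lp.aestronglyMeasurable _)
      (Lp.tendsto_eLpNorm_sub ((continuous_fst.tendsto w).comp h))
  have h2 : Tendsto (fun k => eLpNorm (fun x => (u k).2 x - w.2 x) (ENNReal.ofReal p)
      (volume.restrict Ω)) atTop (𝓝 0) :=
    Lp.tendsto_eLpNorm_sub ((continuous_snd.tendsto w).comp h)
  refine ⟨φ, hφ, ?_, ?_⟩
  · refine tendsto_of_tendsto_of_tendsto_of_le_of_le tendsto_const_nhds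
      (by simpa using hinv.add h1) (fun _ => zero_le) fun k => ?_
    refine le_trans (le_of_eq ?_) ((eLpNorm_add_le
      ((hφ k).1.continuous.aestronglyMeasurable.sub (Lp.aestronglyMeasurable (u k).1))
      ((Lp.aestronglyMeasurable (u k).1).sub (Lp.aestronglyMeasurable w.1))
      (factOneLe p).out).trans (add_le_add_left (ha k) _))
    congr 1
    funext x
    simp
  · refine tendsto_of_tendsto_of_tendsto_of_le_of_le tendsto_const_nhds
      (by simpa using hinv.add h2) (fun _ => zero_le) fun k => ?_
    refine le_trans (le_of_eq ?_) ((eLpNorm_add_le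
      ((continuous_gradient (hφ k).1).aestronglyMeasurable.sub (Lp.aestronglyMeasurable (u k).2))
      ((Lp.aestronglyMeasurable (u k).2).sub (Lp.aestronglyMeasurable w.2))
      (factOneLe p).out).trans (add_le_add_left (hb k) _))
    congr 1
    funext x
    simp

lemma isClosed_V₀ (hΩ : Bornology.IsBounded Ω) (hp2 : p ≤ 2) :
    IsClosed (V₀ Ω p : Set (Pairs Ω p)) := by
  have := isFiniteMeasure_restrict_of_isBounded hΩ
  refine isClosed_of_closure_subset fun w hw => ?_
  obtain ⟨u, hu, hlim⟩ := mem_closure_iff_seq_limit.1 hw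
  refine ⟨⟨?_, HasWeakGradient.of_tendsto (fun k => (hu k).1.2) hlim⟩,
    IsW0.of_tendsto hp2 (fun k => (hu k).2) hlim⟩
  exact (Lp.memLp w.1).mono_exponent (ofReal_le_two hp2)

lemma completeSpace_V₀ (hΩ : Bornology.IsBounded Ω) (hp2 : p ≤ 2) : CompleteSpace (V₀ Ω p) :=
  (isClosed_V₀ hΩ hp2).completeSpace_coe

/-- Poincaré's inequality for the approximating test functions, whose gradients tend to zero, forces
their limit to vanish. The Sobolev estimate behind it asks for `p < n`, which follows from `p ≤ 2 <
3 ≤ n`. -/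
lemma eq_zero_of_gradient_eq_zero (hn : 3 ≤ n) (hΩ : Bornology.IsBounded Ω) (hp2 : p ≤ 2)
    {w : Pairs Ω p} (hw : w ∈ V₀ Ω p) (h : w.2 = 0) : w = 0 := by
  obtain ⟨φ, hφ, a, b⟩ := hw.2
  have hp1 : 1 < p := Fact.out
  refine Prod.ext ?_ h
  set q : NNReal := p.toNNReal with hq
  have hqe : ENNReal.ofReal p = (q : ℝ≥0∞) := rfl
  have hb : Tendsto (fun k => eLpNorm (∇ (φ k)) (ENNReal.ofReal p) (volume.restrict Ω)) atTop
      (𝓝 0) := by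
    refine b.congr fun k => eLpNorm_congr_ae ?_
    have h0 : w.2 =ᵐ[volume.restrict Ω] 0 := by rw [h]; exact Lp.coeFn_zero _ _ _
    filter_upwards [h0] with x hx
    rw [hx, Pi.zero_apply, sub_zero]
  set K := eLpNormLESNormFDerivOfLeConst ℝ (volume : Measure (Rn n)) Ω q q
  have hP : ∀ k, eLpNorm (φ k) (ENNReal.ofReal p) (volume.restrict Ω)
      ≤ K * eLpNorm (∇ (φ k)) (ENNReal.ofReal p) (volume.restrict Ω) := fun k => by
    have hsup : Function.support (φ k) ⊆ Ω := (subset_tsupport _).trans (hφ k).2.2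
    have hsup' : Function.support (∇ (φ k)) ⊆ Ω := by
      refine Subset.trans (fun x hx => ?_) (hφ k).2.2
      refine support_fderiv_subset ℝ (f := φ k) ?_
      rw [Function.mem_support] at hx ⊢
      intro h0
      refine hx (norm_eq_zero.1 ?_)
      rw [norm_gradient_eq, h0, norm_zero]
    rw [eLpNorm_restrict_eq_of_support_subset hsup, eLpNorm_restrict_eq_of_support_subset hsup',
      hqe]
    have h1 := eLpNorm_le_eLpNorm_fderiv (volume : Measure (Rn n)) (hφ k).1 hsup (p := q)
      (by rw [hq]; exact Real.one_le_toNNReal.2 hp1.le)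
      (by
        rw [finrank_euclideanSpace_fin, hq, Real.toNNReal_lt_natCast']
        have : (3 : ℝ) ≤ n := by exact_mod_cast hn
        exact ⟨by linarith, by omega⟩) hΩ
    refine h1.trans_eq ?_
    congr 1
    exact eLpNorm_congr_norm_ae (ae_of_all _ fun x => (norm_gradient_eq _ x).symm)
  have hz : eLpNorm w.1 (ENNReal.ofReal p) (volume.restrict Ω) = 0 := by
    have hlim : Tendsto (fun k => eLpNorm (fun x => φ k x - w.1 x) (ENNReal.ofReal p)
        (volume.restrict Ω) + K * eLpNorm (∇ (φ k)) (ENNReal.ofReal p) (volume.restrict Ω))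
        atTop (𝓝 0) := by
      simpa using a.add (ENNReal.Tendsto.const_mul hb (Or.inr ENNReal.coe_ne_top))
    refine le_antisymm (ge_of_tendsto' hlim fun k => ?_) zero_le
    have h1 := eLpNorm_sub_le (f := φ k) (g := fun x => φ k x - w.1 x) (p := ENNReal.ofReal p)
      (μ := volume.restrict Ω) (hφ k).1.continuous.aestronglyMeasurable
      ((hφ k).1.continuous.aestronglyMeasurable.sub (Lp.aestronglyMeasurable w.1))
      (factOneLe p).out
    have e : φ k - (fun x => φ k x - w.1 x) = w.1 := by
      funext x; simp
    rw [e] at h1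
    refine h1.trans ?_
    rw [add_comm]
    gcongr
    exact hP k
  have hae := (eLpNorm_eq_zero_iff (Lp.aestronglyMeasurable w.1)
    (by simpa using (zero_lt_one.trans hp1))).1 hz
  exact (Lp.eq_zero_iff_ae_eq_zero).2 hae

end Closed

/-! ### Integration by parts for functions with values in a Gelfand triple -/

section WeakDerivative

/-- A bump function of integral one, centred at the origin and supported in `(-r, r)`. -/
lemma exists_bump_seq {r : ℝ} (hr : 0 < r) : ∃ φ : ℕ → ContDiffBump (0 : ℝ),
    (∀ k, (φ k).rOut ≤ r) ∧ Tendsto (fun k => (φ k).rOut) atTop (𝓝 0) := by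
  refine ⟨fun k => ⟨r / (k + 1) / 2, r / (k + 1), by positivity, by
    have : 0 < r / (k + 1) := by positivity
    linarith⟩, fun k => ?_, ?_⟩
  · exact div_le_self hr.le (by linarith [k.cast_nonneg (α := ℝ)])
  · simpa [div_eq_mul_inv] using tendsto_one_div_add_atTop_nhds_zero_nat.const_mul r

/-- The smoothed indicator function of `[a, b]`. -/
def smoothIndicator (φ : ContDiffBump (0 : ℝ)) (a b t : ℝ) : ℝ :=
  ∫ s in (t - b)..(t - a), φ.normed volume s

variable {φ : ContDiffBump (0 : ℝ)} {a b : ℝ}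

/-- Testing a weak derivative with this function evaluates, in the limit of small radii, the
difference of the values at `a` and at `b`. -/
lemma hasDerivAt_smoothIndicator (t : ℝ) : HasDerivAt (smoothIndicator φ a b)
    (φ.normed volume (t - a) - φ.normed volume (t - b)) t := by
  have hc : Continuous (φ.normed volume) := φ.continuous_normed
  have hi : ∀ x y, IntervalIntegrable (φ.normed volume) volume x y :=
    fun x y => hc.intervalIntegrable x y
  have h0 : ∀ x, HasDerivAt (fun x => ∫ s in (0 : ℝ)..x, φ.normed volume s) (φ.normed volume x) x :=
    fun x => intervalIntegral.integral_hasDerivAt_right (hi _ _)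
      (hc.stronglyMeasurableAtFilter _ _) hc.continuousAt
  have e : smoothIndicator φ a b = fun t => (∫ s in (0 : ℝ)..(t - a), φ.normed volume s)
      - ∫ s in (0 : ℝ)..(t - b), φ.normed volume s := by
    funext t
    rw [smoothIndicator, intervalIntegral.integral_interval_sub_left (hi _ _) (hi _ _)]
  rw [e]
  have h1 : ∀ c : ℝ, HasDerivAt (fun t => ∫ s in (0 : ℝ)..(t - c), φ.normed volume s)
      (φ.normed volume (t - c)) t := fun c =>
    (h0 (t - c)).comp_sub_const t c
  exact (h1 a).sub (h1 b)

lemma contDiff_smoothIndicator : ContDiff ℝ ∞ (smoothIndicator φ a b) := by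
  rw [contDiff_infty_iff_deriv]
  refine ⟨fun t => (hasDerivAt_smoothIndicator t).differentiableAt, ?_⟩
  have : deriv (smoothIndicator φ a b)
      = fun t => φ.normed volume (t - a) - φ.normed volume (t - b) :=
    funext fun t => (hasDerivAt_smoothIndicator t).deriv
  rw [this]
  exact (φ.contDiff_normed.comp (contDiff_id.sub contDiff_const)).sub
    (φ.contDiff_normed.comp (contDiff_id.sub contDiff_const))

lemma normed_eq_zero {x : ℝ} (hx : φ.rOut ≤ |x|) : φ.normed volume x = 0 := by
  have : x ∉ Function.support (φ.normed volume) := by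
    rw [φ.support_normed_eq]
    simpa using hx
  simpa using this

lemma smoothIndicator_mem_Icc (hab : a ≤ b) (t : ℝ) : smoothIndicator φ a b t ∈ Icc (0 : ℝ) 1 := by
  have h : t - b ≤ t - a := by linarith
  refine ⟨intervalIntegral.integral_nonneg h fun s _ => φ.nonneg_normed s, ?_⟩
  rw [smoothIndicator, intervalIntegral.integral_of_le h, ← φ.integral_normed (μ := volume)]
  exact setIntegral_le_integral φ.integrable_normed (ae_of_all _ fun s => φ.nonneg_normed s)

lemma smoothIndicator_eq_zero (hab : a ≤ b) {t : ℝ} (ht : t ∉ Icc (a - φ.rOut) (b + φ.rOut)) :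
    smoothIndicator φ a b t = 0 := by
  rw [smoothIndicator]
  refine intervalIntegral.integral_zero_ae (ae_of_all _ fun s hs => normed_eq_zero ?_)
  rw [uIoc_of_le (by linarith)] at hs
  rw [mem_Icc, not_and_or, not_le, not_le] at ht
  rcases ht with ht | ht
  · exact (by linarith [hs.2] : φ.rOut ≤ -s).trans (neg_le_abs s)
  · exact (by linarith [hs.1] : φ.rOut ≤ s).trans (le_abs_self s)

lemma smoothIndicator_eq_one {t : ℝ} (h1 : a + φ.rOut ≤ t) (h2 : t ≤ b - φ.rOut) :
    smoothIndicator φ a b t = 1 := by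
  have hr := φ.rOut_pos
  rw [smoothIndicator, intervalIntegral.integral_of_le (by linarith),
    ← φ.integral_normed (μ := volume)]
  refine setIntegral_eq_integral_of_forall_compl_eq_zero fun s hs => normed_eq_zero ?_
  rw [mem_Ioc, not_and_or, not_lt, not_le] at hs
  rcases hs with hs | hs
  · exact (by linarith : φ.rOut ≤ -s).trans (neg_le_abs s)
  · exact (by linarith : φ.rOut ≤ s).trans (le_abs_self s)

lemma tsupport_smoothIndicator_subset (hab : a ≤ b) :
    tsupport (smoothIndicator φ a b) ⊆ Icc (a - φ.rOut) (b + φ.rOut) :=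
  closure_minimal (fun t ht => by
    by_contra h
    exact ht (smoothIndicator_eq_zero hab h)) isClosed_Icc

lemma hasCompactSupport_smoothIndicator (hab : a ≤ b) :
    HasCompactSupport (smoothIndicator φ a b) :=
  isCompact_Icc.of_isClosed_subset (isClosed_tsupport _) (tsupport_smoothIndicator_subset hab)

variable {S : ℝ} {f g : ℝ → ℝ}

lemma tendsto_integral_bump {φ : ℕ → ContDiffBump (0 : ℝ)}
    (hφ : Tendsto (fun k => (φ k).rOut) atTop (𝓝 0)) (hf : Continuous f) (x : ℝ) :
    Tendsto (fun k => ∫ t, (φ k).normed volume (t - x) * f t) atTop (𝓝 (f x)) := by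
  have h := ContDiffBump.convolution_tendsto_right_of_continuous (μ := volume) hφ hf x
  refine h.congr fun k => ?_
  rw [convolution_eq_swap]
  refine integral_congr_ae (ae_of_all _ fun t => ?_)
  simp only [ContinuousLinearMap.lsmul_apply, smul_eq_mul]
  rw [← ContDiffBump.normed_neg, neg_sub]

/-- The weak equation is tested with smoothed indicators of `[a, b]`. Radii at most `min a (S - b) /
2` keep the supports inside `(0, S)`. As the radii shrink, one side tends to `f a - f b` by
continuity, the other to `-∫ g` over `(a, b)` by dominated convergence. -/
lemma sub_eq_integral_of_weak_deriv_interior (hf : Continuous f)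
    (hg : IntegrableOn g (Ioo 0 S))
    (h : ∀ η : ℝ → ℝ, ContDiff ℝ ∞ η → HasCompactSupport η → tsupport η ⊆ Ioo 0 S →
      ∫ t in Ioo 0 S, deriv η t * f t = -∫ t in Ioo 0 S, η t * g t)
    (ha : 0 < a) (hab : a ≤ b) (hb : b < S) :
    f b - f a = ∫ t in a..b, (Ioo 0 S).indicator g t := by
  set r := min a (S - b) / 2 with hr
  have hm : 0 < min a (S - b) := lt_min ha (sub_pos.2 hb)
  have hra : r < a := by
    have := min_le_left a (S - b)
    linarith
  have hrb : r < S - b := by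
    have := min_le_right a (S - b)
    linarith
  obtain ⟨φ, hφr, hφ⟩ := exists_bump_seq (half_pos hm)
  have hzero : ∀ k t, t ∉ Ioo 0 S → deriv (smoothIndicator (φ k) a b) t = 0 := fun k t ht => by
    have h1 : t ∉ tsupport (smoothIndicator (φ k) a b) := fun h' => ht (by
      have := tsupport_smoothIndicator_subset hab h'
      exact ⟨by linarith [this.1, hφr k], by linarith [this.2, hφr k]⟩)
    by_contra h0
    exact h1 (support_deriv_subset h0)
  have hk : ∀ k, (∫ t, (φ k).normed volume (t - a) * f t) - (∫ t, (φ k).normed volume (t - b) * f t)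
      = -∫ t in Ioo 0 S, smoothIndicator (φ k) a b t * g t := fun k => by
    rw [← h _ contDiff_smoothIndicator (hasCompactSupport_smoothIndicator hab)
      ((tsupport_smoothIndicator_subset hab).trans fun t ht =>
        ⟨by linarith [ht.1, hφr k], by linarith [ht.2, hφr k]⟩),
      setIntegral_eq_integral_of_forall_compl_eq_zero fun t ht => by rw [hzero k t ht, zero_mul],
      ← integral_sub]
    · refine integral_congr_ae (ae_of_all _ fun t => ?_)
      simp only [(hasDerivAt_smoothIndicator (φ := φ k) (a := a) (b := b) t).deriv, sub_mul]
    · exact (((φ k).continuous_normed.comp (continuous_sub_right a)).mul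
        hf).integrable_of_hasCompactSupport (((φ k).hasCompactSupport_normed.comp_homeomorph
          (Homeomorph.subRight a)).mul_right)
    · exact (((φ k).continuous_normed.comp (continuous_sub_right b)).mul
        hf).integrable_of_hasCompactSupport (((φ k).hasCompactSupport_normed.comp_homeomorph
          (Homeomorph.subRight b)).mul_right)
  have hL := (tendsto_integral_bump hφ hf a).sub (tendsto_integral_bump hφ hf b)
  simp only [hk] at hL
  have hR : Tendsto (fun k => ∫ t in Ioo 0 S, smoothIndicator (φ k) a b t * g t) atTop
      (𝓝 (∫ t in Ioo 0 S, (Ioo a b).indicator (fun _ => (1 : ℝ)) t * g t)) := by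
    refine tendsto_integral_of_dominated_convergence (fun t => ‖g t‖)
      (fun k => contDiff_smoothIndicator.continuous.aestronglyMeasurable.mul hg.1) hg.norm
      (fun k => ae_of_all _ fun t => ?_) ?_
    · rw [norm_mul]
      have := smoothIndicator_mem_Icc (φ := φ k) hab t
      rw [Real.norm_of_nonneg this.1]
      exact mul_le_of_le_one_left (norm_nonneg _) this.2
    -- Away from the two endpoints, the smoothed indicators eventually equal the indicator.
    · have hne : ∀ x : ℝ, ∀ᵐ t ∂volume.restrict (Ioo 0 S), t ≠ x := fun x =>
        ae_restrict_of_ae (Measure.ae_ne volume x)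
      filter_upwards [hne a, hne b] with t hta htb
      refine Tendsto.mul_const _ (tendsto_const_nhds.congr' ?_)
      by_cases ht : t ∈ Ioo a b
      · have hpos : 0 < min (t - a) (b - t) := lt_min (by linarith [ht.1]) (by linarith [ht.2])
        filter_upwards [hφ.eventually_lt_const hpos] with k hk
        rw [indicator_of_mem ht, smoothIndicator_eq_one]
        · linarith [min_le_left (t - a) (b - t)]
        · linarith [min_le_right (t - a) (b - t)]
      · have hpos : 0 < max (a - t) (t - b) := by
          rcases lt_or_gt_of_ne hta with h' | h'
          · exact lt_max_of_lt_left (by linarith)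
          · rcases lt_or_gt_of_ne htb with h'' | h''
            · exact absurd ⟨h', h''⟩ ht
            · exact lt_max_of_lt_right (by linarith)
        filter_upwards [hφ.eventually_lt_const hpos] with k hk
        rw [indicator_of_notMem ht, smoothIndicator_eq_zero hab]
        rintro ⟨h1, h2⟩
        rcases lt_max_iff.1 hk with h' | h' <;> linarith
  have hlim := tendsto_nhds_unique hL hR.neg
  have e : ∫ t in Ioo 0 S, (Ioo a b).indicator (fun _ => (1 : ℝ)) t * g t
      = ∫ t in a..b, (Ioo 0 S).indicator g t := by
    rw [intervalIntegral.integral_of_le hab, integral_Ioc_eq_integral_Ioo,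
      ← integral_indicator measurableSet_Ioo, ← integral_indicator measurableSet_Ioo]
    congr 1
    funext t
    simp only [indicator]
    split_ifs <;> simp
  rw [← e]
  linarith

/-- The difference of the two sides is constant inside `(0, S)`, hence on `[0, S]` by continuity,
and it vanishes at `0`. Allowing negative times lets the formula be applied to translates `t - s`
that leave the interval. -/
lemma eq_integral_of_weak_deriv (hS : 0 < S) (hf : Continuous f) (hf0 : ∀ t ≤ 0, f t = 0)
    (hg : IntegrableOn g (Ioo 0 S))
    (h : ∀ η : ℝ → ℝ, ContDiff ℝ ∞ η → HasCompactSupport η → tsupport η ⊆ Ioo 0 S →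
      ∫ t in Ioo 0 S, deriv η t * f t = -∫ t in Ioo 0 S, η t * g t)
    {t : ℝ} (ht : t ≤ S) : f t = ∫ s in (0 : ℝ)..t, (Ioo 0 S).indicator g s := by
  have hG : Integrable ((Ioo 0 S).indicator g) := hg.integrable_indicator measurableSet_Ioo
  set D : ℝ → ℝ := fun t => f t - ∫ s in (0 : ℝ)..t, (Ioo 0 S).indicator g s with hD
  have hDc : Continuous D := hf.sub (hG.continuous_primitive 0)
  have hneg : ∀ t ≤ 0, D t = 0 := fun t ht => by
    have : ∫ s in (0 : ℝ)..t, (Ioo 0 S).indicator g s = 0 := by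
      refine intervalIntegral.integral_zero_ae (ae_of_all _ fun s hs => ?_)
      rw [uIoc_of_ge ht] at hs
      exact indicator_of_notMem (fun h' => absurd h'.1 (not_lt.2 hs.2)) _
    rw [hD]
    simp only
    rw [this, hf0 t ht, sub_zero]
  have hconst : ∀ x ∈ Ioo 0 S, ∀ y ∈ Ioo 0 S, x ≤ y → D y = D x := fun x hx y hy hxy => by
    have h1 := sub_eq_integral_of_weak_deriv_interior hf hg h hx.1 hxy hy.2
    have h2 := intervalIntegral.integral_interval_sub_left (a := 0) (b := y) (c := x)
      (f := (Ioo 0 S).indicator g) hG.intervalIntegrable hG.intervalIntegrable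
    simp only [hD]
    linarith
  have hmid : S / 2 ∈ Ioo 0 S := ⟨by linarith, by linarith⟩
  have hcl : Icc 0 S ⊆ {x | D x = D (S / 2)} := by
    rw [← closure_Ioo hS.ne]
    refine closure_minimal (fun x hx => ?_) (isClosed_eq hDc continuous_const)
    rcases le_total x (S / 2) with h' | h'
    · exact (hconst x hx _ hmid h').symm
    · exact hconst _ hmid x hx h'
  have h0 : D t = 0 := by
    rcases le_total t 0 with h' | h'
    · exact hneg t h'
    · exact (hcl ⟨h', ht⟩).trans ((hcl ⟨le_rfl, hS.le⟩).symm.trans (hneg 0 le_rfl))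
  exact sub_eq_zero.1 h0

end WeakDerivative

/-! ### The energy inequality by translation in time -/

section EnergyInequality

variable {E F : Type*} [NormedAddCommGroup E] [NormedSpace ℝ E] [NormedAddCommGroup F]
  [NormedSpace ℝ F]

/-- Translations act continuously on `L^q(ℝ)`, `q < ∞`. -/
lemma continuous_integral_translate (B : E →L[ℝ] F →L[ℝ] ℝ) {q r : ℝ≥0∞} [Fact (1 ≤ q)]
    [Fact (1 ≤ r)] [ENNReal.HolderConjugate q r] (hr : r ≠ ⊤) {f : ℝ → E} {g : ℝ → F}
    (hf : MemLp f q volume) (hg : MemLp g r volume) :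
    Continuous fun s : ℝ => ∫ t, B (f t) (g (t - s)) := by
  have hmp : ∀ s : ℝ, MeasurePreserving (fun t : ℝ => t - s) volume volume :=
    fun s => measurePreserving_sub_right volume s
  have hc : Continuous fun s : ℝ => ContinuousMap.mk (fun t : ℝ => t - s) (by fun_prop) :=
    ContinuousMap.continuous_of_continuous_uncurry _ (by
      simp only [Function.uncurry_def, ContinuousMap.coe_mk]
      fun_prop)
  have h1 : Continuous fun s : ℝ => Lp.compMeasurePreserving (fun t : ℝ => t - s) (hmp s)
      (hg.toLp g) := Continuous.compMeasurePreservingLp continuous_const hc hmp hr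
  have h2 := (B.lpPairing volume q r (hf.toLp f)).continuous.comp h1
  refine h2.congr fun s => ?_
  simp only [Function.comp_apply]
  rw [ContinuousLinearMap.lpPairing_eq_integral]
  refine integral_congr_ae ?_
  filter_upwards [hf.coeFn_toLp, Lp.coeFn_compMeasurePreserving (hg.toLp g) (hmp s),
    (hmp s).quasiMeasurePreserving.ae_eq_comp hg.coeFn_toLp] with t h1 h2 h3
  rw [h1, h2]
  exact congrArg _ h3

/-- If `∫_{S-h}^S a ≤ ∫_0^h b` for all `h > 0` then `a(S) ≤ b(0)`. -/
lemma le_of_forall_integral_le {a b : ℝ → ℝ} (ha : Continuous a) (hb : Continuous b) {S : ℝ}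
    (h : ∀ s > 0, ∫ t in (S - s)..S, a t ≤ ∫ t in (0 : ℝ)..s, b t) : a S ≤ b 0 := by
  by_contra! hlt
  obtain ⟨m, hm1, hm2⟩ := exists_between hlt
  have hev1 : ∀ᶠ t in 𝓝 S, m < a t := ha.continuousAt.eventually_const_lt hm2
  have hev2 : ∀ᶠ t in 𝓝 0, b t < m := hb.continuousAt.eventually_lt_const hm1
  obtain ⟨r₁, hr₁, h1⟩ := Metric.eventually_nhds_iff.1 hev1
  obtain ⟨r₂, hr₂, h2⟩ := Metric.eventually_nhds_iff.1 hev2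
  set s := min r₁ r₂ / 2 with hs
  have hmin : 0 < min r₁ r₂ := lt_min hr₁ hr₂
  have hs0 : 0 < s := by positivity
  have hs1 : s < r₁ := by linarith [min_le_left r₁ r₂]
  have hs2 : s < r₂ := by linarith [min_le_right r₁ r₂]
  have i1 : ∫ t in (S - s)..S, m < ∫ t in (S - s)..S, a t := by
    refine intervalIntegral.integral_lt_integral_of_continuousOn_of_le_of_exists_lt (by linarith)
      continuousOn_const ha.continuousOn (fun t ht => (h1 ?_).le) ⟨S, by simp [hs0.le], hm2⟩
    rw [Real.dist_eq, abs_lt]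
    constructor <;> linarith [ht.1, ht.2]
  have i2 : ∫ t in (0 : ℝ)..s, b t ≤ ∫ t in (0 : ℝ)..s, m := by
    refine intervalIntegral.integral_mono_on hs0.le (hb.intervalIntegrable _ _)
      (continuous_const.intervalIntegrable _ _) fun t ht => (h2 ?_).le
    rw [Real.dist_eq, abs_lt]
    constructor <;> linarith [ht.1, ht.2]
  simp only [intervalIntegral.integral_const, smul_eq_mul, sub_sub_cancel, sub_zero] at i1 i2
  linarith [h s hs0]

variable {H : Type*} [NormedAddCommGroup H] [InnerProductSpace ℝ H]

/-- Pointwise `‖x‖² - ‖y‖² ≤ 2⟪x - y, x⟫`, the difference being `‖x - y‖²`. Translating the second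
square makes the integral telescope to the end layer, since `c` vanishes at negative times. -/
lemma integral_norm_sq_le_translate {c : ℝ → H} (hc : Continuous c) (hc0 : ∀ t ≤ 0, c t = 0)
    {S h : ℝ} (hS : 0 ≤ S) (hh : 0 < h) :
    ∫ t in (S - h)..S, ‖c t‖ ^ 2 ≤ ∫ t in (0 : ℝ)..S, 2 * ⟪c t - c (t - h), c t⟫ := by
  have hi : ∀ x y, IntervalIntegrable (fun t => ‖c t‖ ^ 2) volume x y :=
    fun x y => (hc.norm.pow 2).intervalIntegrable x y
  have h1 : ∫ t in (0 : ℝ)..S, (‖c t‖ ^ 2 - ‖c (t - h)‖ ^ 2)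
      ≤ ∫ t in (0 : ℝ)..S, 2 * ⟪c t - c (t - h), c t⟫ := by
    refine intervalIntegral.integral_mono_on hS (Continuous.intervalIntegrable (by fun_prop) _ _)
      (Continuous.intervalIntegrable (by fun_prop) _ _) fun t _ => ?_
    rw [inner_sub_left, real_inner_self_eq_norm_sq]
    have := real_inner_le_norm (c (t - h)) (c t)
    nlinarith [sq_nonneg (‖c (t - h)‖ - ‖c t‖)]
  refine le_trans (le_of_eq ?_) h1
  rw [intervalIntegral.integral_sub (hi _ _) (Continuous.intervalIntegrable (by fun_prop) _ _),
    intervalIntegral.integral_comp_sub_right (fun t => ‖c t‖ ^ 2) h,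
    ← intervalIntegral.integral_add_adjacent_intervals (hi (0 - h) 0) (hi 0 (S - h)),
    ← intervalIntegral.integral_add_adjacent_intervals (hi 0 (S - h)) (hi (S - h) S)]
  have h0 : ∫ t in (0 - h)..0, ‖c t‖ ^ 2 = 0 := by
    refine intervalIntegral.integral_zero_ae (ae_of_all _ fun t ht => ?_)
    rw [uIoc_of_le (by linarith)] at ht
    simp [hc0 t ht.2]
  rw [h0]
  ring

variable {S : ℝ} {c : ℝ → H} {w : ℝ → E} {W : ℝ → F}

/-- The substitution by the time lag `x` gives an integration range independent of `t`, ready for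
Fubini. -/
lemma inner_sub_translate_eq (B : E →L[ℝ] F →L[ℝ] ℝ) (ι : E →L[ℝ] H) (hS : 0 < S)
    (hc : Continuous c) (hc0 : ∀ t ≤ 0, c t = 0) (hW : IntegrableOn W (Ioo 0 S))
    (h : ∀ (v : E) (η : ℝ → ℝ), ContDiff ℝ ∞ η → HasCompactSupport η → tsupport η ⊆ Ioo 0 S →
      ∫ t in Ioo 0 S, deriv η t * ⟪c t, ι v⟫ = -∫ t in Ioo 0 S, η t * B v (W t))
    (v : E) {t s : ℝ} (ht : t ≤ S) (hs : 0 < s) :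
    ⟪c t - c (t - s), ι v⟫ = ∫ x in (0 : ℝ)..s, B v ((Ioo 0 S).indicator W (t - x)) := by
  have hgv : IntegrableOn (fun t => B v (W t)) (Ioo 0 S) :=
    (B v).integrable_comp hW
  have key := fun {t} => eq_integral_of_weak_deriv (t := t) hS
    (f := fun t => ⟪c t, ι v⟫) (by fun_prop)
    (fun t ht => by simp only [hc0 t ht, inner_zero_left]) hgv (h v)
  have hG : Integrable ((Ioo 0 S).indicator fun t => B v (W t)) :=
    hgv.integrable_indicator measurableSet_Ioo
  rw [inner_sub_left, key ht, key (by linarith : t - s ≤ S),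
    intervalIntegral.integral_interval_sub_left hG.intervalIntegrable hG.intervalIntegrable,
    intervalIntegral.integral_comp_sub_left (fun x => B v ((Ioo 0 S).indicator W x)) t, sub_zero]
  refine intervalIntegral.integral_congr fun x _ => ?_
  simp only [indicator]
  split_ifs <;> simp

/-- For each `t` the increment formula is used with `v = w t`. The double integral may be swapped
because the integrand is that of a convolution of integrable functions extended by zero. -/
lemma integral_inner_translate_eq (B : E →L[ℝ] F →L[ℝ] ℝ) (ι : E →L[ℝ] H) (hS : 0 < S)
    (hcw : ∀ᵐ t ∂timeMeasure S, c t = ι (w t)) (hw : IntegrableOn w (Ioo 0 S))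
    (hW : IntegrableOn W (Ioo 0 S)) {s : ℝ} (hs : 0 < s)
    (h : ∀ (v : E), ∀ t ≤ S,
      ⟪c t - c (t - s), ι v⟫ = ∫ x in (0 : ℝ)..s, B v ((Ioo 0 S).indicator W (t - x))) :
    ∫ t in (0 : ℝ)..S, ⟪c t - c (t - s), c t⟫ = ∫ x in (0 : ℝ)..s, ∫ t, B
        ((Ioo 0 S).indicator w t) ((Ioo 0 S).indicator W (t - x)) := by
  have hfi : Integrable ((Ioo 0 S).indicator w) volume :=
    (integrable_indicator_iff measurableSet_Ioo).2 hw
  have hgi : Integrable ((Ioo 0 S).indicator W) volume :=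
    (integrable_indicator_iff measurableSet_Ioo).2 hW
  have e1 : ∫ t in (0 : ℝ)..S, ⟪c t - c (t - s), c t⟫
      = ∫ t, ∫ x in Ioc 0 s, B
        ((Ioo 0 S).indicator w t) ((Ioo 0 S).indicator W (t - x)) := by
    rw [intervalIntegral.integral_of_le hS.le, integral_Ioc_eq_integral_Ioo,
      ← integral_indicator measurableSet_Ioo]
    refine integral_congr_ae ?_
    filter_upwards [(ae_restrict_iff' measurableSet_Ioo).1 hcw] with t ht
    by_cases htS : t ∈ Ioo 0 S
    · have h1 := h (w t) t htS.2.le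
      simp only [indicator_of_mem htS]
      rw [← intervalIntegral.integral_of_le hs.le, ← h1, ← ht htS]
    · simp only [indicator_of_notMem htS, map_zero, zero_apply, integral_zero]
  rw [e1, intervalIntegral.integral_of_le hs.le]
  have hint : Integrable (fun z : ℝ × ℝ => B
        ((Ioo 0 S).indicator w z.2) ((Ioo 0 S).indicator W (z.2 - z.1)))
      ((volume.restrict (Ioc 0 s)).prod volume) := by
    have h1 := Integrable.convolution_integrand B hfi
      hgi.comp_neg (μ := volume)
    simp only [neg_sub] at h1
    exact h1.mono_measure (Measure.prod_mono Measure.restrict_le_self le_rfl)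
  exact (integral_integral_swap hint).symm

/-- The energy inequality for a function vanishing at time zero, with values in a Gelfand triple
`E → H → F`, where `B` is the duality pairing of `E` and `F`. -/
theorem half_norm_sq_le_integral (B : E →L[ℝ] F →L[ℝ] ℝ) (ι : E →L[ℝ] H) {q r : ℝ≥0∞}
    [Fact (1 ≤ q)] [Fact (1 ≤ r)] [ENNReal.HolderConjugate q r] (hr : r ≠ ⊤) (hS : 0 < S)
    (hc : Continuous c) (hc0 : ∀ t ≤ 0, c t = 0)
    (hcw : ∀ᵐ t ∂timeMeasure S, c t = ι (w t)) (hw : MemLp w q (timeMeasure S))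
    (hW : MemLp W r (timeMeasure S))
    (h : ∀ (v : E) (η : ℝ → ℝ), ContDiff ℝ ∞ η → HasCompactSupport η → tsupport η ⊆ Ioo 0 S →
      ∫ t in Ioo 0 S, deriv η t * ⟪c t, ι v⟫ = -∫ t in Ioo 0 S, η t * B v (W t)) :
    1 / 2 * ‖c S‖ ^ 2 ≤ ∫ t in Ioo 0 S, B (w t) (W t) := by
  have hwi : IntegrableOn w (Ioo 0 S) := hw.integrable Fact.out
  have hWi : IntegrableOn W (Ioo 0 S) := hW.integrable Fact.out
  -- The pairing of `w` with `W` delayed by `x` is continuous in `x`. Its integral over short lags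
  -- dominates `‖c‖²` integrated over the final layer of the same length, so shrinking the layer
  -- leaves the values at time `S` and lag `0`.
  have hJc := continuous_integral_translate
    B hr
    ((memLp_indicator_iff_restrict measurableSet_Ioo).2 hw)
    ((memLp_indicator_iff_restrict measurableSet_Ioo).2 hW)
  have hJ0 : ∫ t in Ioo 0 S, B (w t) (W t) = ∫ t, B
        ((Ioo 0 S).indicator w t) ((Ioo 0 S).indicator W (t - 0)) := by
    rw [← integral_indicator measurableSet_Ioo]
    refine integral_congr_ae (ae_of_all _ fun t => ?_)
    by_cases ht : t ∈ Ioo 0 S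
    · simp only [indicator_of_mem ht, sub_zero]
    · simp only [indicator_of_notMem ht, map_zero, zero_apply]
  have hmain := le_of_forall_integral_le (a := fun t => ‖c t‖ ^ 2) (S := S)
    (by fun_prop) (hJc.const_mul 2) fun s hs => by
      refine (integral_norm_sq_le_translate hc hc0 hS.le hs).trans_eq ?_
      rw [intervalIntegral.integral_const_mul, intervalIntegral.integral_const_mul,
        integral_inner_translate_eq B ι hS hcw hwi hWi hs fun v t ht =>
          inner_sub_translate_eq B ι hS hc hc0 hWi h v ht hs]
  rw [hJ0]
  linarith

end EnergyInequality

/-! ### Integral estimates -/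

section PointwiseEstimates

variable {n : ℕ} {p : ℝ}

lemma rpow_sub_two_mul_sq {R : ℝ} (hR : 0 < R) : R ^ (p - 2) * R ^ 2 = R ^ p := by
  rw [← Real.rpow_natCast R 2, ← Real.rpow_add hR]
  norm_num

/-- Square `R ≤ ‖a - b‖ + 2 (1 + ‖b‖)` and multiply by `R^(p-2)`, which is at most `(1 +
‖b‖)^(p-2)`. The weighted square thus controls the size of `a` once `b` is fixed. -/
lemma rpow_le_of_sub (hp2 : p ≤ 2) (a b : Rn n) :
    (1 + ‖a‖ + ‖b‖) ^ p ≤ 2 * ((1 + ‖a‖ + ‖b‖) ^ (p - 2) * ‖a - b‖ ^ 2) + 8 * (1 + ‖b‖) ^ p := by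
  set R := 1 + ‖a‖ + ‖b‖ with hR
  have ha := norm_nonneg a
  have hb := norm_nonneg b
  have hR0 : 0 < R := by positivity
  have h1 : R ≤ ‖a - b‖ + 2 * (1 + ‖b‖) := by
    have := norm_le_norm_sub_add a b
    linarith
  have h2 : R ^ 2 ≤ 2 * ‖a - b‖ ^ 2 + 8 * (1 + ‖b‖) ^ 2 := by
    nlinarith [sq_nonneg (‖a - b‖ - 2 * (1 + ‖b‖)), norm_nonneg (a - b)]
  have h3 : R ^ (p - 2) ≤ (1 + ‖b‖) ^ (p - 2) :=
    Real.rpow_le_rpow_of_nonpos (by positivity) (by linarith) (by linarith)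
  have hRp : 0 ≤ R ^ (p - 2) := by positivity
  calc R ^ p = R ^ (p - 2) * R ^ 2 := (rpow_sub_two_mul_sq hR0).symm
    _ ≤ R ^ (p - 2) * (2 * ‖a - b‖ ^ 2 + 8 * (1 + ‖b‖) ^ 2) := by gcongr
    _ = 2 * (R ^ (p - 2) * ‖a - b‖ ^ 2) + 8 * (R ^ (p - 2) * (1 + ‖b‖) ^ 2) := by ring
    _ ≤ 2 * (R ^ (p - 2) * ‖a - b‖ ^ 2) + 8 * ((1 + ‖b‖) ^ (p - 2) * (1 + ‖b‖) ^ 2) := by gcongr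
    _ = _ := by rw [rpow_sub_two_mul_sq (by positivity : 0 < 1 + ‖b‖)]

/-- A form of Young's inequality: beyond `R = 2K` the first term dominates, below it the second. -/
lemma mul_rpow_sub_one_le (hp : 1 < p) {K R : ℝ} (hK : 0 ≤ K) (hR : 0 < R) :
    K * R ^ (p - 1) ≤ R ^ p / 2 + K * (2 * K) ^ (p - 1) := by
  rcases le_total R (2 * K) with h | h
  · have : R ^ (p - 1) ≤ (2 * K) ^ (p - 1) := Real.rpow_le_rpow hR.le h (by linarith)
    have h2 : 0 ≤ R ^ p := by positivity
    nlinarith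
  · have h1 : K * R ^ (p - 1) ≤ R / 2 * R ^ (p - 1) := by
      gcongr
      linarith
    have h2 : R / 2 * R ^ (p - 1) = R ^ p / 2 := by
      rw [Real.rpow_sub_one hR.ne']
      field_simp
    have h3 : 0 ≤ K * (2 * K) ^ (p - 1) := by positivity
    linarith

lemma one_add_norm_add_rpow_le (hp : 1 < p) (a b : Rn n) :
    (1 + ‖a‖ + ‖b‖) ^ p ≤ 2 ^ p * ((1 + ‖a‖) ^ p + (1 + ‖b‖) ^ p) := by
  have ha := norm_nonneg a
  have hb := norm_nonneg b
  rcases le_total ‖a‖ ‖b‖ with h | h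
  · calc (1 + ‖a‖ + ‖b‖) ^ p ≤ (2 * (1 + ‖b‖)) ^ p :=
        Real.rpow_le_rpow (by positivity) (by linarith) (by linarith)
      _ = 2 ^ p * (1 + ‖b‖) ^ p := Real.mul_rpow (by norm_num) (by positivity)
      _ ≤ _ := by
        gcongr
        exact le_add_of_nonneg_left (by positivity)
  · calc (1 + ‖a‖ + ‖b‖) ^ p ≤ (2 * (1 + ‖a‖)) ^ p :=
        Real.rpow_le_rpow (by positivity) (by linarith) (by linarith)
      _ = 2 ^ p * (1 + ‖a‖) ^ p := Real.mul_rpow (by norm_num) (by positivity)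
      _ ≤ _ := by
        gcongr
        exact le_add_of_nonneg_right (by positivity)

/-- Split according to whether `‖a - b‖ ≤ s R`. The free parameter `s` plays the part of Hölder
interpolation and is later chosen to balance the two terms. -/
lemma norm_sub_rpow_le (hp : 1 < p) (hp2 : p ≤ 2) (a b : Rn n) {s : ℝ} (hs : 0 < s) :
    ‖a - b‖ ^ p ≤ s ^ (p - 2) * ((1 + ‖a‖ + ‖b‖) ^ (p - 2) * ‖a - b‖ ^ 2)
      + s ^ p * (1 + ‖a‖ + ‖b‖) ^ p := by
  set R := 1 + ‖a‖ + ‖b‖ with hR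
  have hR0 : 0 < R := by positivity
  rcases le_or_gt ‖a - b‖ (s * R) with h | h
  · have h1 : ‖a - b‖ ^ p ≤ s ^ p * R ^ p := by
      rw [← Real.mul_rpow hs.le hR0.le]
      exact Real.rpow_le_rpow (norm_nonneg _) h (by linarith)
    have : 0 ≤ s ^ (p - 2) * (R ^ (p - 2) * ‖a - b‖ ^ 2) := by positivity
    linarith
  · have hpos : 0 < ‖a - b‖ := (by positivity : 0 < s * R).trans h
    have h1 : ‖a - b‖ ^ p ≤ s ^ (p - 2) * (R ^ (p - 2) * ‖a - b‖ ^ 2) := by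
      rw [← rpow_sub_two_mul_sq (p := p) hpos, ← mul_assoc, ← Real.mul_rpow hs.le hR0.le]
      have h3 : ‖a - b‖ ^ (p - 2) ≤ (s * R) ^ (p - 2) :=
        Real.rpow_le_rpow_of_nonpos (mul_pos hs hR0) h.le (by linarith)
      gcongr
    have : 0 ≤ s ^ p * R ^ p := by positivity
    linarith

lemma rpow_sub_two_mul_norm_sub_sq_le (a b : Rn n) :
    (1 + ‖a‖ + ‖b‖) ^ (p - 2) * ‖a - b‖ ^ 2 ≤ (1 + ‖a‖ + ‖b‖) ^ p := by
  have hR0 : 0 < 1 + ‖a‖ + ‖b‖ := by positivity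
  rw [← rpow_sub_two_mul_sq (p := p) hR0]
  exact mul_le_mul_of_nonneg_left (pow_le_pow_left₀ (norm_nonneg _)
    (by linarith [norm_sub_le a b]) 2) (by positivity)

end PointwiseEstimates

/-! ### Uniform bounds and the Cauchy rate in `L^p` -/

section IntegralEstimates

variable {n : ℕ} {p : ℝ} {X : Type*} [MeasurableSpace X] {m : Measure X} [IsFiniteMeasure m]

lemma integrable_one_add_norm_rpow (hp : 1 < p) {a b : X → Rn n}
    (ha : MemLp a (ENNReal.ofReal p) m) (hb : MemLp b (ENNReal.ofReal p) m) :
    Integrable (fun x => (1 + ‖a x‖ + ‖b x‖) ^ p) m := by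
  have h1 : MemLp (fun x => 1 + ‖a x‖ + ‖b x‖) (ENNReal.ofReal p) m :=
    MemLp.add (f := fun x => 1 + ‖a x‖) (MemLp.add (memLp_const (1 : ℝ)) ha.norm) hb.norm
  have := h1.integrable_norm_rpow (by simpa using (zero_lt_one.trans hp)) ENNReal.ofReal_ne_top
  rw [ENNReal.toReal_ofReal (by linarith)] at this
  refine this.congr (ae_of_all _ fun x => ?_)
  simp only
  rw [Real.norm_of_nonneg (by positivity)]

lemma integrable_of_abs_le_one_add_norm_rpow (hp : 1 < p) {a b : X → Rn n}
    (ha : MemLp a (ENNReal.ofReal p) m) (hb : MemLp b (ENNReal.ofReal p) m) {f : X → ℝ}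
    (hf : AEStronglyMeasurable f m) (h : ∀ x, |f x| ≤ (1 + ‖a x‖ + ‖b x‖) ^ p) :
    Integrable f m :=
  (integrable_one_add_norm_rpow hp ha hb).mono' hf (ae_of_all _ h)

lemma integrable_rpow_mul_sq (hp : 1 < p) {a b : X → Rn n}
    (ha : MemLp a (ENNReal.ofReal p) m) (hb : MemLp b (ENNReal.ofReal p) m) :
    Integrable (fun x => (1 + ‖a x‖ + ‖b x‖) ^ (p - 2) * ‖a x - b x‖ ^ 2) m := by
  refine integrable_of_abs_le_one_add_norm_rpow hp ha hb ?_ fun x => ?_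
  · have h1 : AEMeasurable (fun x => 1 + ‖a x‖ + ‖b x‖) m :=
      (aemeasurable_const.add ha.1.norm.aemeasurable).add hb.1.norm.aemeasurable
    exact (h1.pow_const _).aestronglyMeasurable.mul ((ha.1.sub hb.1).norm.pow 2)
  · rw [abs_of_nonneg (by positivity)]
    exact rpow_sub_two_mul_norm_sub_sq_le _ _

lemma integrable_rpow_sub_one (hp : 1 < p) {a b : X → Rn n}
    (ha : MemLp a (ENNReal.ofReal p) m) (hb : MemLp b (ENNReal.ofReal p) m) :
    Integrable (fun x => (1 + ‖a x‖ + ‖b x‖) ^ (p - 1)) m := by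
  refine integrable_of_abs_le_one_add_norm_rpow hp ha hb ?_ fun x => ?_
  · have h1 : AEMeasurable (fun x => 1 + ‖a x‖ + ‖b x‖) m :=
      (aemeasurable_const.add ha.1.norm.aemeasurable).add hb.1.norm.aemeasurable
    exact (h1.pow_const _).aestronglyMeasurable
  · rw [abs_of_nonneg (by positivity)]
    exact Real.rpow_le_rpow_of_exponent_le
      (by linarith [norm_nonneg (a x), norm_nonneg (b x)]) (by linarith)

lemma integral_rpow_sub_one_le (hp : 1 < p) {a b : X → Rn n}
    (ha : MemLp a (ENNReal.ofReal p) m) (hb : MemLp b (ENNReal.ofReal p) m) :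
    ∫ x, (1 + ‖a x‖ + ‖b x‖) ^ (p - 1) ∂m ≤ ∫ x, (1 + ‖a x‖ + ‖b x‖) ^ p ∂m :=
  integral_mono (integrable_rpow_sub_one hp ha hb) (integrable_one_add_norm_rpow hp ha hb)
    fun x => Real.rpow_le_rpow_of_exponent_le
      (by linarith [norm_nonneg (a x), norm_nonneg (b x)]) (by linarith)

/-- A bound in `L^p` for `a` in terms of `b`. -/
lemma integral_rpow_le_of_integral_le (hp : 1 < p) (hp2 : p ≤ 2) {K : ℝ} (hK : 0 ≤ K)
    {a b : X → Rn n} (ha : MemLp a (ENNReal.ofReal p) m) (hb : MemLp b (ENNReal.ofReal p) m)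
    (h : ∫ x, (1 + ‖a x‖ + ‖b x‖) ^ (p - 2) * ‖a x - b x‖ ^ 2 ∂m
      ≤ K * ∫ x, (1 + ‖a x‖ + ‖b x‖) ^ (p - 1) ∂m) :
    ∫ x, (1 + ‖a x‖ + ‖b x‖) ^ p ∂m
      ≤ 2 * (m.real univ * (2 * K * (2 * (2 * K)) ^ (p - 1)) + 8 * ∫ x, (1 + ‖b x‖) ^ p ∂m) := by
  have hi := integrable_one_add_norm_rpow hp ha hb
  have hib : Integrable (fun x => (1 + ‖b x‖) ^ p) m := by
    have := integrable_one_add_norm_rpow hp (MemLp.zero' (ε := Rn n)) hb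
    simpa using this
  have h1 : ∫ x, (1 + ‖a x‖ + ‖b x‖) ^ p ∂m
      ≤ 2 * ∫ x, (1 + ‖a x‖ + ‖b x‖) ^ (p - 2) * ‖a x - b x‖ ^ 2 ∂m
        + 8 * ∫ x, (1 + ‖b x‖) ^ p ∂m := by
    rw [← integral_const_mul, ← integral_const_mul, ← integral_add
      ((integrable_rpow_mul_sq hp ha hb).const_mul _) (hib.const_mul _)]
    exact integral_mono hi (((integrable_rpow_mul_sq hp ha hb).const_mul _).add (hib.const_mul _))
      fun x => rpow_le_of_sub hp2 _ _
  -- Half of the left-hand side reappears on the right and is absorbed, which accounts for the outer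
  -- factor `2` in the conclusion.
  have h2 : 2 * K * ∫ x, (1 + ‖a x‖ + ‖b x‖) ^ (p - 1) ∂m
      ≤ (∫ x, (1 + ‖a x‖ + ‖b x‖) ^ p ∂m) / 2
        + m.real univ * (2 * K * (2 * (2 * K)) ^ (p - 1)) := by
    rw [← integral_const_mul, ← integral_div, ← smul_eq_mul (m.real univ), ← integral_const,
      ← integral_add (hi.div_const _) (integrable_const _)]
    refine integral_mono ((integrable_rpow_sub_one hp ha hb).const_mul _)
      ((hi.div_const _).add (integrable_const _)) fun x => ?_
    exact mul_rpow_sub_one_le hp (by positivity) (by positivity)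
  linarith

/-- A family satisfying the quantitative monotonicity inequality is bounded and Cauchy. -/
lemma exists_bound_of_monotone (hp : 1 < p) (hp2 : p ≤ 2) {K : ℝ} (hK : 0 ≤ K)
    {a : ℝ → X → Rn n} (ha : ∀ ε ∈ Ioo (0 : ℝ) 1, MemLp (a ε) (ENNReal.ofReal p) m)
    (h : ∀ ε ∈ Ioo (0 : ℝ) 1, ∀ δ ∈ Ioo (0 : ℝ) 1,
      ∫ x, (1 + ‖a ε x‖ + ‖a δ x‖) ^ (p - 2) * ‖a ε x - a δ x‖ ^ 2 ∂m
        ≤ K * (ε + δ) * ∫ x, (1 + ‖a ε x‖ + ‖a δ x‖) ^ (p - 1) ∂m) :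
    ∃ M, 0 ≤ M ∧ ∀ ε ∈ Ioo (0 : ℝ) 1, ∀ δ ∈ Ioo (0 : ℝ) 1,
      ∫ x, (1 + ‖a ε x‖ + ‖a δ x‖) ^ (p - 1) ∂m ≤ M ∧
      ∫ x, ‖a ε x - a δ x‖ ^ p ∂m ≤ M * (ε + δ) ^ (p / 2) := by
  have hhalf : (1 / 2 : ℝ) ∈ Ioo (0 : ℝ) 1 := by norm_num
  -- Every member is compared with the one of index `1/2`, so a single fixed function bounds the
  -- whole family.
  obtain ⟨M₀, hM₀⟩ : ∃ M₀, ∀ ε ∈ Ioo (0 : ℝ) 1, ∫ x, (1 + ‖a ε x‖) ^ p ∂m ≤ M₀ := by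
    refine ⟨2 * (m.real univ * (2 * (K * 2) * (2 * (2 * (K * 2))) ^ (p - 1))
      + 8 * ∫ x, (1 + ‖a (1 / 2) x‖) ^ p ∂m), fun ε hε => ?_⟩
    have h1 := h ε hε (1 / 2) hhalf
    have h2 : ∫ x, (1 + ‖a ε x‖ + ‖a (1 / 2) x‖) ^ (p - 2) * ‖a ε x - a (1 / 2) x‖ ^ 2 ∂m
        ≤ K * 2 * ∫ x, (1 + ‖a ε x‖ + ‖a (1 / 2) x‖) ^ (p - 1) ∂m := by
      refine h1.trans (mul_le_mul_of_nonneg_right ?_ (integral_nonneg fun x => by positivity))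
      gcongr
      linarith [hε.2]
    refine le_trans ?_ (integral_rpow_le_of_integral_le hp hp2 (by positivity) (ha ε hε)
      (ha _ hhalf) h2)
    refine integral_mono_of_nonneg (ae_of_all _ fun x => by positivity)
      (integrable_one_add_norm_rpow hp (ha ε hε) (ha _ hhalf)) (ae_of_all _ fun x => ?_)
    exact Real.rpow_le_rpow (by positivity) (by linarith [norm_nonneg (a (1 / 2) x)]) (by linarith)
  have hM₀0 : 0 ≤ M₀ := le_trans (integral_nonneg fun x => by positivity) (hM₀ _ hhalf)
  have hone : ∀ ε ∈ Ioo (0 : ℝ) 1, Integrable (fun x => (1 + ‖a ε x‖) ^ p) m := fun ε hε => by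
    have := integrable_one_add_norm_rpow hp (MemLp.zero' (ε := Rn n)) (ha ε hε)
    simpa using this
  set M₁ := 2 ^ p * (M₀ + M₀) with hM₁
  have hM₁0 : 0 ≤ M₁ := by positivity
  have hR : ∀ ε ∈ Ioo (0 : ℝ) 1, ∀ δ ∈ Ioo (0 : ℝ) 1,
      ∫ x, (1 + ‖a ε x‖ + ‖a δ x‖) ^ p ∂m ≤ M₁ := fun ε hε δ hδ => by
    calc ∫ x, (1 + ‖a ε x‖ + ‖a δ x‖) ^ p ∂m
        ≤ ∫ x, 2 ^ p * ((1 + ‖a ε x‖) ^ p + (1 + ‖a δ x‖) ^ p) ∂m :=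
          integral_mono (integrable_one_add_norm_rpow hp (ha ε hε) (ha δ hδ))
            (((hone ε hε).add (hone δ hδ)).const_mul _) fun x => one_add_norm_add_rpow_le hp _ _
      _ = 2 ^ p * (∫ x, (1 + ‖a ε x‖) ^ p ∂m + ∫ x, (1 + ‖a δ x‖) ^ p ∂m) := by
          rw [integral_const_mul, integral_add (hone ε hε) (hone δ hδ)]
      _ ≤ M₁ := by
          rw [hM₁]
          gcongr
          · exact hM₀ ε hε
          · exact hM₀ δ hδ
  refine ⟨M₁ + (K * M₁ + M₁), by positivity, fun ε hε δ hδ => ?_⟩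
  have hR1 := (integral_rpow_sub_one_le hp (ha ε hε) (ha δ hδ)).trans (hR ε hε δ hδ)
  refine ⟨hR1.trans (le_add_of_nonneg_right (by positivity)), ?_⟩
  have hεδ : 0 < ε + δ := add_pos hε.1 hδ.1
  -- This choice gives `s^(p-2) (ε + δ) = s^p`, so both terms have order `(ε + δ)^(p/2)`.
  set s := (ε + δ) ^ (1 / 2 : ℝ) with hs
  have hs0 : 0 < s := by positivity
  have hs2 : s ^ 2 = ε + δ := by
    rw [hs, ← Real.rpow_natCast, ← Real.rpow_mul hεδ.le]
    norm_num
  have hsp : s ^ p = (ε + δ) ^ (p / 2) := by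
    rw [hs, ← Real.rpow_mul hεδ.le]
    congr 1
    ring
  have hint := integrable_rpow_mul_sq hp (ha ε hε) (ha δ hδ)
  have hint2 := integrable_one_add_norm_rpow hp (ha ε hε) (ha δ hδ)
  calc ∫ x, ‖a ε x - a δ x‖ ^ p ∂m
      ≤ ∫ x, (s ^ (p - 2) * ((1 + ‖a ε x‖ + ‖a δ x‖) ^ (p - 2) * ‖a ε x - a δ x‖ ^ 2)
        + s ^ p * (1 + ‖a ε x‖ + ‖a δ x‖) ^ p) ∂m :=
        integral_mono_of_nonneg (ae_of_all _ fun x => by positivity)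
          ((hint.const_mul _).add (hint2.const_mul _))
          (ae_of_all _ fun x => norm_sub_rpow_le hp hp2 _ _ hs0)
    _ = s ^ (p - 2) * (∫ x, (1 + ‖a ε x‖ + ‖a δ x‖) ^ (p - 2) * ‖a ε x - a δ x‖ ^ 2 ∂m)
        + s ^ p * ∫ x, (1 + ‖a ε x‖ + ‖a δ x‖) ^ p ∂m := by
        rw [integral_add (hint.const_mul _) (hint2.const_mul _), integral_const_mul,
          integral_const_mul]
    _ ≤ s ^ (p - 2) * (K * (ε + δ) * M₁) + s ^ p * M₁ := by
        gcongr
        · refine (h ε hε δ hδ).trans ?_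
          gcongr
        · exact hR ε hε δ hδ
    _ = (K * M₁ + M₁) * (s ^ (p - 2) * s ^ 2) := by
        rw [← rpow_sub_two_mul_sq (p := p) hs0, hs2]
        ring
    _ ≤ _ := by
        rw [rpow_sub_two_mul_sq hs0, hsp]
        exact mul_le_mul_of_nonneg_right (le_add_of_nonneg_left hM₁0) (by positivity)

end IntegralEstimates

/-! ### Functions with values in a dual space -/

section Dual

variable {E H : Type*} [NormedAddCommGroup E] [NormedSpace ℝ E] [NormedAddCommGroup H]
  [InnerProductSpace ℝ H] {q r : ℝ≥0∞} {X : Type*} [MeasurableSpace X] {μ ν : Measure X}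

lemma memLp_dual_mono_measure {W : X → StrongDual ℝ E} (hW : MemLp W q μ) (h : ν ≤ μ) :
    MemLp W q ν := hW.mono_measure h

lemma memLp_dual_sub {W W' : X → StrongDual ℝ E} (hW : MemLp W q μ) (hW' : MemLp W' q μ) :
    MemLp (fun t => W t - W' t) q μ := hW.sub hW'

lemma integrable_dual_apply_const [IsFiniteMeasure μ] [Fact (1 ≤ q)] {W : X → StrongDual ℝ E}
    (hW : MemLp W q μ) (v : E) : Integrable (fun t => W t v) μ :=
  (ContinuousLinearMap.apply ℝ ℝ v : StrongDual ℝ E →L[ℝ] ℝ).integrable_comp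
    (hW.integrable Fact.out)

lemma integrable_dual_apply [ENNReal.HolderConjugate q r] {W : X → StrongDual ℝ E} {w : X → E}
    (hW : MemLp W r μ) (hw : MemLp w q μ) : Integrable (fun t => W t (w t)) μ :=
  memLp_one_iff_integrable.1 (ContinuousLinearMap.memLp_of_bilin 1
    (ContinuousLinearMap.apply ℝ ℝ : E →L[ℝ] StrongDual ℝ E →L[ℝ] ℝ) hw hW)

/-- The energy inequality for a function whose time derivative takes values in the dual. -/
lemma half_norm_sq_le_integral_dual [Fact (1 ≤ q)] [Fact (1 ≤ r)]
    [ENNReal.HolderConjugate q r] (ι : E →L[ℝ] H) (hr : r ≠ ⊤) {S : ℝ} (hS : 0 < S)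
    {c : ℝ → H} {w : ℝ → E} {W : ℝ → StrongDual ℝ E} (hc : Continuous c) (hc0 : ∀ t ≤ 0, c t = 0)
    (hcw : ∀ᵐ t ∂timeMeasure S, c t = ι (w t)) (hw : MemLp w q (timeMeasure S))
    (hW : MemLp W r (timeMeasure S))
    (h : ∀ (v : E) (η : ℝ → ℝ), ContDiff ℝ ∞ η → HasCompactSupport η → tsupport η ⊆ Ioo 0 S →
      ∫ t in Ioo 0 S, deriv η t * ⟪c t, ι v⟫ = -∫ t in Ioo 0 S, η t * W t v) :
    1 / 2 * ‖c S‖ ^ 2 ≤ ∫ t in Ioo 0 S, W t (w t) :=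
  half_norm_sq_le_integral (ContinuousLinearMap.apply ℝ ℝ : E →L[ℝ] StrongDual ℝ E →L[ℝ] ℝ) ι hr
    hS hc hc0 hcw hw hW h

end Dual
/-! ### Parabolic function spaces -/

section Parabolic

variable {n : ℕ} {Ω : Set (Rn n)} {p : ℝ} [Fact (1 < p)] {S T : ℝ}

/-- The exponent `p' = p / (p - 1)`. -/
abbrev conjExp (p : ℝ) : ℝ≥0∞ := ENNReal.ofReal (p / (p - 1))

instance holderConjugate_conjExp (p : ℝ) [h : Fact (1 < p)] :
    ENNReal.HolderConjugate (ENNReal.ofReal p) (conjExp p) :=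
  (Real.HolderConjugate.conjExponent h.out).ennrealOfReal

instance factOneLeConjExp (p : ℝ) [h : Fact (1 < p)] : Fact (1 ≤ conjExp p) := by
  refine ⟨?_⟩
  rw [ENNReal.one_le_ofReal, one_le_div (by linarith [h.out])]
  linarith

instance factOfRealNeTop (x : ℝ) : Fact (ENNReal.ofReal x ≠ ⊤) := ⟨ENNReal.ofReal_ne_top⟩

lemma restrict_spaceTime : (volume.restrict (spaceTime Ω T) : Measure (Rn n × ℝ))
    = (volume.restrict Ω).prod (timeMeasure T) := by
  rw [Measure.prod_restrict, Measure.volume_eq_prod]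

lemma timeMeasure_mono (h : S ≤ T) : timeMeasure S ≤ timeMeasure T :=
  Measure.restrict_mono (Ioo_subset_Ioo_right h) le_rfl

lemma spaceTime_mono (h : S ≤ T) : spaceTime Ω S ⊆ spaceTime Ω T :=
  prod_mono Subset.rfl (Ioo_subset_Ioo_right h)

lemma ae_timeMeasure_mono (h : S ≤ T) {P : ℝ → Prop} (hP : ∀ᵐ t ∂timeMeasure T, P t) :
    ∀ᵐ t ∂timeMeasure S, P t :=
  (Measure.absolutelyContinuous_of_le (timeMeasure_mono h)).ae_le hP

lemma setIntegral_Ioo_eq_of_tsupport {f : ℝ → ℝ} (h : S ≤ T) (hf : ∀ t, t ∉ Ioo 0 S → f t = 0) :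
    ∫ t in Ioo 0 S, f t = ∫ t in Ioo 0 T, f t := by
  rw [setIntegral_eq_integral_of_forall_compl_eq_zero hf,
    setIntegral_eq_integral_of_forall_compl_eq_zero fun t ht => hf t fun h' =>
      ht (Ioo_subset_Ioo_right h h')]

lemma IsTimeDeriv.mono (h : S ≤ T) {u : ℝ → Lp ℝ 2 (volume.restrict Ω)} {W : ℝ → V₀Dual Ω p}
    (hu : IsTimeDeriv Ω p T u W) : IsTimeDeriv Ω p S u W := by
  refine ⟨memLp_dual_mono_measure hu.1 (timeMeasure_mono h), fun v η h1 h2 h3 => ?_⟩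
  rw [setIntegral_Ioo_eq_of_tsupport h fun t ht => ?_,
    setIntegral_Ioo_eq_of_tsupport h fun t ht => ?_]
  · exact hu.2 v η h1 h2 (h3.trans (Ioo_subset_Ioo_right h))
  · rw [image_eq_zero_of_notMem_tsupport fun h' => ht (h3 h'), zero_mul]
  · have : deriv η t = 0 := by
      by_contra h0
      exact ht (h3 (support_deriv_subset h0))
    rw [this, zero_mul]

lemma IsTimeDeriv.congr {u v : ℝ → Lp ℝ 2 (volume.restrict Ω)} {W : ℝ → V₀Dual Ω p}
    (hu : IsTimeDeriv Ω p T u W) (h : ∀ᵐ t ∂timeMeasure T, u t = v t) :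
    IsTimeDeriv Ω p T v W := by
  refine ⟨hu.1, fun w η h1 h2 h3 => ?_⟩
  rw [← hu.2 w η h1 h2 h3]
  refine integral_congr_ae ?_
  filter_upwards [h] with t ht
  rw [ht]

lemma exists_bound_deriv {η : ℝ → ℝ} (h : ContDiff ℝ ∞ η) (hc : HasCompactSupport η) :
    ∃ M, ∀ t, ‖deriv η t‖ ≤ M :=
  hc.deriv.exists_bound_of_continuous (h.continuous_deriv (by simp))

lemma integrable_deriv_mul_inner {u : ℝ → Lp ℝ 2 (volume.restrict Ω)}
    (hu : Integrable u (timeMeasure T)) (v : Lp ℝ 2 (volume.restrict Ω)) {η : ℝ → ℝ}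
    (h : ContDiff ℝ ∞ η) (hc : HasCompactSupport η) :
    Integrable (fun t => deriv η t * ⟪u t, v⟫) (timeMeasure T) := by
  obtain ⟨M, hM⟩ := exists_bound_deriv h hc
  exact (hu.inner_const v).bdd_mul (h.continuous_deriv (by simp)).aestronglyMeasurable
    (ae_of_all _ hM)

lemma integrable_mul_apply {W : ℝ → V₀Dual Ω p} (hW : MemLp W (conjExp p) (timeMeasure T))
    (v : V₀ Ω p) {η : ℝ → ℝ} (h : ContDiff ℝ ∞ η) (hc : HasCompactSupport η) :
    Integrable (fun t => η t * W t v) (timeMeasure T) := by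
  obtain ⟨M, hM⟩ := hc.exists_bound_of_continuous h.continuous
  exact (integrable_dual_apply_const hW v).bdd_mul h.continuous.aestronglyMeasurable
    (ae_of_all _ hM)

lemma IsTimeDeriv.sub {u v : ℝ → Lp ℝ 2 (volume.restrict Ω)} {W W' : ℝ → V₀Dual Ω p}
    (hu : IsTimeDeriv Ω p T u W) (hv : IsTimeDeriv Ω p T v W')
    (hui : Integrable u (timeMeasure T)) (hvi : Integrable v (timeMeasure T)) :
    IsTimeDeriv Ω p T (fun t => u t - v t) (fun t => W t - W' t) := by
  refine ⟨memLp_dual_sub hu.1 hv.1, fun w η h1 h2 h3 => ?_⟩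
  have e1 : ∀ t, deriv η t * ⟪u t - v t, w.1.1⟫
      = deriv η t * ⟪u t, w.1.1⟫ - deriv η t * ⟪v t, w.1.1⟫ := fun t => by
    rw [inner_sub_left, mul_sub]
  have e2 : ∀ t, η t * (W t - W' t) w = η t * W t w - η t * W' t w := fun t => by
    rw [sub_apply, mul_sub]
  simp only [e1, e2]
  rw [integral_sub (integrable_deriv_mul_inner hui _ h1 h2)
      (integrable_deriv_mul_inner hvi _ h1 h2),
    integral_sub (integrable_mul_apply hu.1 _ h1 h2) (integrable_mul_apply hv.1 _ h1 h2),
    hu.2 w η h1 h2 h3, hv.2 w η h1 h2 h3]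
  ring

/-- The projection of `L²(Ω) × L^p(Ω; ℝⁿ)` to `L²(Ω)`. -/
abbrev fstL (Ω : Set (Rn n)) (p : ℝ) [Fact (1 < p)] : Pairs Ω p →L[ℝ] Lp ℝ 2 (volume.restrict Ω) :=
  ContinuousLinearMap.fst ℝ _ _

/-- The projection of `L²(Ω) × L^p(Ω; ℝⁿ)` to `L^p(Ω; ℝⁿ)`. -/
abbrev sndL (Ω : Set (Rn n)) (p : ℝ) [Fact (1 < p)] :
    Pairs Ω p →L[ℝ] Lp (Rn n) (ENNReal.ofReal p) (volume.restrict Ω) :=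
  ContinuousLinearMap.snd ℝ _ _

lemma memLp_coe {K : Submodule ℝ (Pairs Ω p)} {u : ℝ → K} {q : ℝ≥0∞}
    (hu : MemLp u q (timeMeasure T)) : MemLp (fun t => (u t : Pairs Ω p)) q (timeMeasure T) :=
  K.subtypeL.comp_memLp' hu

lemma memLp_fst {K : Submodule ℝ (Pairs Ω p)} {u : ℝ → K} {q : ℝ≥0∞}
    (hu : MemLp u q (timeMeasure T)) : MemLp (fun t => (u t : Pairs Ω p).1) q (timeMeasure T) :=
  (fstL Ω p).comp_memLp' (memLp_coe hu)

lemma integrable_fst {K : Submodule ℝ (Pairs Ω p)} {u : ℝ → K}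
    (hu : MemLp u (ENNReal.ofReal p) (timeMeasure T)) :
    Integrable (fun t => (u t : Pairs Ω p).1) (timeMeasure T) :=
  (memLp_fst hu).integrable (factOneLe p).out

lemma integrable_apply {W : ℝ → V₀Dual Ω p} {w : ℝ → V₀ Ω p}
    (hW : MemLp W (conjExp p) (timeMeasure T)) (hw : MemLp w (ENNReal.ofReal p) (timeMeasure T)) :
    Integrable (fun t => W t (w t)) (timeMeasure T) :=
  integrable_dual_apply hW hw

/-- The energy inequality in `X₀^p(0,S;Ω)`. -/
lemma IsTimeDeriv.half_norm_sq_le (hS : 0 < S) {w : ℝ → V₀ Ω p} {W : ℝ → V₀Dual Ω p}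
    (hw : MemLp w (ENNReal.ofReal p) (timeMeasure S))
    (hW : IsTimeDeriv Ω p S (fun t => (w t).1.1) W) {c : ℝ → Lp ℝ 2 (volume.restrict Ω)}
    (hc : ContinuousOn c (Icc 0 S)) (hcw : ∀ᵐ t ∂timeMeasure S, c t = (w t).1.1) (hc0 : c 0 = 0) :
    1 / 2 * ‖c S‖ ^ 2 ≤ ∫ t in Ioo 0 S, W t (w t) := by
  -- The extension is constant outside `[0, S]`, hence zero at negative times because `c 0 = 0`.
  set d : ℝ → Lp ℝ 2 (volume.restrict Ω) := IccExtend hS.le ((Icc 0 S).domRestrict c) with hd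
  have hdc : Continuous d := (continuousOn_iff_continuous_domRestrict.1 hc).Icc_extend'
  have hde : ∀ t ∈ Icc 0 S, d t = c t := fun t ht => IccExtend_of_mem _ _ ht
  have hd0 : ∀ t ≤ 0, d t = 0 := fun t ht => by
    rw [hd, IccExtend_of_le_left _ _ ht]
    exact hc0
  have hdw : ∀ᵐ t ∂timeMeasure S, d t = (w t).1.1 := by
    filter_upwards [hcw, ae_restrict_mem measurableSet_Ioo] with t h1 h2
    rw [hde t (Ioo_subset_Icc_self h2), h1]
  have hdW : IsTimeDeriv Ω p S d W := hW.congr (hdw.mono fun t ht => ht.symm)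
  have := half_norm_sq_le_integral_dual
    ((fstL Ω p).comp (V₀ Ω p).subtypeL) (q := ENNReal.ofReal p) (r := conjExp p)
    ENNReal.ofReal_ne_top hS hdc hd0 hdw hw hW.1 hdW.2
  rwa [hde S (right_mem_Icc.2 hS.le)] at this

lemma IsSpaceTimeGradient.isSlice {u : ℝ → Pairs Ω p} {G : Rn n × ℝ → Rn n}
    (h : IsSpaceTimeGradient Ω p T u G) :
    IsSlice (volume.restrict Ω) (timeMeasure T) G fun t => (u t).2 := h.2

lemma IsSpaceTimeGradient.memLp {u : ℝ → Pairs Ω p} {G : Rn n × ℝ → Rn n}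
    (h : IsSpaceTimeGradient Ω p T u G) :
    MemLp G (ENNReal.ofReal p) ((volume.restrict Ω).prod (timeMeasure T)) := by
  rw [← restrict_spaceTime]
  exact h.1

lemma IsSpaceTimeGradient.mono (h : S ≤ T) {u : ℝ → Pairs Ω p} {G : Rn n × ℝ → Rn n}
    (hu : IsSpaceTimeGradient Ω p T u G) : IsSpaceTimeGradient Ω p S u G :=
  ⟨hu.1.mono_measure (Measure.restrict_mono (spaceTime_mono h) le_rfl),
    ae_timeMeasure_mono h hu.2⟩

lemma IsSpaceTimeGradient.sub {u v w : ℝ → Pairs Ω p} {G H : Rn n × ℝ → Rn n}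
    (hu : IsSpaceTimeGradient Ω p T u G) (hv : IsSpaceTimeGradient Ω p T v H)
    (hw : ∀ᵐ t ∂timeMeasure T, w t = u t - v t) :
    IsSpaceTimeGradient Ω p T w (G - H) := by
  refine ⟨hu.1.sub hv.1, ?_⟩
  filter_upwards [hu.isSlice.sub hv.isSlice, hw] with t h1 h2
  rw [h2]
  exact h1

lemma exists_isSpaceTimeGradient (hΩ : Bornology.IsBounded Ω) {u : ℝ → Pairs Ω p}
    (hu : MemLp u (ENNReal.ofReal p) (timeMeasure T)) :
    ∃ G, IsSpaceTimeGradient Ω p T u G := by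
  have := isFiniteMeasure_restrict_of_isBounded hΩ
  obtain ⟨G, h1, h2⟩ := exists_joint (μ := volume.restrict Ω) ((sndL Ω p).comp_memLp' hu)
  exact ⟨G, by rwa [← restrict_spaceTime] at h1, h2⟩

lemma IsSpaceTimeGradient.eLpNorm_eq (hΩ : Bornology.IsBounded Ω) {u : ℝ → Pairs Ω p}
    {G : Rn n × ℝ → Rn n} (h : IsSpaceTimeGradient Ω p T u G) :
    eLpNorm G (ENNReal.ofReal p) (volume.restrict (spaceTime Ω T))
      = eLpNorm (fun t => (u t).2) (ENNReal.ofReal p) (timeMeasure T) := by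
  have := isFiniteMeasure_restrict_of_isBounded hΩ
  have hp : (1 : ℝ) < p := Fact.out
  rw [restrict_spaceTime]
  exact h.isSlice.eLpNorm_eq (by simpa using (zero_lt_one.trans hp)) ENNReal.ofReal_ne_top h.memLp.1

lemma integrable_inner_of_memLp {X : Type*} [MeasurableSpace X] {m : Measure X} {Y G : X → Rn n}
    (hY : MemLp Y (conjExp p) m) (hG : MemLp G (ENNReal.ofReal p) m) :
    Integrable (fun z => ⟪Y z, G z⟫) m := by
  have : ENNReal.HolderConjugate (conjExp p) (ENNReal.ofReal p) := ENNReal.HolderTriple.symm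
  exact memLp_one_iff_integrable.1
    (ContinuousLinearMap.memLp_of_bilin 1 (innerSL ℝ : Rn n →L[ℝ] Rn n →L[ℝ] ℝ) hY hG)

/-- `Y` is the flux associated with `W`, that is, `W = div Y`. -/
def HasFlux (Ω : Set (Rn n)) (p : ℝ) [Fact (1 < p)] (T : ℝ) (W : ℝ → V₀Dual Ω p)
    (Y : Rn n × ℝ → Rn n) : Prop :=
  ∀ᵐ t ∂timeMeasure T, ∀ v : V₀ Ω p, W t v + ∫ x in Ω, ⟪Y (x, t), v.1.2 x⟫ = 0

lemma HasFlux.mono (h : S ≤ T) {W : ℝ → V₀Dual Ω p} {Y : Rn n × ℝ → Rn n}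
    (hW : HasFlux Ω p T W Y) : HasFlux Ω p S W Y := ae_timeMeasure_mono h hW

lemma HasFlux.integral_add_eq_zero (hΩ : Bornology.IsBounded Ω) {W : ℝ → V₀Dual Ω p}
    {Y : Rn n × ℝ → Rn n} (hW : HasFlux Ω p T W Y)
    (hY : MemLp Y (conjExp p) (volume.restrict (spaceTime Ω T))) {w : ℝ → V₀ Ω p}
    {G : Rn n × ℝ → Rn n} (hG : IsSpaceTimeGradient Ω p T (fun t => (w t).1) G) :
    (∫ t in Ioo 0 T, W t (w t)) + ∫ z in spaceTime Ω T, ⟪Y z, G z⟫ = 0 := by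
  have := isFiniteMeasure_restrict_of_isBounded hΩ
  have hi : Integrable (fun z => ⟪Y z, G z⟫) ((volume.restrict Ω).prod (timeMeasure T)) := by
    rw [← restrict_spaceTime]
    exact integrable_inner_of_memLp hY hG.1
  rw [restrict_spaceTime, integral_prod_symm _ hi, ← eq_neg_iff_add_eq_zero, ← integral_neg]
  refine integral_congr_ae ?_
  filter_upwards [hW, hG.2] with t h1 h2
  rw [eq_neg_of_add_eq_zero_left (h1 (w t))]
  congr 1
  refine integral_congr_ae ?_
  filter_upwards [h2] with x hx
  rw [hx]

/-- The energy inequality for the difference of two functions with the same boundary and initial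
values. -/
lemma exists_sub_half_norm_sq_le (hS : 0 < S) {uStar u v : ℝ → V Ω p}
    (hu : MemAffine Ω p S uStar u) (hv : MemAffine Ω p S uStar v)
    (huL : MemLp u (ENNReal.ofReal p) (timeMeasure S))
    (hvL : MemLp v (ENNReal.ofReal p) (timeMeasure S)) {W W' : ℝ → V₀Dual Ω p}
    (hW : IsTimeDeriv Ω p S (fun t => (u t).1.1) W)
    (hW' : IsTimeDeriv Ω p S (fun t => (v t).1.1) W') {c d : ℝ → Lp ℝ 2 (volume.restrict Ω)}
    (hc : ContinuousOn c (Icc 0 S)) (hcu : ∀ᵐ t ∂timeMeasure S, c t = (u t).1.1 - (uStar t).1.1)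
    (hc0 : c 0 = 0) (hd : ContinuousOn d (Icc 0 S))
    (hdv : ∀ᵐ t ∂timeMeasure S, d t = (v t).1.1 - (uStar t).1.1) (hd0 : d 0 = 0) :
    ∃ w : ℝ → V₀ Ω p, MemX₀ Ω p S w ∧
      (∀ᵐ t ∂timeMeasure S, (w t : Pairs Ω p) = (u t : Pairs Ω p) - (v t : Pairs Ω p)) ∧
      1 / 2 * ‖c S - d S‖ ^ 2 ≤ (∫ t in Ioo 0 S, W t (w t)) - ∫ t in Ioo 0 S, W' t (w t) := by
  obtain ⟨w₁, hw₁, hu'⟩ := hu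
  obtain ⟨w₂, hw₂, hv'⟩ := hv
  have hwL : MemLp (fun t => w₁ t - w₂ t) (ENNReal.ofReal p) (timeMeasure S) := hw₁.1.sub hw₂.1
  have hdiff : ∀ᵐ t ∂timeMeasure S,
      ((w₁ t - w₂ t : V₀ Ω p) : Pairs Ω p) = (u t : Pairs Ω p) - (v t : Pairs Ω p) := by
    filter_upwards [hu', hv'] with t h1 h2
    rw [h1, h2, Submodule.coe_sub]
    abel
  have hder : IsTimeDeriv Ω p S (fun t => (w₁ t - w₂ t : V₀ Ω p).1.1) fun t => W t - W' t := by
    refine (hW.sub hW' (integrable_fst huL) (integrable_fst hvL)).congr ?_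
    filter_upwards [hdiff] with t ht
    rw [ht, Prod.fst_sub]
  refine ⟨fun t => w₁ t - w₂ t, ⟨hwL, _, hder⟩, hdiff, ?_⟩
  have := hder.half_norm_sq_le hS hwL (c := fun t => c t - d t) (hc.sub hd) (by
    filter_upwards [hdiff, hcu, hdv] with t h1 h2 h3
    rw [h1, h2, h3, Prod.fst_sub]
    abel) (by simp only [hc0, hd0, sub_zero])
  refine this.trans_eq ?_
  rw [← integral_sub (integrable_apply hW.1 hwL) (integrable_apply hW'.1 hwL)]
  rfl

/-! ### Restriction to smaller time intervals -/

lemma MemX₀.mono (h : S ≤ T) {u : ℝ → V₀ Ω p} (hu : MemX₀ Ω p T u) : MemX₀ Ω p S u :=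
  ⟨hu.1.mono_measure (timeMeasure_mono h), hu.2.imp fun _ => IsTimeDeriv.mono h⟩

lemma MemAffine.mono (h : S ≤ T) {uStar u : ℝ → V Ω p} (hu : MemAffine Ω p T uStar u) :
    MemAffine Ω p S uStar u :=
  hu.imp fun _ hw => ⟨hw.1.mono h, ae_timeMeasure_mono h hw.2⟩

end Parabolic

/-! ### Estimates for differences of solutions -/

section Comparison

variable {n : ℕ} {Ω : Set (Rn n)} {p : ℝ} [Fact (1 < p)] {S T C κ : ℝ}

lemma memLp_conjExp_of_growth {X : Type*} [MeasurableSpace X] {m : Measure X} [IsFiniteMeasure m]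
    {Y G : X → Rn n} (hG : MemLp G (ENNReal.ofReal p) m) (hY : AEStronglyMeasurable Y m)
    (h : ∀ᵐ z ∂m, ‖Y z‖ ≤ C * (1 + ‖G z‖) ^ (p - 1)) : MemLp Y (conjExp p) m := by
  have hp : 1 < p := Fact.out
  have h1 : MemLp (fun z => 1 + ‖G z‖) (ENNReal.ofReal p) m := (memLp_const (1 : ℝ)).add hG.norm
  have h2 := h1.norm_rpow_div (ENNReal.ofReal (p - 1))
  rw [← ENNReal.ofReal_div_of_pos (by linarith), ENNReal.toReal_ofReal (by linarith)] at h2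
  refine (h2.const_mul C).mono' hY ?_
  filter_upwards [h] with z hz
  rwa [Real.norm_of_nonneg (by positivity)]

lemma isFiniteMeasure_spaceTime (hΩ : Bornology.IsBounded Ω) :
    IsFiniteMeasure (volume.restrict (spaceTime Ω T) : Measure (Rn n × ℝ)) := by
  have := isFiniteMeasure_restrict_of_isBounded hΩ
  rw [restrict_spaceTime]
  infer_instance

/-- `u` solves `∂ₜu = div Y` with `Y ∈ ∂F(∇u)` in `Ω_S`, with boundary and initial values given by
`uStar`; `W` is the time derivative of `u`, `G` the spatial gradient, and `c` the continuous
representative of `u - uStar`. -/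
structure IsFluxSolution (Ω : Set (Rn n)) (p : ℝ) [Fact (1 < p)] (S : ℝ) (F : Rn n → ℝ)
    (uStar u : ℝ → V Ω p) (c : ℝ → Lp ℝ 2 (volume.restrict Ω)) (W : ℝ → V₀Dual Ω p)
    (G Y : Rn n × ℝ → Rn n) : Prop where
  affine : MemAffine Ω p S uStar u
  memLp : MemLp u (ENNReal.ofReal p) (timeMeasure S)
  deriv : IsTimeDeriv Ω p S (fun t => (u t).1.1) W
  gradient : IsSpaceTimeGradient Ω p S (fun t => (u t).1) G
  continuousOn : ContinuousOn c (Icc 0 S)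
  ae_eq : ∀ᵐ t ∂timeMeasure S, c t = (u t).1.1 - (uStar t).1.1
  initial : c 0 = 0
  flux_memLp : MemLp Y (conjExp p) (volume.restrict (spaceTime Ω S))
  flux_mem : ∀ᵐ z ∂volume.restrict (spaceTime Ω S), Y z ∈ subdifferential F (G z)
  weak : ∀ (φ : ℝ → V₀ Ω p) (Gφ : Rn n × ℝ → Rn n), MemX₀ Ω p S φ →
    IsSpaceTimeGradient Ω p S (fun t => (φ t).1) Gφ →
    (∫ t in Ioo 0 S, W t (φ t)) + ∫ z in spaceTime Ω S, ⟪Y z, Gφ z⟫ = 0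

variable {F H : Rn n → ℝ} {uStar u v : ℝ → V Ω p} {c d : ℝ → Lp ℝ 2 (volume.restrict Ω)}
  {W W' : ℝ → V₀Dual Ω p} {G G' Y Y' : Rn n × ℝ → Rn n}

/-- Both equations are tested with `u - v`, which belongs to `X₀^p` because the two solutions share
their boundary values. -/
lemma IsFluxSolution.energy_sub_le (hS : 0 < S)
    (hu : IsFluxSolution Ω p S F uStar u c W G Y) (hv : IsFluxSolution Ω p S H uStar v d W' G' Y') :
    1 / 2 * ‖c S - d S‖ ^ 2 + ∫ z in spaceTime Ω S, ⟪Y z - Y' z, G z - G' z⟫ ≤ 0 := by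
  obtain ⟨w, hwX, hw, h⟩ := exists_sub_half_norm_sq_le hS hu.affine hv.affine hu.memLp hv.memLp
    hu.deriv hv.deriv hu.continuousOn hu.ae_eq hu.initial hv.continuousOn hv.ae_eq hv.initial
  have hG := hu.gradient.sub hv.gradient hw
  have h1 := hu.weak w _ hwX hG
  have h2 := hv.weak w _ hwX hG
  have h3 : ∫ z in spaceTime Ω S, ⟪Y z - Y' z, G z - G' z⟫
      = (∫ z in spaceTime Ω S, ⟪Y z, (G - G') z⟫) - ∫ z in spaceTime Ω S, ⟪Y' z, (G - G') z⟫ := by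
    rw [← integral_sub (integrable_inner_of_memLp hu.flux_memLp hG.1)
      (integrable_inner_of_memLp hv.flux_memLp hG.1)]
    simp only [inner_sub_left, Pi.sub_apply]
  rw [h3]
  linarith

/-- The quantitative comparison of two solutions with nearby densities. -/
lemma IsFluxSolution.norm_sub_sq_add_integral_le (hΩ : Bornology.IsBounded Ω) (hS : 0 < S)
    (hu : IsFluxSolution Ω p S F uStar u c W G Y) (hv : IsFluxSolution Ω p S H uStar v d W' G' Y')
    (hF : IsGrowthConvex p C κ F) (hH : IsGrowthConvex p C κ H) {δ : ℝ}
    (hFH : ∀ z, |F z - H z| ≤ δ * (1 + ‖z‖) ^ (p - 1)) :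
    1 / 2 * ‖c S - d S‖ ^ 2 + 4 * κ * ∫ z in spaceTime Ω S,
        (1 + ‖G z‖ + ‖G' z‖) ^ (p - 2) * ‖G z - G' z‖ ^ 2
      ≤ 2 * δ * ∫ z in spaceTime Ω S, (1 + ‖G z‖ + ‖G' z‖) ^ (p - 1) := by
  have hp : 1 < p := Fact.out
  have := isFiniteMeasure_spaceTime (T := S) hΩ
  have h := hu.energy_sub_le hS hv
  have i1 := (integrable_rpow_mul_sq hp hu.gradient.1 hv.gradient.1).const_mul (4 * κ)
  have i2 := (integrable_rpow_sub_one hp hu.gradient.1 hv.gradient.1).const_mul (2 * δ)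
  have i3 : Integrable (fun z => ⟪Y z - Y' z, G z - G' z⟫) (volume.restrict (spaceTime Ω S)) :=
    integrable_inner_of_memLp (hu.flux_memLp.sub hv.flux_memLp)
      (hu.gradient.1.sub hv.gradient.1)
  have h2 : (∫ z in spaceTime Ω S, 4 * κ * ((1 + ‖G z‖ + ‖G' z‖) ^ (p - 2) * ‖G z - G' z‖ ^ 2))
      - (∫ z in spaceTime Ω S, 2 * δ * (1 + ‖G z‖ + ‖G' z‖) ^ (p - 1))
      ≤ ∫ z in spaceTime Ω S, ⟪Y z - Y' z, G z - G' z⟫ := by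
    rw [← integral_sub i1 i2]
    refine integral_mono_ae (i1.sub i2) i3 ?_
    filter_upwards [hu.flux_mem, hv.flux_mem] with z hz hz'
    exact hF.inner_sub_ge hp hH hFH hz hz'
  rw [integral_const_mul, integral_const_mul] at h2
  linarith

/-- Two solutions for the same density coincide. -/
lemma IsFluxSolution.ae_eq_of_same_density (hn : 3 ≤ n) (hp2 : p ≤ 2) (hΩ : Bornology.IsBounded Ω)
    (hS : 0 < S) (hκ : 0 < κ) (hF : IsGrowthConvex p C κ F)
    (hu : IsFluxSolution Ω p S F uStar u c W G Y) (hv : IsFluxSolution Ω p S F uStar v d W' G' Y') :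
    ∀ᵐ t ∂timeMeasure S, u t = v t := by
  have hp : 1 < p := Fact.out
  have hfin := isFiniteMeasure_spaceTime (T := S) hΩ
  have hfin' := isFiniteMeasure_restrict_of_isBounded hΩ
  -- With equal densities the error term disappears, and positivity of the weight forces the
  -- gradients to coincide.
  have h := hu.norm_sub_sq_add_integral_le hΩ hS hv hF hF (δ := 0) (by simp)
  have i1 := integrable_rpow_mul_sq hp hu.gradient.1 hv.gradient.1
  have h0 : ∀ z, 0 ≤ (1 + ‖G z‖ + ‖G' z‖) ^ (p - 2) * ‖G z - G' z‖ ^ 2 := fun z => by positivity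
  have h1 : ∫ z in spaceTime Ω S, (1 + ‖G z‖ + ‖G' z‖) ^ (p - 2) * ‖G z - G' z‖ ^ 2 = 0 := by
    refine le_antisymm ?_ (integral_nonneg h0)
    have : 0 ≤ ‖c S - d S‖ ^ 2 := by positivity
    by_contra! hlt
    have := mul_pos hκ hlt
    linarith
  have h2 : ∀ᵐ z ∂volume.restrict (spaceTime Ω S), G z - G' z = 0 := by
    filter_upwards [(integral_eq_zero_iff_of_nonneg h0 i1).1 h1] with z hz
    have : (1 + ‖G z‖ + ‖G' z‖) ^ (p - 2) ≠ 0 := by positivity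
    simpa [this] using hz
  rw [restrict_spaceTime] at h2
  obtain ⟨w₁, -, hw₁⟩ := hu.affine
  obtain ⟨w₂, -, hw₂⟩ := hv.affine
  filter_upwards [ae_ae_swap_of_ae_prod h2, hw₁, hw₂, hu.gradient.2, hv.gradient.2]
    with t h3 h4 h5 h6 h7
  -- The difference lies in `V₀` and has zero gradient, so Poincaré's inequality applies at almost
  -- every time.
  have h8 : w₁ t - w₂ t = 0 := by
    refine Subtype.ext (eq_zero_of_gradient_eq_zero hn hΩ hp2 (w₁ t - w₂ t).2 ?_)
    have e : ((w₁ t - w₂ t : V₀ Ω p) : Pairs Ω p) = (u t : Pairs Ω p) - (v t : Pairs Ω p) := by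
      rw [h4, h5, Submodule.coe_sub]
      abel
    rw [e, Prod.snd_sub]
    refine Lp.ext ?_
    filter_upwards [Lp.coeFn_sub (u t).1.2 (v t).1.2, Lp.coeFn_zero (Rn n) (ENNReal.ofReal p)
      (volume.restrict Ω), h3, h6, h7] with x e1 e2 e3 e4 e5
    rw [e1, e2, Pi.sub_apply, ← e4, ← e5, e3, Pi.zero_apply]
  refine Subtype.ext ?_
  rw [h4, h5, sub_eq_zero.1 h8]

lemma HasFlux.weak (hΩ : Bornology.IsBounded Ω) (hW : HasFlux Ω p S W Y)
    (hY : MemLp Y (conjExp p) (volume.restrict (spaceTime Ω S))) (φ : ℝ → V₀ Ω p)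
    (Gφ : Rn n × ℝ → Rn n) (_ : MemX₀ Ω p S φ)
    (hG : IsSpaceTimeGradient Ω p S (fun t => (φ t).1) Gφ) :
    (∫ t in Ioo 0 S, W t (φ t)) + ∫ z in spaceTime Ω S, ⟪Y z, Gφ z⟫ = 0 :=
  hW.integral_add_eq_zero hΩ hY hG

/-- A test function on the shorter interval need not extend to an admissible one on the longer. The
weak form is therefore rederived from the equation at almost every time. -/
lemma IsFluxSolution.mono (hΩ : Bornology.IsBounded Ω) (h : S ≤ T)
    (hu : IsFluxSolution Ω p T F uStar u c W G Y) (hW : HasFlux Ω p T W Y) :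
    IsFluxSolution Ω p S F uStar u c W G Y := by
  have hle : (volume.restrict (spaceTime Ω S) : Measure (Rn n × ℝ))
      ≤ volume.restrict (spaceTime Ω T) := Measure.restrict_mono (spaceTime_mono h) le_rfl
  have hY := hu.flux_memLp.mono_measure hle
  exact ⟨hu.affine.mono h, hu.memLp.mono_measure (timeMeasure_mono h), hu.deriv.mono h,
    hu.gradient.mono h, hu.continuousOn.mono (Icc_subset_Icc_right h),
    ae_timeMeasure_mono h hu.ae_eq, hu.initial, hY,
    (Measure.absolutelyContinuous_of_le hle).ae_le hu.flux_mem, (hW.mono h).weak hΩ hY⟩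

/-- Solutions of the Dirichlet problem for a smooth density. -/
lemma IsSmoothDirichletSolution.exists_isFluxSolution (hΩ : Bornology.IsBounded Ω)
    (hF : IsGrowthConvex p C κ F) (hFs : ContDiff ℝ 1 F)
    (hu : IsSmoothDirichletSolution Ω p T F uStar u) :
    ∃ c W G, IsFluxSolution Ω p T F uStar u c W G (fun z => ∇ F (G z)) ∧
      HasFlux Ω p T W fun z => ∇ F (G z) := by
  have hp : 1 < p := Fact.out
  have := isFiniteMeasure_spaceTime (T := T) hΩ
  obtain ⟨h1, ⟨c, hc, hcu, hc0⟩, h2, W, hW, hWF⟩ := hu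
  obtain ⟨G, hG⟩ := exists_isSpaceTimeGradient hΩ ((V Ω p).subtypeL.comp_memLp' h2)
  have hmem : ∀ z, ∇ F (G z) ∈ subdifferential F (G z) := fun z =>
    gradient_mem_subdifferential hF.convex (hFs.differentiable (by simp) _)
  have hY : MemLp (fun z => ∇ F (G z)) (conjExp p) (volume.restrict (spaceTime Ω T)) :=
    memLp_conjExp_of_growth hG.1
      ((continuous_gradient hFs).comp_aestronglyMeasurable hG.1.aestronglyMeasurable)
      (ae_of_all _ fun z => hF.norm_le_of_mem_subdifferential hp (hmem z))
  have hflux : HasFlux Ω p T W fun z => ∇ F (G z) := by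
    filter_upwards [hWF, hG.2] with t h3 h4 v
    rw [← h3 v]
    congr 1
    refine integral_congr_ae ?_
    filter_upwards [h4] with x hx
    rw [hx]
    rfl
  exact ⟨c, W, G, ⟨h1, h2, hW, hG, hc, hcu, hc0, hY, ae_of_all _ hmem, hflux.weak hΩ hY⟩, hflux⟩

end Comparison

/-! ### The limit of the approximations -/

section Limit

variable {n : ℕ} {Ω : Set (Rn n)} {p : ℝ} [Fact (1 < p)] {T C κ K : ℝ}
  {F : ℝ → Rn n → ℝ} {uStar : ℝ → V Ω p} {u : ℝ → ℝ → V Ω p}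
  {c : ℝ → ℝ → Lp ℝ 2 (volume.restrict Ω)} {W : ℝ → ℝ → V₀Dual Ω p} {G Y : ℝ → Rn n × ℝ → Rn n}

/-- The comparison on all of `(0, T)` controls the gradients. The `L²` bound at time `S` needs the
comparison on `(0, S)`, hence the hypothesis for every `S`. The constant `K / (2κ)` is the quotient
of the coefficients `2K` and `4κ`. -/
lemma exists_energy_bound (hΩ : Bornology.IsBounded Ω) (hp2 : p ≤ 2) (hT : 0 < T) (hκ : 0 < κ)
    (hK : 0 ≤ K) (hF : ∀ ε ∈ Ioo (0 : ℝ) 1, IsGrowthConvex p C κ (F ε))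
    (hFF : ∀ ε ∈ Ioo (0 : ℝ) 1, ∀ δ ∈ Ioo (0 : ℝ) 1, ∀ z,
      |F ε z - F δ z| ≤ K * (ε + δ) * (1 + ‖z‖) ^ (p - 1))
    (hu : ∀ ε ∈ Ioo (0 : ℝ) 1, ∀ S ∈ Ioc 0 T,
      IsFluxSolution Ω p S (F ε) uStar (u ε) (c ε) (W ε) (G ε) (Y ε)) :
    ∃ M, 0 ≤ M ∧ ∀ ε ∈ Ioo (0 : ℝ) 1, ∀ δ ∈ Ioo (0 : ℝ) 1,
      ∫ z in spaceTime Ω T, ‖G ε z - G δ z‖ ^ p ≤ M * (ε + δ) ^ (p / 2) ∧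
      ∀ S ∈ Icc 0 T, ‖c ε S - c δ S‖ ^ 2 ≤ M * (ε + δ) := by
  have hp : 1 < p := Fact.out
  have hfin := isFiniteMeasure_spaceTime (T := T) hΩ
  have hTT : T ∈ Ioc 0 T := right_mem_Ioc.2 hT
  obtain ⟨M, hM0, hM⟩ := exists_bound_of_monotone (m := volume.restrict (spaceTime Ω T)) hp hp2
    (K := K / (2 * κ)) (by positivity) (a := G) (fun ε hε => (hu ε hε T hTT).gradient.1)
    fun ε hε δ hδ => by
      have h := (hu ε hε T hTT).norm_sub_sq_add_integral_le hΩ hT (hu δ hδ T hTT) (hF ε hε)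
        (hF δ hδ) (hFF ε hε δ hδ)
      have h0 : 0 ≤ ‖c ε T - c δ T‖ ^ 2 := by positivity
      rw [div_mul_eq_mul_div, div_mul_eq_mul_div, le_div_iff₀ (by positivity)]
      linarith
  refine ⟨M + 4 * K * M, by positivity, fun ε hε δ hδ => ⟨?_, fun S hS => ?_⟩⟩
  · refine (hM ε hε δ hδ).2.trans ?_
    have := add_pos hε.1 hδ.1
    gcongr
    exact le_add_of_nonneg_right (by positivity)
  · have hεδ := add_pos hε.1 hδ.1
    rcases hS.1.eq_or_lt with rfl | hS0
    · rw [(hu ε hε T hTT).initial, (hu δ hδ T hTT).initial]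
      rw [sub_self, norm_zero, zero_pow two_ne_zero]
      positivity
    · have hSS : S ∈ Ioc 0 T := ⟨hS0, hS.2⟩
      have h := (hu ε hε S hSS).norm_sub_sq_add_integral_le hΩ hS0 (hu δ hδ S hSS) (hF ε hε)
        (hF δ hδ) (hFF ε hε δ hδ)
      have h0 : 0 ≤ ∫ z in spaceTime Ω S, (1 + ‖G ε z‖ + ‖G δ z‖) ^ (p - 2) * ‖G ε z - G δ z‖ ^ 2 :=
        integral_nonneg fun z => by positivity
      have h1 : ∫ z in spaceTime Ω S, (1 + ‖G ε z‖ + ‖G δ z‖) ^ (p - 1) ≤ M :=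
        (setIntegral_mono_set (integrable_rpow_sub_one hp (hu ε hε T hTT).gradient.1
          (hu δ hδ T hTT).gradient.1) (ae_of_all _ fun z => by positivity)
          (LE.le.eventuallyLE (spaceTime_mono hS.2))).trans (hM ε hε δ hδ).1
      have h2 : K * (ε + δ) * ∫ z in spaceTime Ω S, (1 + ‖G ε z‖ + ‖G δ z‖) ^ (p - 1)
          ≤ K * (ε + δ) * M := by gcongr
      have h3 : 0 ≤ κ * ∫ z in spaceTime Ω S,
          (1 + ‖G ε z‖ + ‖G δ z‖) ^ (p - 2) * ‖G ε z - G δ z‖ ^ 2 := by positivity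
      have h4 : 0 ≤ M * (ε + δ) := by positivity
      linarith

lemma exists_tendsto_of_cauchy {X E : Type*} [MeasurableSpace X] {μ : Measure X}
    [NormedAddCommGroup E] [CompleteSpace E] {q : ℝ≥0∞} [Fact (1 ≤ q)] {f : ℕ → X → E}
    (hf : ∀ k, MemLp (f k) q μ)
    (h : Tendsto (fun i : ℕ × ℕ => eLpNorm (fun x => f i.1 x - f i.2 x) q μ) atTop (𝓝 0)) :
    ∃ g, MemLp g q μ ∧ Tendsto (fun k => eLpNorm (fun x => f k x - g x) q μ) atTop (𝓝 0) := by
  have hc : CauchySeq fun k => (hf k).toLp (f k) := by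
    rw [Lp.cauchySeq_Lp_iff_cauchySeq_eLpNorm]
    refine h.congr fun i => eLpNorm_congr_ae ?_
    filter_upwards [(hf i.1).coeFn_toLp, (hf i.2).coeFn_toLp] with x h1 h2
    rw [Pi.sub_apply, h1, h2]
  obtain ⟨g, hg⟩ := cauchySeq_tendsto_of_complete hc
  refine ⟨g, Lp.memLp g, ?_⟩
  refine ((Lp.tendsto_Lp_iff_tendsto_eLpNorm' _ _).1 hg).congr fun k => eLpNorm_congr_ae ?_
  filter_upwards [(hf k).coeFn_toLp] with x h1
  rw [Pi.sub_apply, h1]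

/-- A modulus controlling the norm of `L^p(0,T;V₀)`. -/
def energyModulus (p T M s : ℝ) : ℝ≥0∞ :=
  timeMeasure T univ ^ (ENNReal.ofReal p).toReal⁻¹ * ENNReal.ofReal (√(M * s))
    + ENNReal.ofReal ((M * s ^ (p / 2)) ^ p⁻¹)

lemma tendsto_energyModulus (p T M : ℝ) [Fact (1 < p)] :
    Tendsto (energyModulus p T M) (𝓝 0) (𝓝 0) := by
  have hp : 1 < p := Fact.out
  have h1 : Tendsto (fun s => √(M * s)) (𝓝 0) (𝓝 0) := by
    have : Continuous fun s : ℝ => √(M * s) := by fun_prop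
    simpa using this.tendsto 0
  have h2 : Tendsto (fun s : ℝ => (M * s ^ (p / 2)) ^ p⁻¹) (𝓝 0) (𝓝 0) := by
    have : Continuous fun s : ℝ => (M * s ^ (p / 2)) ^ p⁻¹ :=
      (continuous_const.mul (continuous_id.rpow_const fun s => Or.inr (by positivity))).rpow_const
        fun s => Or.inr (by positivity)
    have h0 := this.tendsto 0
    rwa [Real.zero_rpow (by positivity), mul_zero, Real.zero_rpow (by positivity)] at h0
  have h3 : timeMeasure T univ ^ (ENNReal.ofReal p).toReal⁻¹ ≠ ⊤ :=
    ENNReal.rpow_ne_top_of_nonneg (by positivity) (measure_ne_top _ _)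
  have h4 := (ENNReal.Tendsto.const_mul (ENNReal.tendsto_ofReal h1) (Or.inr h3)).add
    (ENNReal.tendsto_ofReal h2)
  simp only [mul_zero, ENNReal.ofReal_zero, add_zero] at h4
  exact h4

/-- The norm of `V₀` is at most the sum of its two components: the first is bounded uniformly in
time, the second is a space-time norm of the gradient. -/
lemma eLpNorm_le_energyModulus (hΩ : Bornology.IsBounded Ω) {M s : ℝ} {w : ℝ → V₀ Ω p}
    {H : Rn n × ℝ → Rn n} (hw : MemLp w (ENNReal.ofReal p) (timeMeasure T))
    (hH : IsSpaceTimeGradient Ω p T (fun t => (w t).1) H)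
    (h1 : ∀ᵐ t ∂timeMeasure T, ‖(w t).1.1‖ ^ 2 ≤ M * s)
    (h2 : ∫ z in spaceTime Ω T, ‖H z‖ ^ p ≤ M * s ^ (p / 2)) :
    eLpNorm w (ENNReal.ofReal p) (timeMeasure T) ≤ energyModulus p T M s := by
  have hp : 1 < p := Fact.out
  have e1 : eLpNorm w (ENNReal.ofReal p) (timeMeasure T)
      ≤ eLpNorm (fun t => ‖(w t).1.1‖ + ‖(w t).1.2‖) (ENNReal.ofReal p) (timeMeasure T) := by
    refine eLpNorm_mono_real fun t => ?_
    exact (max_le_add_of_nonneg (norm_nonneg _) (norm_nonneg _))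
  have e2 : AEStronglyMeasurable (fun t => (w t).1.1) (timeMeasure T) := (memLp_fst hw).1
  have e3 : AEStronglyMeasurable (fun t => (w t).1.2) (timeMeasure T) :=
    ((sndL Ω p).comp_memLp' (memLp_coe hw)).1
  refine e1.trans ((eLpNorm_add_le e2.norm e3.norm (factOneLe p).out).trans ?_)
  refine add_le_add ?_ ?_
  · rw [eLpNorm_norm]
    refine eLpNorm_le_of_ae_bound ?_
    filter_upwards [h1] with t ht
    exact Real.le_sqrt_of_sq_le ht
  · rw [eLpNorm_norm, ← hH.eLpNorm_eq hΩ,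
      hH.1.eLpNorm_eq_integral_rpow_norm (by simpa using by linarith) ENNReal.ofReal_ne_top,
      ENNReal.toReal_ofReal (by linarith)]
    refine ENNReal.ofReal_le_ofReal (Real.rpow_le_rpow (integral_nonneg fun z => by positivity) h2
      (by positivity))

lemma V₀_le_V : V₀ Ω p ≤ V Ω p := fun _ h => h.1

lemma exists_uniform_limit {H : Type*} [NormedAddCommGroup H] [CompleteSpace H] {s : Set ℝ}
    {f : ℕ → ℝ → H} (hf : ∀ k, ContinuousOn (f k) s) {b : ℕ × ℕ → ℝ} (hb : Tendsto b atTop (𝓝 0))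
    (h : ∀ i, ∀ t ∈ s, ‖f i.1 t - f i.2 t‖ ^ 2 ≤ b i) :
    ∃ g, ContinuousOn g s ∧ ∀ t ∈ s, Tendsto (fun k => f k t) atTop (𝓝 (g t)) := by
  have hu : UniformCauchySeqOn f atTop s := by
    rw [Metric.uniformCauchySeqOn_iff]
    intro ε hε
    have h1 : ∀ᶠ i in atTop, b i < ε ^ 2 := hb.eventually_lt_const (by positivity)
    obtain ⟨N, hN⟩ := eventually_atTop.1 h1
    refine ⟨max N.1 N.2, fun i hi j hj t ht => ?_⟩
    rw [dist_eq_norm]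
    refine lt_of_pow_lt_pow_left₀ 2 hε.le ((h (i, j) t ht).trans_lt (hN (i, j) ?_))
    exact ⟨(le_max_left _ _).trans hi, (le_max_right _ _).trans hj⟩
  have hl : ∀ t, ∃ l, t ∈ s → Tendsto (fun k => f k t) atTop (𝓝 l) := fun t => by
    by_cases ht : t ∈ s
    · obtain ⟨l, hl⟩ := cauchySeq_tendsto_of_complete (hu.cauchySeq ht)
      exact ⟨l, fun _ => hl⟩
    · exact ⟨0, fun h => absurd h ht⟩
  choose g hg using hl
  exact ⟨g, (hu.tendstoUniformlyOn_of_tendsto hg).continuousOn (Frequently.of_forall hf), hg⟩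

lemma exists_seq_tendsto_ae {X E : Type*} [MeasurableSpace X] {μ : Measure X}
    [NormedAddCommGroup E] {q : ℝ≥0∞} (hq : q ≠ 0) {f : ℕ → X → E} {g : X → E}
    (hf : ∀ k, AEStronglyMeasurable (f k) μ) (hg : AEStronglyMeasurable g μ)
    (h : Tendsto (fun k => eLpNorm (fun x => f k x - g x) q μ) atTop (𝓝 0)) :
    ∃ ns : ℕ → ℕ, StrictMono ns ∧ ∀ᵐ x ∂μ, Tendsto (fun i => f (ns i) x) atTop (𝓝 (g x)) :=
  (tendstoInMeasure_of_tendsto_eLpNorm hq hf hg h).exists_seq_tendsto_ae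

lemma memLp_add_inclusion {X E : Type*} [MeasurableSpace X] {μ : Measure X} [NormedAddCommGroup E]
    [NormedSpace ℝ E] {q : ℝ≥0∞} {K L : Submodule ℝ E} (h : K ≤ L) {v : X → L} {w : X → K}
    (hv : MemLp v q μ) (hw : MemLp w q μ) :
    MemLp (fun t => v t + Submodule.inclusion h (w t)) q μ :=
  hv.add (hw.of_le_mul (c := 1) ((Isometry.of_dist_eq fun _ _ => rfl : Isometry
    (Submodule.inclusion h)).continuous.comp_aestronglyMeasurable hw.1)
    (ae_of_all _ fun _ => (one_mul _).ge))

set_option maxHeartbeats 1000000 in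
/-- Passage to the limit `ε → 0` in the approximations. -/
lemma exists_limit (hΩ : Bornology.IsBounded Ω) (hp2 : p ≤ 2) (hT : 0 < T) {M : ℝ}
    (huStar : MemLp uStar (ENNReal.ofReal p) (timeMeasure T))
    (hu : ∀ ε ∈ Ioo (0 : ℝ) 1, IsFluxSolution Ω p T (F ε) uStar (u ε) (c ε) (W ε) (G ε) (Y ε))
    (hM : ∀ ε ∈ Ioo (0 : ℝ) 1, ∀ δ ∈ Ioo (0 : ℝ) 1,
      ∫ z in spaceTime Ω T, ‖G ε z - G δ z‖ ^ p ≤ M * (ε + δ) ^ (p / 2) ∧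
      ∀ S ∈ Icc 0 T, ‖c ε S - c δ S‖ ^ 2 ≤ M * (ε + δ)) {e : ℕ → ℝ}
    (heI : ∀ k, e k ∈ Ioo (0 : ℝ) 1) (he0 : Tendsto e atTop (𝓝 0)) :
    ∃ (w₀ : ℝ → V₀ Ω p) (u₀ : ℝ → V Ω p) (G₀ : Rn n × ℝ → Rn n)
      (c₀ : ℝ → Lp ℝ 2 (volume.restrict Ω)),
      MemLp w₀ (ENNReal.ofReal p) (timeMeasure T) ∧
      MemLp u₀ (ENNReal.ofReal p) (timeMeasure T) ∧
      (∀ t, (u₀ t : Pairs Ω p) = (uStar t : Pairs Ω p) + (w₀ t : Pairs Ω p)) ∧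
      ContinuousOn c₀ (Icc 0 T) ∧ c₀ 0 = 0 ∧ (∀ᵐ t ∂timeMeasure T, c₀ t = (w₀ t).1.1) ∧
      IsSpaceTimeGradient Ω p T (fun t => (u₀ t).1) G₀ ∧
      Tendsto (fun k => eLpNorm (fun t => (u (e k) t).1.1 - (u₀ t).1.1) (ENNReal.ofReal p)
        (timeMeasure T)) atTop (𝓝 0) ∧
      Tendsto (fun k => eLpNorm (fun z => G (e k) z - G₀ z) (ENNReal.ofReal p)
        (volume.restrict (spaceTime Ω T))) atTop (𝓝 0) := by
  have hp : 1 < p := Fact.out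
  have hcomplete := completeSpace_V₀ (p := p) hΩ hp2
  have he2 : Tendsto (fun i : ℕ × ℕ => e i.1 + e i.2) atTop (𝓝 0) := by
    rw [← prod_atTop_atTop_eq]
    simpa using (he0.comp tendsto_fst).add (he0.comp tendsto_snd)
  have haff : ∀ k, ∃ w : ℝ → V₀ Ω p, MemLp w (ENNReal.ofReal p) (timeMeasure T) ∧
      ∀ᵐ t ∂timeMeasure T, (u (e k) t : Pairs Ω p) = (uStar t : Pairs Ω p) + (w t : Pairs Ω p) :=
    fun k => by
      obtain ⟨w, h1, h2⟩ := (hu _ (heI k)).affine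
      exact ⟨w, h1.1, h2⟩
  choose w hw huw using haff
  have hcw : ∀ k, ∀ᵐ t ∂timeMeasure T, c (e k) t = (w k t).1.1 := fun k => by
    filter_upwards [(hu _ (heI k)).ae_eq, huw k] with t h1 h2
    rw [h1, h2, Prod.fst_add, add_sub_cancel_left]
  have hdiff : ∀ i j, ∀ᵐ t ∂timeMeasure T, ((w i t - w j t : V₀ Ω p) : Pairs Ω p)
      = (u (e i) t : Pairs Ω p) - (u (e j) t : Pairs Ω p) := fun i j => by
    filter_upwards [huw i, huw j] with t h1 h2
    rw [h1, h2, Submodule.coe_sub]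
    abel
  -- Convergence is sought for `u - uStar` with values in `V₀`: as `V₀` is closed, the lateral
  -- boundary values survive in the limit.
  have hcauchy : Tendsto (fun i : ℕ × ℕ => eLpNorm (fun t => w i.1 t - w i.2 t)
      (ENNReal.ofReal p) (timeMeasure T)) atTop (𝓝 0) := by
    refine tendsto_of_tendsto_of_tendsto_of_le_of_le tendsto_const_nhds
      ((tendsto_energyModulus p T M).comp he2) (fun _ => zero_le) fun i => ?_
    refine eLpNorm_le_energyModulus hΩ ((hw i.1).sub (hw i.2))
      ((hu _ (heI i.1)).gradient.sub (hu _ (heI i.2)).gradient (hdiff i.1 i.2)) ?_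
      (hM _ (heI i.1) _ (heI i.2)).1
    filter_upwards [hcw i.1, hcw i.2, ae_restrict_mem measurableSet_Ioo] with t h1 h2 h3
    rw [Submodule.coe_sub, Prod.fst_sub, ← h1, ← h2]
    exact (hM _ (heI i.1) _ (heI i.2)).2 t (Ioo_subset_Icc_self h3)
  obtain ⟨w₀, hw₀, hlim⟩ := exists_tendsto_of_cauchy hw hcauchy
  obtain ⟨u₀, hu₀w, hu₀L⟩ : ∃ u₀ : ℝ → V Ω p,
      (∀ t, (u₀ t : Pairs Ω p) = (uStar t : Pairs Ω p) + (w₀ t : Pairs Ω p)) ∧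
      MemLp u₀ (ENNReal.ofReal p) (timeMeasure T) :=
    ⟨_, fun _ => rfl, memLp_add_inclusion V₀_le_V huStar hw₀⟩
  obtain ⟨G₀, hG₀⟩ := exists_isSpaceTimeGradient hΩ ((V Ω p).subtypeL.comp_memLp' hu₀L)
  have hdiff0 : ∀ k, ∀ᵐ t ∂timeMeasure T, ((w k t - w₀ t : V₀ Ω p) : Pairs Ω p)
      = (u (e k) t : Pairs Ω p) - (u₀ t : Pairs Ω p) := fun k => by
    filter_upwards [huw k] with t h1
    rw [h1, hu₀w, Submodule.coe_sub]
    abel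
  obtain ⟨c₀, hc₀, hc₀lim⟩ := exists_uniform_limit (f := fun k => c (e k)) (s := Icc 0 T)
    (b := fun i => M * (e i.1 + e i.2)) (fun k => (hu _ (heI k)).continuousOn)
    (by simpa using he2.const_mul M) fun i t ht => (hM _ (heI i.1) _ (heI i.2)).2 t ht
  refine ⟨w₀, u₀, G₀, c₀, hw₀, hu₀L, hu₀w, hc₀, ?_, ?_, hG₀, ?_, ?_⟩
  · refine tendsto_nhds_unique (hc₀lim 0 (left_mem_Icc.2 hT.le)) ?_
    simp only [(hu _ (heI _)).initial, tendsto_const_nhds]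
  -- The limit uniform in time and the limit in `L^p(0,T;V₀)` are identified along a subsequence
  -- converging at almost every time.
  · obtain ⟨ns, hns, hae⟩ := exists_seq_tendsto_ae (by simpa using by linarith)
      (fun k => (hw k).1) hw₀.1 hlim
    filter_upwards [hae, ae_all_iff.2 hcw, ae_restrict_mem measurableSet_Ioo] with t h1 h2 h3
    refine tendsto_nhds_unique
      ((hc₀lim t (Ioo_subset_Icc_self h3)).comp hns.tendsto_atTop) ?_
    have h4 := (((fstL Ω p).comp (V₀ Ω p).subtypeL).continuous.tendsto (w₀ t)).comp h1
    refine h4.congr fun k => ?_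
    exact (h2 _).symm
  · refine tendsto_of_tendsto_of_tendsto_of_le_of_le tendsto_const_nhds hlim (fun _ => zero_le)
      fun k => eLpNorm_mono_ae ?_
    filter_upwards [hdiff0 k] with t h1
    rw [← Prod.fst_sub, ← h1]
    exact norm_fst_le _
  · refine tendsto_of_tendsto_of_tendsto_of_le_of_le tendsto_const_nhds hlim (fun _ => zero_le)
      fun k => ?_
    have h1 := ((hu _ (heI k)).gradient.sub hG₀ (hdiff0 k)).eLpNorm_eq hΩ
    refine h1.le.trans (eLpNorm_mono fun t => ?_)
    exact norm_snd_le _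

end Limit

/-! ### Weak limits of fluxes -/

section WeakLimit

variable {n : ℕ} {p : ℝ} [Fact (1 < p)] {X : Type*} [MeasurableSpace X] {m : Measure X}

/-- Banach–Alaoglu along an ultrafilter, which needs no separability of `E`. -/
lemma exists_weakStar_limit {E : Type*} [NormedAddCommGroup E] [NormedSpace ℝ E]
    {Φ : ℕ → StrongDual ℝ E} {B : ℝ} (h : ∀ᶠ k in atTop, ‖Φ k‖ ≤ B) :
    ∃ U : Ultrafilter ℕ, (U : Filter ℕ) ≤ atTop ∧ ∃ Φ₀ : StrongDual ℝ E,
      ∀ H, Tendsto (fun k => Φ k H) U (𝓝 (Φ₀ H)) := by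
  set U : Ultrafilter ℕ := Ultrafilter.of atTop with hU
  have hle : (U : Filter ℕ) ≤ atTop := Ultrafilter.of_le _
  obtain ⟨Φ₀, -, hΦ₀⟩ := (WeakDual.isCompact_closedBall (𝕜 := ℝ) (0 : StrongDual ℝ E)
    B).ultrafilter_le_nhds' (U.map fun k => StrongDual.toWeakDual (Φ k)) (by
      refine hle ?_
      filter_upwards [h] with k hk
      simpa using hk)
  refine ⟨U, hle, WeakDual.toStrongDual Φ₀, fun H => ?_⟩
  have h1 : Tendsto (fun k => StrongDual.toWeakDual (Φ k)) U (𝓝 Φ₀) := hΦ₀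
  exact ((WeakDual.eval_continuous H).tendsto Φ₀).comp h1

/-- Since `L²` embeds in `L^p`, the functional restricts to a Hilbert space and Riesz represents it
there. Only `Y ∈ L²` results; integrability to the power `p'` is recovered afterwards from the
growth of subgradients. -/
lemma exists_memLp_two_of_dual [IsFiniteMeasure m] (hp2 : p ≤ 2)
    (Φ : StrongDual ℝ (Lp (Rn n) (ENNReal.ofReal p) m)) :
    ∃ Y : X → Rn n, MemLp Y 2 m ∧ ∀ (H : X → Rn n) (_ : MemLp H 2 m)
      (hH : MemLp H (ENNReal.ofReal p) m), Φ (hH.toLp H) = ∫ x, ⟪Y x, H x⟫ ∂m := by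
  have hle := ofReal_le_two hp2
  have hmem : ∀ H : Lp (Rn n) 2 m, MemLp H (ENNReal.ofReal p) m := fun H =>
    (Lp.memLp H).mono_exponent hle
  set c := m univ ^ (1 / (ENNReal.ofReal p).toReal - 1 / (2 : ℝ≥0∞).toReal) with hc
  have hctop : c ≠ ⊤ := by
    refine ENNReal.rpow_ne_top_of_nonneg ?_ (measure_ne_top _ _)
    have hp : 1 < p := Fact.out
    rw [ENNReal.toReal_ofReal (by linarith), ENNReal.toReal_ofNat, sub_nonneg]
    exact one_div_le_one_div_of_le (by linarith) hp2
  let J : Lp (Rn n) 2 m →ₗ[ℝ] Lp (Rn n) (ENNReal.ofReal p) m :=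
    { toFun := fun H => (hmem H).toLp H
      map_add' := fun H K => by
        rw [← MemLp.toLp_add]
        exact MemLp.toLp_congr _ _ (Lp.coeFn_add H K)
      map_smul' := fun a H => by
        rw [RingHom.id_apply, ← MemLp.toLp_const_smul]
        exact MemLp.toLp_congr _ _ (Lp.coeFn_smul a H) }
  let JL : Lp (Rn n) 2 m →L[ℝ] Lp (Rn n) (ENNReal.ofReal p) m :=
    J.mkContinuous c.toReal fun H => by
      change ‖(hmem H).toLp H‖ ≤ _
      rw [Lp.norm_toLp, Lp.norm_def, ← ENNReal.toReal_mul, mul_comm]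
      exact ENNReal.toReal_mono (ENNReal.mul_ne_top (Lp.memLp H).2.ne hctop)
        (eLpNorm_le_eLpNorm_mul_rpow_measure_univ hle (Lp.memLp H).1)
  set y : Lp (Rn n) 2 m := (InnerProductSpace.toDual ℝ (Lp (Rn n) 2 m)).symm (Φ.comp JL) with hy
  refine ⟨y, Lp.memLp y, fun H h2 hH => ?_⟩
  have h3 : ⟪y, h2.toLp H⟫ = Φ (JL (h2.toLp H)) := by
    rw [hy, InnerProductSpace.toDual_symm_apply]
    rfl
  have h4 : JL (h2.toLp H) = hH.toLp H :=
    MemLp.toLp_congr (hmem _) hH h2.coeFn_toLp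
  rw [← h4, ← h3, L2.inner_def]
  refine integral_congr_ae ?_
  filter_upwards [h2.coeFn_toLp] with x hx
  rw [hx]

/-- The functional `H ↦ ∫ ⟪Y, H⟫` on `L^p`. -/
def fluxFunctional (m : Measure X) (p : ℝ) [Fact (1 < p)] {Y : X → Rn n}
    (hY : MemLp Y (conjExp p) m) :
    StrongDual ℝ (Lp (Rn n) (ENNReal.ofReal p) m) :=
  have : ENNReal.HolderConjugate (conjExp p) (ENNReal.ofReal p) := ENNReal.HolderTriple.symm
  (innerSL ℝ : Rn n →L[ℝ] Rn n →L[ℝ] ℝ).lpPairing m (conjExp p) (ENNReal.ofReal p) (hY.toLp Y)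

lemma fluxFunctional_apply {Y : X → Rn n} (hY : MemLp Y (conjExp p) m) {H : X → Rn n}
    (hH : MemLp H (ENNReal.ofReal p) m) :
    fluxFunctional m p hY (hH.toLp H) = ∫ x, ⟪Y x, H x⟫ ∂m := by
  rw [fluxFunctional, ContinuousLinearMap.lpPairing_eq_integral]
  refine integral_congr_ae ?_
  filter_upwards [hY.coeFn_toLp, hH.coeFn_toLp] with x h1 h2
  rw [h1, h2]
  rfl

lemma abs_integral_inner_le {Y : X → Rn n} (hY : MemLp Y (conjExp p) m) {H : X → Rn n}
    (hH : MemLp H (ENNReal.ofReal p) m) :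
    |∫ x, ⟪Y x, H x⟫ ∂m| ≤ (eLpNorm Y (conjExp p) m).toReal
      * (eLpNorm H (ENNReal.ofReal p) m).toReal := by
  have : ENNReal.HolderConjugate (conjExp p) (ENNReal.ofReal p) := ENNReal.HolderTriple.symm
  rw [← ENNReal.toReal_mul, ← Real.norm_eq_abs, ← toReal_enorm]
  refine ENNReal.toReal_mono (ENNReal.mul_ne_top hY.2.ne hH.2.ne) ?_
  refine (enorm_integral_le_lintegral_enorm _).trans ?_
  rw [← eLpNorm_one_eq_lintegral_enorm]
  simpa using eLpNorm_le_eLpNorm_mul_eLpNorm'_of_norm (r := 1) hY.1 hH.1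
    (fun a b : Rn n => ⟪a, b⟫) 1 (ae_of_all _ fun x => by
      simpa using norm_inner_le_norm (𝕜 := ℝ) (Y x) (H x))

lemma norm_fluxFunctional_le {Y : X → Rn n} (hY : MemLp Y (conjExp p) m) :
    ‖fluxFunctional m p hY‖ ≤ (eLpNorm Y (conjExp p) m).toReal := by
  refine ContinuousLinearMap.opNorm_le_bound _ ENNReal.toReal_nonneg fun H => ?_
  have h := abs_integral_inner_le hY (Lp.memLp H)
  rwa [← fluxFunctional_apply hY (Lp.memLp H), Lp.toLp_coeFn, ← Lp.norm_def] at h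

/-- Two continuous functionals on `L^p` which agree on `L²` are equal. -/
lemma apply_eq_integral_of_memLp_two [IsFiniteMeasure m]
    {Φ : StrongDual ℝ (Lp (Rn n) (ENNReal.ofReal p) m)} {Y : X → Rn n}
    (hY : MemLp Y (conjExp p) m)
    (h : ∀ (H : X → Rn n) (_ : MemLp H 2 m) (hH : MemLp H (ENNReal.ofReal p) m),
      Φ (hH.toLp H) = ∫ x, ⟪Y x, H x⟫ ∂m) {H : X → Rn n} (hH : MemLp H (ENNReal.ofReal p) m) :
    Φ (hH.toLp H) = ∫ x, ⟪Y x, H x⟫ ∂m := by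
  rw [← fluxFunctional_apply hY hH]
  refine Lp.induction ENNReal.ofReal_ne_top (fun f => Φ f = fluxFunctional m p hY f) ?_ ?_ ?_ _
  · intro c s hs hμs
    have e : (Lp.simpleFunc.indicatorConst (ENNReal.ofReal p) hs hμs.ne c : Lp (Rn n) _ m)
        = (memLp_indicator_const (ENNReal.ofReal p) hs c (Or.inr hμs.ne)).toLp _ := by
      rw [Lp.simpleFunc.coe_indicatorConst]
      rfl
    rw [e, fluxFunctional_apply hY, h _ (memLp_indicator_const 2 hs c (Or.inr hμs.ne))]
  · intro f g hf hg _ h1 h2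
    rw [map_add, map_add, h1, h2]
  · exact isClosed_eq Φ.continuous (fluxFunctional m p hY).continuous

/-- The exponents match because `p' (p - 1) = p`. -/
lemma eLpNorm_rpow_sub_one_le {C : ℝ} {Y G : X → Rn n}
    (h : ∀ᵐ z ∂m, ‖Y z‖ ≤ C * (1 + ‖G z‖) ^ (p - 1)) :
    eLpNorm Y (conjExp p) m
      ≤ ENNReal.ofReal C * eLpNorm (fun z => 1 + ‖G z‖) (ENNReal.ofReal p) m ^ (p - 1) := by
  have hp : 1 < p := Fact.out
  have h1 := eLpNorm_norm_rpow (μ := m) (p := conjExp p) (fun z => 1 + ‖G z‖)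
    (q := p - 1) (by linarith)
  rw [← ENNReal.ofReal_mul (div_nonneg (by linarith) (by linarith)),
    div_mul_cancel₀ _ (by linarith)] at h1
  rw [← h1]
  refine eLpNorm_le_mul_eLpNorm_of_ae_le_mul ?_ _
  filter_upwards [h] with z hz
  rwa [Real.norm_of_nonneg (by positivity), Real.norm_of_nonneg (by positivity)]

lemma exists_bound_eLpNorm_flux [IsFiniteMeasure m] {C : ℝ} {Y G : ℕ → X → Rn n}
    {G₀ : X → Rn n} (hG : ∀ k, MemLp (G k) (ENNReal.ofReal p) m)
    (hG₀ : MemLp G₀ (ENNReal.ofReal p) m)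
    (hlim : Tendsto (fun k => eLpNorm (fun z => G k z - G₀ z) (ENNReal.ofReal p) m) atTop (𝓝 0))
    (h : ∀ k, ∀ᵐ z ∂m, ‖Y k z‖ ≤ C * (1 + ‖G k z‖) ^ (p - 1)) :
    ∃ B : ℝ, 0 ≤ B ∧ ∀ᶠ k in atTop, (eLpNorm (Y k) (conjExp p) m).toReal ≤ B := by
  have hp : 1 < p := Fact.out
  set b : ℝ≥0∞ := 1 + eLpNorm (fun z => 1 + ‖G₀ z‖) (ENNReal.ofReal p) m with hb
  have hbtop : b ≠ ⊤ := ENNReal.add_ne_top.2 ⟨ENNReal.one_ne_top,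
    ((memLp_const (1 : ℝ)).add hG₀.norm).2.ne⟩
  have htop : ENNReal.ofReal C * b ^ (p - 1) ≠ ⊤ := ENNReal.mul_ne_top ENNReal.ofReal_ne_top
    (ENNReal.rpow_ne_top_of_nonneg (by linarith) hbtop)
  refine ⟨(ENNReal.ofReal C * b ^ (p - 1)).toReal, ENNReal.toReal_nonneg, ?_⟩
  filter_upwards [hlim.eventually_le_const zero_lt_one] with k hk
  refine ENNReal.toReal_mono htop ((eLpNorm_rpow_sub_one_le (h k)).trans ?_)
  have h1 : eLpNorm (fun z => 1 + ‖G k z‖) (ENNReal.ofReal p) m ≤ b := by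
    have h2 : eLpNorm (fun z => 1 + ‖G k z‖) (ENNReal.ofReal p) m
        ≤ eLpNorm (fun z => ‖G k z - G₀ z‖ + (1 + ‖G₀ z‖)) (ENNReal.ofReal p) m := by
      refine eLpNorm_mono fun z => ?_
      rw [Real.norm_of_nonneg (by positivity), Real.norm_of_nonneg (by positivity)]
      linarith [norm_le_norm_sub_add (G k z) (G₀ z)]
    refine h2.trans ((eLpNorm_add_le ((hG k).1.sub hG₀.1).norm
      (aestronglyMeasurable_const.add hG₀.1.norm) (factOneLe p).out).trans ?_)
    refine add_le_add ?_ le_rfl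
    exact (eLpNorm_norm _).le.trans hk
  have : 0 ≤ p - 1 := by linarith
  gcongr

variable {C κ : ℝ} {F : ℕ → Rn n → ℝ} {E : Rn n → ℝ} {δ : ℕ → ℝ} {G : ℕ → X → Rn n} {G₀ : X → Rn n}

lemma memLp_gradient_comp [IsFiniteMeasure m] {F : Rn n → ℝ} {G : X → Rn n}
    (hF : IsGrowthConvex p C κ F) (hFs : ContDiff ℝ 1 F) (hG : MemLp G (ENNReal.ofReal p) m) :
    MemLp (fun z => ∇ F (G z)) (conjExp p) m :=
  memLp_conjExp_of_growth hG ((continuous_gradient hFs).comp_aestronglyMeasurable hG.1)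
    (ae_of_all _ fun _ => hF.norm_le_of_mem_subdifferential Fact.out
      (gradient_mem_subdifferential hF.convex (hFs.differentiable (by simp) _)))

/-- Hölder: both fluxes stay bounded in `L^{p'}` while `G k - G₀` tends to zero in `L^p`. This
strong convergence makes the identification of the weak limit elementary. -/
lemma tendsto_integral_monotone [IsFiniteMeasure m] (hF : ∀ k, IsGrowthConvex p C κ (F k))
    (hFs : ∀ k, ContDiff ℝ 1 (F k)) (hG : ∀ k, MemLp (G k) (ENNReal.ofReal p) m)
    (hG₀ : MemLp G₀ (ENNReal.ofReal p) m)
    (hlim : Tendsto (fun k => eLpNorm (fun z => G k z - G₀ z) (ENNReal.ofReal p) m) atTop (𝓝 0)) :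
    Tendsto (fun k => ∫ z, ⟪∇ (F k) (G k z) - ∇ (F k) (G₀ z), G k z - G₀ z⟫ ∂m) atTop (𝓝 0) := by
  have hp : 1 < p := Fact.out
  have hmem : ∀ k z, ∇ (F k) z ∈ subdifferential (F k) z := fun k z =>
    gradient_mem_subdifferential (hF k).convex ((hFs k).differentiable (by simp) _)
  obtain ⟨B, hB0, hB⟩ := exists_bound_eLpNorm_flux hG hG₀ hlim
    (Y := fun k z => ∇ (F k) (G k z)) fun k => ae_of_all _ fun z =>
      (hF k).norm_le_of_mem_subdifferential hp (hmem k (G k z))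
  obtain ⟨B', hB0', hB'⟩ := exists_bound_eLpNorm_flux (G := fun _ => G₀) (fun _ => hG₀) hG₀
    (by simp) (Y := fun k z => ∇ (F k) (G₀ z)) fun k => ae_of_all _ fun z =>
      (hF k).norm_le_of_mem_subdifferential hp (hmem k (G₀ z))
  have hr : Tendsto (fun k => (B + B') *
      (eLpNorm (fun z => G k z - G₀ z) (ENNReal.ofReal p) m).toReal) atTop (𝓝 0) := by
    have := ((ENNReal.tendsto_toReal ENNReal.zero_ne_top).comp hlim).const_mul (B + B')
    simpa using this
  refine squeeze_zero_norm' ?_ hr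
  filter_upwards [hB, hB'] with k h1 h2
  have hd : MemLp (fun z => G k z - G₀ z) (ENNReal.ofReal p) m := (hG k).sub hG₀
  have hY := memLp_gradient_comp (hF k) (hFs k) (hG k)
  have hY' := memLp_gradient_comp (hF k) (hFs k) hG₀
  have h3 := abs_integral_inner_le hY hd
  have h4 := abs_integral_inner_le hY' hd
  simp only [inner_sub_left]
  rw [integral_sub (integrable_inner_of_memLp hY hd) (integrable_inner_of_memLp hY' hd),
    Real.norm_eq_abs, add_mul]
  refine (abs_sub _ _).trans (add_le_add (h3.trans ?_) (h4.trans ?_))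
  · exact mul_le_mul_of_nonneg_right h1 ENNReal.toReal_nonneg
  · exact mul_le_mul_of_nonneg_right h2 ENNReal.toReal_nonneg

/-- Add the subgradient inequalities of `F k` at `G k z`, tested at `w`, and at `G₀ z`, tested at `G
k z`: the value `F k (G k z)` cancels. Replacing `F k` by `E` at `w` and `G₀ z` costs `|δ k|`, and
the remaining monotonicity term vanishes in the limit. On `A` the test field `w - G₀` is bounded, so
the weak limit may be taken. -/
lemma setIntegral_inner_le_of_weak_limit [IsFiniteMeasure m]
    (hF : ∀ k, IsGrowthConvex p C κ (F k)) (hFs : ∀ k, ContDiff ℝ 1 (F k))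
    (hE : IsGrowthConvex p C κ E) (hδ : Tendsto δ atTop (𝓝 0))
    (hFE : ∀ k z, |F k z - E z| ≤ δ k * (1 + ‖z‖) ^ (p - 1))
    (hG : ∀ k, MemLp (G k) (ENNReal.ofReal p) m) (hG₀ : MemLp G₀ (ENNReal.ofReal p) m)
    (hlim : Tendsto (fun k => eLpNorm (fun z => G k z - G₀ z) (ENNReal.ofReal p) m) atTop (𝓝 0))
    {U : Filter ℕ} [U.NeBot] (hU : U ≤ atTop) {Y : X → Rn n}
    (hY : ∀ H : X → Rn n, MemLp H 2 m → MemLp H (ENNReal.ofReal p) m →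
      Tendsto (fun k => ∫ z, ⟪∇ (F k) (G k z), H z⟫ ∂m) U (𝓝 (∫ z, ⟪Y z, H z⟫ ∂m)))
    (w : Rn n) {r : ℝ} (hr : 0 ≤ r) {A : Set X} (hA : MeasurableSet A) (hAr : ∀ z ∈ A, ‖G₀ z‖ ≤ r) :
    ∫ z in A, ⟪Y z, w - G₀ z⟫ ∂m ≤ ∫ z in A, (E w - E (G₀ z)) ∂m := by
  have hp : 1 < p := Fact.out
  set H : X → Rn n := A.indicator fun z => w - G₀ z with hH
  have hHm : AEStronglyMeasurable H m := (aestronglyMeasurable_const.sub hG₀.1).indicator hA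
  have hHb : ∀ z, ‖H z‖ ≤ ‖w‖ + r := fun z => by
    by_cases hz : z ∈ A
    · rw [hH, indicator_of_mem hz]
      exact (norm_sub_le _ _).trans (by gcongr; exact hAr z hz)
    · rw [hH, indicator_of_notMem hz, norm_zero]
      positivity
  have hHL : ∀ q, MemLp H q m := fun q => MemLp.of_bound hHm (‖w‖ + r) (ae_of_all _ hHb)
  have hset : ∀ V : X → Rn n, ∫ z in A, ⟪V z, w - G₀ z⟫ ∂m = ∫ z, ⟪V z, H z⟫ ∂m := fun V => by
    rw [← integral_indicator hA]
    refine integral_congr_ae (ae_of_all _ fun z => ?_)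
    by_cases hz : z ∈ A
    · simp only [hH, indicator_of_mem hz]
    · simp only [hH, indicator_of_notMem hz, inner_zero_right]
  set c := (1 + ‖w‖) ^ (p - 1) + (1 + r) ^ (p - 1) with hc
  have hEi : IntegrableOn (fun z => E w - E (G₀ z)) A m := by
    refine (integrable_const _).sub (IntegrableOn.of_bound (measure_lt_top _ _)
      (hE.continuous.comp_aestronglyMeasurable hG₀.1).restrict (C * (1 + r) ^ p) ?_)
    filter_upwards [ae_restrict_mem hA] with z hz
    have hC := hE.const_nonneg
    rw [Real.norm_of_nonneg (hE.nonneg _)]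
    refine (hE.growth _).trans ?_
    gcongr
    exact hAr z hz
  have hmem : ∀ k z, ∇ (F k) z ∈ subdifferential (F k) z := fun k z =>
    gradient_mem_subdifferential (hF k).convex ((hFs k).differentiable (by simp) _)
  have hmono : ∀ k z, 0 ≤ ⟪∇ (F k) (G k z) - ∇ (F k) (G₀ z), G k z - G₀ z⟫ := fun k z => by
    have h1 := hmem k (G k z) (G₀ z)
    have h2 := hmem k (G₀ z) (G k z)
    rw [inner_sub_left]
    rw [← neg_sub (G k z), inner_neg_right] at h1
    linarith
  have hpt : ∀ k, ∀ z ∈ A, ⟪∇ (F k) (G k z), w - G₀ z⟫ ≤ (E w - E (G₀ z)) + (|δ k| * c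
      + ⟪∇ (F k) (G k z) - ∇ (F k) (G₀ z), G k z - G₀ z⟫) := fun k z hz => by
    have h1 := hmem k (G k z) w
    have h2 := hmem k (G₀ z) (G k z)
    have h3 := (abs_sub_le_iff.1 (hFE k w)).1
    have h4 := (abs_sub_le_iff.1 (hFE k (G₀ z))).2
    have h5 : δ k * (1 + ‖w‖) ^ (p - 1) ≤ |δ k| * (1 + ‖w‖) ^ (p - 1) := by
      gcongr
      exact le_abs_self _
    have h6 : δ k * (1 + ‖G₀ z‖) ^ (p - 1) ≤ |δ k| * (1 + r) ^ (p - 1) := by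
      have := hAr z hz
      have : 0 ≤ p - 1 := by linarith
      gcongr
      exact le_abs_self _
    have e : w - G₀ z = (w - G k z) + (G k z - G₀ z) := by abel
    rw [e, inner_add_right, inner_sub_left, hc, mul_add]
    linarith
  have hYi : ∀ k, Integrable (fun z => ⟪∇ (F k) (G k z), H z⟫) m := fun k =>
    integrable_inner_of_memLp (memLp_gradient_comp (hF k) (hFs k) (hG k)) (hHL _)
  have hMi : ∀ k, Integrable
      (fun z => ⟪∇ (F k) (G k z) - ∇ (F k) (G₀ z), G k z - G₀ z⟫) m := fun k =>
    integrable_inner_of_memLp ((memLp_gradient_comp (hF k) (hFs k) (hG k)).sub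
      (memLp_gradient_comp (hF k) (hFs k) hG₀)) ((hG k).sub hG₀)
  have hk : ∀ k, ∫ z, ⟪∇ (F k) (G k z), H z⟫ ∂m ≤ (∫ z in A, (E w - E (G₀ z)) ∂m)
      + (m.real A * (|δ k| * c)
      + ∫ z, ⟪∇ (F k) (G k z) - ∇ (F k) (G₀ z), G k z - G₀ z⟫ ∂m) := fun k => by
    have hYi' : IntegrableOn (fun z => ⟪∇ (F k) (G k z), w - G₀ z⟫) A m := by
      refine ((hYi k).integrableOn (s := A)).congr_fun (fun z hz => ?_) hA
      simp only [hH, indicator_of_mem hz]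
    have hi : IntegrableOn (fun z => |δ k| * c
        + ⟪∇ (F k) (G k z) - ∇ (F k) (G₀ z), G k z - G₀ z⟫) A m :=
      (integrable_const _).add (hMi k).integrableOn
    rw [← hset]
    calc ∫ z in A, ⟪∇ (F k) (G k z), w - G₀ z⟫ ∂m
        ≤ ∫ z in A, ((E w - E (G₀ z)) + (|δ k| * c
          + ⟪∇ (F k) (G k z) - ∇ (F k) (G₀ z), G k z - G₀ z⟫)) ∂m :=
          setIntegral_mono_on hYi' (hEi.add hi) hA (hpt k)
      _ = (∫ z in A, (E w - E (G₀ z)) ∂m) + (m.real A * (|δ k| * c)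
          + ∫ z in A, ⟪∇ (F k) (G k z) - ∇ (F k) (G₀ z), G k z - G₀ z⟫ ∂m) := by
          rw [integral_add hEi hi,
            integral_add (integrable_const _) (hMi k).integrableOn, setIntegral_const, smul_eq_mul]
      _ ≤ _ := by
          gcongr
          · exact ae_of_all _ (hmono k)
          · exact hMi k
          · exact Measure.restrict_le_self
  rw [hset]
  refine le_of_tendsto_of_tendsto (hY H (hHL _) (hHL _)) ?_ (Eventually.of_forall hk)
  have h1 : Tendsto (fun k => m.real A * (|δ k| * c)) atTop (𝓝 0) := by
    simpa using (hδ.abs.mul_const c).const_mul (m.real A)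
  simpa using ((h1.add (tendsto_integral_monotone hF hFs hG hG₀ hlim)).mono_left hU).const_add
    (∫ z in A, (E w - E (G₀ z)) ∂m)

lemma integrableOn_inner_of_bound [IsFiniteMeasure m] {Y H : X → Rn n} (hY : MemLp Y 2 m)
    {A : Set X} (hA : MeasurableSet A) (hH : AEStronglyMeasurable H m) {r : ℝ}
    (hr : ∀ z ∈ A, ‖H z‖ ≤ r) : IntegrableOn (fun z => ⟪Y z, H z⟫) A m := by
  have h1 : IntegrableOn Y A m := (hY.integrable (by norm_num)).integrableOn
  refine (h1.norm.mul_const r).mono' (hY.1.inner hH).restrict ?_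
  filter_upwards [ae_restrict_mem hA] with z hz
  exact (norm_inner_le_norm _ _).trans (by gcongr; exact hr z hz)

/-- The integrals over measurable subsets of `{‖G₀‖ ≤ j}` give the pointwise inequality for one `w`.
Countably many `j` exhaust the space, countably many dense `w` share one null set, and continuity of
`E` reaches every `w`. -/
lemma ae_mem_subdifferential_of_setIntegral [IsFiniteMeasure m] (hE : IsGrowthConvex p C κ E)
    {Y : X → Rn n} (hY : MemLp Y 2 m) (hG₀ : StronglyMeasurable G₀)
    (h : ∀ (w : Rn n) (r : ℝ), 0 ≤ r → ∀ A, MeasurableSet A → (∀ z ∈ A, ‖G₀ z‖ ≤ r) →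
      ∫ z in A, ⟪Y z, w - G₀ z⟫ ∂m ≤ ∫ z in A, (E w - E (G₀ z)) ∂m) :
    ∀ᵐ z ∂m, Y z ∈ subdifferential E (G₀ z) := by
  obtain ⟨D, hDc, hDd⟩ := TopologicalSpace.exists_countable_dense (Rn n)
  have h1 : ∀ w ∈ D, ∀ j : ℕ, ∀ᵐ z ∂m, ‖G₀ z‖ ≤ j → E (G₀ z) + ⟪Y z, w - G₀ z⟫ ≤ E w := by
    intro w _ j
    set B : Set X := {z | ‖G₀ z‖ ≤ j} with hB
    have hBm : MeasurableSet B := measurableSet_le hG₀.measurable.norm measurable_const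
    have hi1 : IntegrableOn (fun z => ⟪Y z, w - G₀ z⟫) B m :=
      integrableOn_inner_of_bound hY hBm (aestronglyMeasurable_const.sub hG₀.aestronglyMeasurable)
        (r := ‖w‖ + j) fun z hz => (norm_sub_le _ _).trans (by gcongr; exact hz)
    have hi2 : IntegrableOn (fun z => E w - E (G₀ z)) B m := by
      refine (integrable_const _).sub (IntegrableOn.of_bound (measure_lt_top _ _)
        (hE.continuous.comp_stronglyMeasurable hG₀).aestronglyMeasurable (C * (1 + j) ^ p) ?_)
      filter_upwards [ae_restrict_mem hBm] with z hz
      have hC := hE.const_nonneg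
      have hp : 1 < p := Fact.out
      rw [Real.norm_of_nonneg (hE.nonneg _)]
      refine (hE.growth _).trans ?_
      gcongr
      exact hz
    have h2 : 0 ≤ᵐ[m.restrict B] fun z => (E w - E (G₀ z)) - ⟪Y z, w - G₀ z⟫ := by
      refine ae_nonneg_of_forall_setIntegral_nonneg (hi2.sub hi1) fun s hs _ => ?_
      rw [Measure.restrict_restrict hs, integral_sub (hi2.mono_set inter_subset_right)
        (hi1.mono_set inter_subset_right), sub_nonneg]
      exact h w j (Nat.cast_nonneg j) _ (hs.inter hBm) fun z hz => hz.2
    filter_upwards [(ae_restrict_iff' hBm).1 h2] with z hz hzj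
    have := hz hzj
    simp only [Pi.zero_apply] at this
    linarith
  have h2 : ∀ᵐ z ∂m, ∀ w ∈ D, E (G₀ z) + ⟪Y z, w - G₀ z⟫ ≤ E w := by
    refine (ae_ball_iff hDc).2 fun w hw => ?_
    filter_upwards [ae_all_iff.2 (h1 w hw)] with z hz
    obtain ⟨j, hj⟩ := exists_nat_ge ‖G₀ z‖
    exact hz j hj
  filter_upwards [h2] with z hz w
  have hcl : IsClosed {w | E (G₀ z) + ⟪Y z, w - G₀ z⟫ ≤ E w} :=
    isClosed_le (by fun_prop) hE.continuous
  exact hcl.closure_subset_iff.2 hz (hDd w)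

/-- The fluxes converge weakly, and the limit is a flux for the limit density. -/
lemma exists_flux_limit [IsFiniteMeasure m] (hp2 : p ≤ 2)
    (hF : ∀ k, IsGrowthConvex p C κ (F k)) (hFs : ∀ k, ContDiff ℝ 1 (F k))
    (hE : IsGrowthConvex p C κ E) (hδ : Tendsto δ atTop (𝓝 0))
    (hFE : ∀ k z, |F k z - E z| ≤ δ k * (1 + ‖z‖) ^ (p - 1))
    (hG : ∀ k, MemLp (G k) (ENNReal.ofReal p) m) (hG₀ : MemLp G₀ (ENNReal.ofReal p) m)
    (hlim : Tendsto (fun k => eLpNorm (fun z => G k z - G₀ z) (ENNReal.ofReal p) m) atTop (𝓝 0)) :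
    ∃ Y : X → Rn n, MemLp Y (conjExp p) m ∧ (∀ᵐ z ∂m, Y z ∈ subdifferential E (G₀ z)) ∧
      ∃ U : Ultrafilter ℕ, (U : Filter ℕ) ≤ atTop ∧
        ∀ H : X → Rn n, MemLp H (ENNReal.ofReal p) m →
          Tendsto (fun k => ∫ z, ⟪∇ (F k) (G k z), H z⟫ ∂m) U (𝓝 (∫ z, ⟪Y z, H z⟫ ∂m)) := by
  have hp : 1 < p := Fact.out
  have hYk := fun k => memLp_gradient_comp (hF k) (hFs k) (hG k)
  obtain ⟨B, hB0, hB⟩ := exists_bound_eLpNorm_flux hG hG₀ hlim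
    (Y := fun k z => ∇ (F k) (G k z)) fun k => ae_of_all _ fun z =>
      (hF k).norm_le_of_mem_subdifferential hp
        (gradient_mem_subdifferential (hF k).convex ((hFs k).differentiable (by simp) (G k z)))
  obtain ⟨U, hU, Φ, hΦ⟩ := exists_weakStar_limit (Φ := fun k => fluxFunctional m p (hYk k))
    (hB.mono fun k hk => (norm_fluxFunctional_le (hYk k)).trans hk)
  obtain ⟨Y, hY2, hYΦ⟩ := exists_memLp_two_of_dual hp2 Φ
  have hlimΦ : ∀ (H : X → Rn n) (hH : MemLp H (ENNReal.ofReal p) m),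
      Tendsto (fun k => ∫ z, ⟪∇ (F k) (G k z), H z⟫ ∂m) U (𝓝 (Φ (hH.toLp H))) := fun H hH =>
    (hΦ (hH.toLp H)).congr fun k => fluxFunctional_apply (hYk k) hH
  have hmk := hG₀.1.ae_eq_mk
  have hsub : ∀ᵐ z ∂m, Y z ∈ subdifferential E (G₀ z) := by
    have := ae_mem_subdifferential_of_setIntegral hE hY2 hG₀.1.stronglyMeasurable_mk
      fun w r hr A hA hAr => setIntegral_inner_le_of_weak_limit hF hFs hE hδ hFE hG
        ((memLp_congr_ae hmk).1 hG₀) (hlim.congr fun k => eLpNorm_congr_ae (by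
          filter_upwards [hmk] with z hz
          rw [hz])) hU (fun H h2 hH => by
          rw [← hYΦ H h2 hH]
          exact hlimΦ H hH) w hr hA hAr
    filter_upwards [this, hmk] with z h1 h2
    rwa [h2]
  -- Being a subgradient at `G₀`, the representative has growth of order `p - 1`, which upgrades
  -- `L²` to `L^{p'}`. Density then extends the representation to all of `L^p`.
  have hY : MemLp Y (conjExp p) m := memLp_conjExp_of_growth hG₀ hY2.1
    (hsub.mono fun z hz => hE.norm_le_of_mem_subdifferential hp hz)
  refine ⟨Y, hY, hsub, U, hU, fun H hH => ?_⟩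
  rw [← apply_eq_integral_of_memLp_two hY hYΦ hH]
  exact hlimΦ H hH

end WeakLimit

/-! ### The limit equation -/

section LimitEquation

variable {n : ℕ} {Ω : Set (Rn n)} {p : ℝ} [Fact (1 < p)] {S T C κ : ℝ}

/-- `W` is the image of `y` under a continuous linear map, so its measurability and integrability
are inherited. The minus sign makes `W` the divergence of `y`. -/
lemma exists_dual_valued {E X : Type*} [NormedAddCommGroup E] [NormedSpace ℝ E]
    [MeasurableSpace X] {ν : Measure X} {μ : Measure (Rn n)} {q : ℝ≥0∞}
    (ι : E →L[ℝ] Lp (Rn n) (ENNReal.ofReal p) μ) {y : X → Lp (Rn n) (conjExp p) μ}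
    (hy : MemLp y q ν) :
    ∃ W : X → StrongDual ℝ E, MemLp W q ν ∧ ∀ t v, W t v = -∫ x, ⟪y t x, ι v x⟫ ∂μ := by
  have : ENNReal.HolderConjugate (conjExp p) (ENNReal.ofReal p) := ENNReal.HolderTriple.symm
  set D : Lp (Rn n) (conjExp p) μ →L[ℝ] StrongDual ℝ E :=
    -(((ContinuousLinearMap.compL ℝ E (Lp (Rn n) (ENNReal.ofReal p) μ) ℝ).flip ι).comp
      ((innerSL ℝ : Rn n →L[ℝ] Rn n →L[ℝ] ℝ).lpPairing μ (conjExp p) (ENNReal.ofReal p))) with hD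
  refine ⟨fun t => D (y t), D.comp_memLp' hy, fun t v => ?_⟩
  have h : D (y t) v = -((innerSL ℝ : Rn n →L[ℝ] Rn n →L[ℝ] ℝ).lpPairing μ (conjExp p)
    (ENNReal.ofReal p) (y t) (ι v)) := rfl
  rw [h, ContinuousLinearMap.lpPairing_eq_integral]
  rfl

lemma exists_hasFlux (hΩ : Bornology.IsBounded Ω) {Y : Rn n × ℝ → Rn n}
    (hY : MemLp Y (conjExp p) (volume.restrict (spaceTime Ω T))) :
    ∃ W : ℝ → V₀Dual Ω p, MemLp W (conjExp p) (timeMeasure T) ∧ HasFlux Ω p T W Y := by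
  have := isFiniteMeasure_restrict_of_isBounded hΩ
  rw [restrict_spaceTime] at hY
  obtain ⟨y, hy, hs⟩ := exists_isSlice hY
  obtain ⟨W, hW, h⟩ := exists_dual_valued ((sndL Ω p).comp (V₀ Ω p).subtypeL) hy
  refine ⟨W, hW, ?_⟩
  filter_upwards [hs] with t ht v
  rw [h, neg_add_eq_zero]
  refine integral_congr_ae ?_
  filter_upwards [ht] with x hx
  rw [hx]
  rfl

lemma isSpaceTimeGradient_smul (hΩ : Bornology.IsBounded Ω) (v : V₀ Ω p) {η : ℝ → ℝ}
    (hη : Continuous η) (hc : HasCompactSupport η) :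
    IsSpaceTimeGradient Ω p T (fun t => (η t • v : V₀ Ω p).1) fun z => η z.2 • v.1.2 z.1 := by
  have := isFiniteMeasure_restrict_of_isBounded hΩ
  obtain ⟨M, hM⟩ := hc.exists_bound_of_continuous hη
  constructor
  · rw [restrict_spaceTime]
    have h1 := (Lp.memLp v.1.2).comp_fst (timeMeasure T)
    refine h1.of_le_mul (c := M)
      ((hη.comp continuous_snd).aestronglyMeasurable.smul h1.1) (ae_of_all _ fun z => ?_)
    rw [norm_smul]
    gcongr
    exact hM _
  · refine ae_of_all _ fun t => ?_
    exact (Lp.coeFn_smul (η t) v.1.2).symm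

lemma HasFlux.integral_mul_eq (hΩ : Bornology.IsBounded Ω) {W : ℝ → V₀Dual Ω p}
    {Y : Rn n × ℝ → Rn n} (hW : HasFlux Ω p T W Y)
    (hY : MemLp Y (conjExp p) (volume.restrict (spaceTime Ω T))) (v : V₀ Ω p) {η : ℝ → ℝ}
    (hη : Continuous η) (hc : HasCompactSupport η) :
    (∫ t in Ioo 0 T, η t * W t v) + ∫ z in spaceTime Ω T, ⟪Y z, η z.2 • v.1.2 z.1⟫ = 0 := by
  simpa only [map_smul, smul_eq_mul] using
    hW.integral_add_eq_zero hΩ hY (isSpaceTimeGradient_smul hΩ v hη hc)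

/-- Passage to the limit in the equations `∂ₜuₖ = div Yₖ`. -/
lemma isTimeDeriv_of_tendsto (hΩ : Bornology.IsBounded Ω) {U : Filter ℕ} [U.NeBot]
    {u : ℕ → ℝ → Lp ℝ 2 (volume.restrict Ω)} {u₀ : ℝ → Lp ℝ 2 (volume.restrict Ω)}
    {W : ℕ → ℝ → V₀Dual Ω p} {W₀ : ℝ → V₀Dual Ω p} {Y : ℕ → Rn n × ℝ → Rn n}
    {Y₀ : Rn n × ℝ → Rn n} (hu : ∀ k, MemLp (u k) (ENNReal.ofReal p) (timeMeasure T))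
    (hu₀ : MemLp u₀ (ENNReal.ofReal p) (timeMeasure T))
    (hlim : Tendsto (fun k => eLpNorm (fun t => u k t - u₀ t) (ENNReal.ofReal p) (timeMeasure T))
      U (𝓝 0)) (hW : ∀ k, IsTimeDeriv Ω p T (u k) (W k)) (hflux : ∀ k, HasFlux Ω p T (W k) (Y k))
    (hY : ∀ k, MemLp (Y k) (conjExp p) (volume.restrict (spaceTime Ω T)))
    (hY₀ : MemLp Y₀ (conjExp p) (volume.restrict (spaceTime Ω T)))
    (hYlim : ∀ H, MemLp H (ENNReal.ofReal p) (volume.restrict (spaceTime Ω T)) →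
      Tendsto (fun k => ∫ z in spaceTime Ω T, ⟪Y k z, H z⟫) U
        (𝓝 (∫ z in spaceTime Ω T, ⟪Y₀ z, H z⟫)))
    (hW₀ : MemLp W₀ (conjExp p) (timeMeasure T)) (hflux₀ : HasFlux Ω p T W₀ Y₀) :
    IsTimeDeriv Ω p T u₀ W₀ := by
  refine ⟨hW₀, fun v η h1 h2 h3 => ?_⟩
  obtain ⟨M, hM⟩ := exists_bound_deriv h1 h2
  have hbd : ∀ᵐ t ∂timeMeasure T, ‖deriv η t • v.1.1‖ ≤ M * ‖v.1.1‖ := ae_of_all _ fun t => by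
    rw [norm_smul]
    gcongr
    exact hM t
  have hm : AEStronglyMeasurable (fun t => deriv η t • v.1.1) (timeMeasure T) :=
    ((h1.continuous_deriv (by simp)).smul continuous_const).aestronglyMeasurable
  have hl := tendsto_integral_pairing
    (innerSL ℝ : Lp ℝ 2 (volume.restrict Ω) →L[ℝ] Lp ℝ 2 (volume.restrict Ω) →L[ℝ] ℝ)
    (factOneLe p).out hu hu₀ hlim hm hbd
  have e1 : ∀ f : ℝ → Lp ℝ 2 (volume.restrict Ω), (∫ t in Ioo 0 T,
      (innerSL ℝ : Lp ℝ 2 (volume.restrict Ω) →L[ℝ] Lp ℝ 2 (volume.restrict Ω) →L[ℝ] ℝ) (f t)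
        (deriv η t • v.1.1)) = ∫ t in Ioo 0 T, deriv η t * ⟪f t, v.1.1⟫ := fun f => by
    simp only [innerSL_apply_apply, real_inner_smul_right]
  simp only [e1] at hl
  -- The derivatives are passed to the limit through their fluxes, which converge weakly; no
  -- convergence of `W k` in the dual norm is required.
  have hr := hYlim _ (isSpaceTimeGradient_smul hΩ v h1.continuous h2).1
  refine tendsto_nhds_unique hl ?_
  rw [eq_neg_of_add_eq_zero_left (hflux₀.integral_mul_eq hΩ hY₀ v h1.continuous h2), neg_neg]
  refine hr.congr fun k => ?_
  rw [(hW k).2 v η h1 h2 h3,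
    eq_neg_of_add_eq_zero_left ((hflux k).integral_mul_eq hΩ (hY k) v h1.continuous h2), neg_neg]

variable {E₁ Eₚ : Rn n → ℝ} {lam₀ Lam₀ : ℝ} {uStar u : ℝ → V Ω p}

lemma IsDirichletSolution.exists_isFluxSolution (hΩ : Bornology.IsBounded Ω)
    (hE : IsGrowthConvex p C κ fun z => E₁ z + Eₚ z) (hₚ : ConvexOn ℝ univ Eₚ)
    (hₚs : ContDiff ℝ 1 Eₚ) (h : IsDirichletSolution Ω p S E₁ Eₚ uStar u) :
    ∃ c W G Y, IsFluxSolution Ω p S (fun z => E₁ z + Eₚ z) uStar u c W G Y := by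
  have hp : 1 < p := Fact.out
  have := isFiniteMeasure_spaceTime (T := S) hΩ
  obtain ⟨haff, ⟨c, hc, hcu, hc0⟩, hX, -, W, G, Z, hW, hG, hZ, hZG, hweak⟩ := h
  have hmem : ∀ᵐ z ∂volume.restrict (spaceTime Ω S),
      Z z + ∇ Eₚ (G z) ∈ subdifferential (fun z => E₁ z + Eₚ z) (G z) := by
    filter_upwards [hZG] with z hz
    exact subdifferential_add hz
      (gradient_mem_subdifferential hₚ (hₚs.differentiable (by simp) _))
  have hY : MemLp (fun z => Z z + ∇ Eₚ (G z)) (conjExp p) (volume.restrict (spaceTime Ω S)) :=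
    memLp_conjExp_of_growth hG.1
      (hZ.1.add ((continuous_gradient hₚs).comp_aestronglyMeasurable hG.1.1))
      (hmem.mono fun z hz => hE.norm_le_of_mem_subdifferential hp hz)
  exact ⟨c, W, G, _, haff, hX.1, hW, hG, hc, hcu, hc0, hY, hmem, hweak⟩

/-- The field required by the definition is `Z = Y - ∇ Eₚ (G)`: removing the differentiable summand
leaves a subgradient of `E₁`, and all subgradients of `E₁` obey one bound. -/
lemma isDirichletSolution_of_hasFlux (hΩ : Bornology.IsBounded Ω) (h₁ : IsOneDensity E₁)
    (hₚ : IsPDensity p lam₀ Lam₀ Eₚ) {cStar c : ℝ → Lp ℝ 2 (volume.restrict Ω)}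
    {W : ℝ → V₀Dual Ω p} {G Y : Rn n × ℝ → Rn n} (haff : MemAffine Ω p S uStar u)
    (hcStar : ContinuousOn cStar (Icc 0 S)) (hcuStar : ∀ᵐ t ∂timeMeasure S, cStar t = (uStar t).1.1)
    (hc : ContinuousOn c (Icc 0 S)) (hcu : ∀ᵐ t ∂timeMeasure S, c t = (u t).1.1 - (uStar t).1.1)
    (hc0 : c 0 = 0) (hu : MemLp u (ENNReal.ofReal p) (timeMeasure S))
    (hW : IsTimeDeriv Ω p S (fun t => (u t).1.1) W)
    (hG : IsSpaceTimeGradient Ω p S (fun t => (u t).1) G)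
    (hY : MemLp Y (conjExp p) (volume.restrict (spaceTime Ω S)))
    (hYG : ∀ᵐ z ∂volume.restrict (spaceTime Ω S),
      Y z ∈ subdifferential (fun z => E₁ z + Eₚ z) (G z))
    (hflux : HasFlux Ω p S W Y) : IsDirichletSolution Ω p S E₁ Eₚ uStar u := by
  obtain ⟨L, hL⟩ := h₁.exists_norm_le
  have hZG : ∀ᵐ z ∂volume.restrict (spaceTime Ω S),
      Y z - ∇ Eₚ (G z) ∈ subdifferential E₁ (G z) := by
    filter_upwards [hYG] with z hz
    exact sub_gradient_mem_subdifferential h₁.convex (hₚ.contDiff.differentiable (by simp) _) hz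
  refine ⟨haff, ⟨c, hc, hcu, hc0⟩, ⟨hu, W, hW⟩, ⟨fun t => cStar t + c t, hcStar.add hc, ?_⟩, W, G,
    fun z => Y z - ∇ Eₚ (G z), hW, hG, ?_, hZG, fun φ Gφ hφ hGφ => ?_⟩
  · filter_upwards [hcuStar, hcu] with t h1 h2
    rw [h1, h2, add_sub_cancel]
  · exact memLp_top_of_bound (hY.1.sub
      ((continuous_gradient hₚ.contDiff).comp_aestronglyMeasurable hG.1.1)) L
      (hZG.mono fun z hz => hL _ _ hz)
  · simp only [sub_add_cancel]
    exact hflux.integral_add_eq_zero hΩ hY hGφ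

lemma memAffine_of_isTimeDeriv {w : ℝ → V₀ Ω p} {W : ℝ → V₀Dual Ω p} (huStar : MemX Ω p T uStar)
    (hw : MemLp w (ENNReal.ofReal p) (timeMeasure T))
    (hu : MemLp u (ENNReal.ofReal p) (timeMeasure T))
    (huw : ∀ t, (u t : Pairs Ω p) = (uStar t : Pairs Ω p) + (w t : Pairs Ω p))
    (hW : IsTimeDeriv Ω p T (fun t => (u t).1.1) W) : MemAffine Ω p T uStar u := by
  obtain ⟨hs, Ws, hWs⟩ := huStar
  refine ⟨w, ⟨hw, _, (hW.sub hWs (integrable_fst hu) (integrable_fst hs)).congr ?_⟩,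
    ae_of_all _ huw⟩
  refine ae_of_all _ fun t => ?_
  rw [huw, Prod.fst_add, add_sub_cancel_left]

end LimitEquation

/-! ### Uniform estimates for the mollified densities -/

section Densities

variable {n : ℕ} {p lam₀ Lam₀ : ℝ} {E₁ Eₚ ρ : Rn n → ℝ}

lemma IsGrowthConvex.mono {C C' κ κ' : ℝ} {F : Rn n → ℝ} (hF : IsGrowthConvex p C κ F)
    (hC : C ≤ C') (hκ : κ' ≤ κ) : IsGrowthConvex p C' κ' F :=
  ⟨hF.convex, hF.nonneg, fun z => (hF.growth z).trans (by gcongr),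
    fun a b => le_trans (by gcongr) (hF.midpoint a b)⟩

/-- The mollified densities have uniform growth and convexity, and converge at a linear rate. -/
lemma exists_uniform_densities (hp : 1 < p) (hp2 : p ≤ 2) (h₁ : IsOneDensity E₁)
    (hₚ : IsPDensity p lam₀ Lam₀ Eₚ) (hρ : IsMollifier ρ) :
    ∃ C κ K, 0 < κ ∧ 0 ≤ K ∧ IsGrowthConvex p C κ (fun z => E₁ z + Eₚ z) ∧
      ∀ ε ∈ Ioo (0 : ℝ) 1, IsGrowthConvex p C κ (relaxedDensity ρ E₁ Eₚ ε) ∧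
        ContDiff ℝ 1 (relaxedDensity ρ E₁ Eₚ ε) ∧
        ∀ z, |relaxedDensity ρ E₁ Eₚ ε z - (E₁ z + Eₚ z)| ≤ K * ε * (1 + ‖z‖) ^ (p - 1) := by
  obtain ⟨C, hE⟩ := isGrowthConvex_add hp hp2 h₁ hₚ
  have hC := hE.const_nonneg
  have hlam := hₚ.lam_pos
  have h3 : (3 : ℝ) ^ (p - 2) ≤ 1 :=
    Real.rpow_le_one_of_one_le_of_nonpos (by norm_num) (by linarith)
  -- The constants of the mollified densities are weaker than those of `E`, so they serve for both.
  refine ⟨C * 2 ^ p, lam₀ / 8 * 3 ^ (p - 2), C * 4 ^ p, by positivity, by positivity,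
    hE.mono (le_mul_of_one_le_right hC (Real.one_le_rpow (by norm_num) (by linarith)))
      (mul_le_of_le_one_right (by positivity) h3), fun ε hε => ?_⟩
  rw [hρ.relaxedDensity_eq hε.1 h₁.continuous hₚ.contDiff.continuous]
  exact ⟨hρ.isGrowthConvex_mollify hε.1 hε.2.le hp hp2 (by positivity) hE,
    (hρ.contDiff_mollify hε.1 hE.continuous).of_le (by simp),
    hρ.abs_mollify_sub_le hε.1 hε.2.le hp hE⟩

end Densities

lemma exists_strictAnti_seq : ∃ e : ℕ → ℝ, StrictAnti e ∧ (∀ k, e k ∈ Ioo (0 : ℝ) 1) ∧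
    Tendsto e atTop (𝓝 0) := exists_seq_strictAnti_tendsto' zero_lt_one

end OnePLaplace

end

/-! ### Convergence of the approximations and the limit problem -/

theorem mainTheorem2
    {n : ℕ} (hn : 3 ≤ n)
    (p : ℝ) [Fact (1 < p)] (hp : p ≤ 2 * n / (n + 2))
    (Ω : Set (Rn n)) (hΩ : IsOpen Ω) (hΩb : Bornology.IsBounded Ω)
    (T : ℝ) (hT : 0 < T)
    (E₁ Eₚ : Rn n → ℝ) (lam₀ Lam₀ : ℝ)
    (hE₁ : IsOneDensity E₁) (hEₚ : IsPDensity p lam₀ Lam₀ Eₚ)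
    (ρ : Rn n → ℝ) (hρ : IsMollifier ρ)
    (uStar : ℝ → V Ω p) (huStar : MemX Ω p T uStar) (huStarC : MemC Ω p T uStar)
    (τ : ℝ) (hτ : τ ∈ Ioo 0 T)
    (u : ℝ → ℝ → V Ω p)
    (hu : ∀ ε ∈ Ioo (0 : ℝ) 1,
      IsSmoothDirichletSolution Ω p T (relaxedDensity ρ E₁ Eₚ ε) uStar (u ε)) :
    ∃ ε : ℕ → ℝ, StrictAnti ε ∧ (∀ k, ε k ∈ Ioo (0 : ℝ) 1) ∧ Tendsto ε atTop (𝓝 0) ∧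
      ∃ u₀ : ℝ → V Ω p,
        MemAffine Ω p T uStar u₀ ∧
        IsDirichletSolution Ω p (T - τ) E₁ Eₚ uStar u₀ ∧
        (∀ v : ℝ → V Ω p, IsDirichletSolution Ω p (T - τ) E₁ Eₚ uStar v →
          ∀ᵐ t ∂timeMeasure (T - τ), v t = u₀ t) ∧
        ∃ (G : ℕ → Rn n × ℝ → Rn n) (G₀ : Rn n × ℝ → Rn n),
          (∀ k, IsSpaceTimeGradient Ω p (T - τ) (fun t => (u (ε k) t).1) (G k)) ∧
          IsSpaceTimeGradient Ω p (T - τ) (fun t => (u₀ t).1) G₀ ∧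
          (∀ᵐ z ∂volume.restrict (spaceTime Ω (T - τ)),
            Tendsto (fun k => G k z) atTop (𝓝 (G₀ z))) ∧
          Tendsto (fun k => eLpNorm (fun z => G k z - G₀ z) (ENNReal.ofReal p)
            (volume.restrict (spaceTime Ω (T - τ)))) atTop (𝓝 0) := by
  have hp1 : 1 < p := Fact.out
  have hp2 : p ≤ 2 := by
    refine hp.trans ?_
    rw [div_le_iff₀ (by positivity)]
    linarith
  have hle : T - τ ≤ T := sub_le_self _ hτ.1.le
  have hS : 0 < T - τ := sub_pos.2 hτ.2
  have hfin := isFiniteMeasure_spaceTime (T := T) hΩb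
  have hmono : (volume.restrict (spaceTime Ω (T - τ)) : Measure (Rn n × ℝ))
      ≤ volume.restrict (spaceTime Ω T) := Measure.restrict_mono (spaceTime_mono hle) le_rfl
  obtain ⟨C, κ, K, hκ, hK, hE, hF⟩ := exists_uniform_densities hp1 hp2 hE₁ hEₚ hρ
  have hsol := fun ε hε => (hu ε hε).exists_isFluxSolution hΩb (hF ε hε).1 (hF ε hε).2.1
  choose! c W G hsol hflux using hsol
  obtain ⟨M, -, hM⟩ := exists_energy_bound hΩb hp2 hT hκ hK (fun ε hε => (hF ε hε).1)
    -- The triangle inequality through `E₁ + Eₚ` gives the rate `K (ε + δ)`.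
    (fun ε hε δ hδ z => by
      have h1 := (hF ε hε).2.2 z
      have h2 := (hF δ hδ).2.2 z
      rw [abs_sub_comm] at h2
      refine (abs_sub_le _ (E₁ z + Eₚ z) _).trans ((add_le_add h1 h2).trans_eq ?_)
      ring)
    fun ε hε S hS => (hsol ε hε).mono hΩb hS.2 (hflux ε hε)
  obtain ⟨e', he'A, he'I, he'0⟩ := exists_strictAnti_seq
  obtain ⟨w₀, u₀, G₀, c₀, hw₀, hu₀, huw, hc₀, hc₀0, hcw, hG₀, hulim, hGlim⟩ :=
    exists_limit hΩb hp2 hT huStar.1 hsol hM he'I he'0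
  obtain ⟨ns, hns, hae⟩ := exists_seq_tendsto_ae (by simpa using by linarith)
    (fun k => (hsol _ (he'I k)).gradient.1.1) hG₀.1.1 hGlim
  set e : ℕ → ℝ := fun k => e' (ns k) with he
  have heI : ∀ k, e k ∈ Ioo (0 : ℝ) 1 := fun k => he'I _
  have he0 : Tendsto e atTop (𝓝 0) := he'0.comp hns.tendsto_atTop
  have hGlim' := hGlim.comp hns.tendsto_atTop
  -- The fluxes converge only along `U`; this suffices to identify the equation of `u₀`, since the
  -- functions and gradients converge along the whole sequence.
  obtain ⟨Y, hY, hYG, U, hU, hYlim⟩ := exists_flux_limit hp2 (fun k => (hF _ (heI k)).1)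
    (fun k => (hF _ (heI k)).2.1) hE (by simpa using he0.const_mul K)
    (fun k => (hF _ (heI k)).2.2) (fun k => (hsol _ (heI k)).gradient.1) hG₀.1 hGlim'
  obtain ⟨W₀, hW₀, hflux₀⟩ := exists_hasFlux hΩb hY
  have hder : IsTimeDeriv Ω p T (fun t => (u₀ t).1.1) W₀ :=
    isTimeDeriv_of_tendsto hΩb (U := U) (fun k => memLp_fst (hsol _ (heI k)).memLp)
      (memLp_fst hu₀) ((hulim.comp hns.tendsto_atTop).mono_left hU)
      (fun k => (hsol _ (heI k)).deriv) (fun k => hflux _ (heI k))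
      (fun k => (hsol _ (heI k)).flux_memLp) hY hYlim hW₀ hflux₀
  have haff := memAffine_of_isTimeDeriv huStar hw₀ hu₀ huw hder
  obtain ⟨cStar, hcStar, hcuStar⟩ := huStarC
  have hdir : IsDirichletSolution Ω p (T - τ) E₁ Eₚ uStar u₀ := by
    refine isDirichletSolution_of_hasFlux hΩb hE₁ hEₚ (haff.mono hle)
      (hcStar.mono (Icc_subset_Icc_right hle)) (ae_timeMeasure_mono hle hcuStar)
      (hc₀.mono (Icc_subset_Icc_right hle)) (ae_timeMeasure_mono hle ?_) hc₀0
      (hu₀.mono_measure (timeMeasure_mono hle)) (hder.mono hle) (hG₀.mono hle)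
      (hY.mono_measure hmono) ((Measure.absolutelyContinuous_of_le hmono).ae_le hYG)
      (hflux₀.mono hle)
    filter_upwards [hcw] with t ht
    rw [ht, huw, Prod.fst_add, add_sub_cancel_left]
  refine ⟨e, he'A.comp_strictMono hns, heI, he0, u₀, haff, hdir, fun v hv => ?_,
    fun k => G (e k), G₀, fun k => (hsol _ (heI k)).gradient.mono hle, hG₀.mono hle,
    (Measure.absolutelyContinuous_of_le hmono).ae_le hae, ?_⟩
  -- Both solutions carry a flux in `∂(E₁ + Eₚ)`, so the comparison for equal densities applies even
  -- if their fields `Z` differ.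
  · obtain ⟨_, _, _, _, h1⟩ :=
      hv.exists_isFluxSolution hΩb hE hEₚ.convex hEₚ.contDiff
    obtain ⟨_, _, _, _, h2⟩ := hdir.exists_isFluxSolution hΩb hE hEₚ.convex hEₚ.contDiff
    exact h1.ae_eq_of_same_density hn hp2 hΩb hS hκ hE h2
  · exact tendsto_of_tendsto_of_tendsto_of_le_of_le tendsto_const_nhds hGlim'
      (fun _ => zero_le) fun k => eLpNorm_mono_measure _ hmono
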